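/- Let $\Sigma$ be a compact connected oriented cone spherical surface: a compact connected metric surface in which every point has a neighbourhood isometric to a ball about the apex of a spherical cone $\mathrm{d}r^2+\theta^2\sin^2 r\,\mathrm{d}t^2$ ($t\in\mathbb{R}/2\pi\mathbb{Z}$) of angle $2\pi\theta>0$, with $\theta\neq 1$ exactly at the points of a finite set $P$ of cone points. Let $D$ be a developing map of $\Sigma$, i.e. a locally isometric map from the universal cover of $\Sigma\setminus P$ to the unit sphere $\mathbb{S}^2$, equivariant for a monodromy representation $\rho:\pi_1(\Sigma\setminus P)\to \mathrm{SO}(3)$, and suppose that $\rho(\pi_1)$ lies in the group $\mathrm{O}(2)\subset\mathrm{SO}(3)$ of rotations preserving the pair $\{N,S\}$ of north and south pole. The foliations of $\mathbb{S}^2\setminus\{N,S\}$ by latitude circles and by meridians are then pulled back by $D$ to a pair $(F,G)$ of transverse foliations of $\Sigma$, the latitude and the longitude foliation, and $(\Sigma;F,G)$ is called a foliated dihedral surface. The set $Q$ of poles consists of the points of $\Sigma$ over which (the continuous extension of) $D$ takes values in $\{N,S\}$; the points of $P\setminus Q$ are the zeros. Let $\mathrm{Crit}(G)$ be the union of the zeros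 and of all leaves of $G$ starting at a zero, each followed until it reaches the next point of $P\cup Q$ and taken with its endpoints. The bigons $B_1,\dots,B_b$ of the strip decomposition are the connected components of $\Sigma\setminus(\mathrm{Crit}(G)\cup Q)$; each is a union of leaves of $G$ of length $\pi$ that all have the same two (possibly equal) endpoints in $Q=\{q_1,\dots,q_m\}$, to which the two vertices of the bigon are said to be glued. The surface $(\Sigma;F,G)$ is generic if no leaf of $G$ connects two (possibly equal) zeros; if there is a zero, this means that each side of each bigon contains exactly one zero. The connection matrix $\mathbf{M}$ is the $m\times b$ matrix with $\mathbf{M}_{ij}=2$ if both vertices of $B_j$ are glued to $q_i$, $\mathbf{M}_{ij}=1$ if exactly one of them is glued to $q_i$, and $\mathbf{M}_{ij}=0$ otherwise. A foliation is orientable if outside $P\cup Q$ its leaves have a globally continuous orientation, and $(F,G)$ is orientable if both $F$ and $G$ are. For every generic foliated dihedral surface $(\Sigma;F,G)$, the numbers $m$ and $b$ are finite, and: 1. $\operatorname{rank}(\mathbf{M})\ge m-1$; 2. $(F,G)$ is orientable if and only if $\operatorname{rank}(\mathbf{M})=m-1$; moreover, $F$ is orientable if and only if $G$ is. -/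

import Mathlib

open Real Set Filter Topology

universe u v

/-- Euclidean three-space. -/
abbrev E3 : Type := EuclideanSpace ℝ (Fin 3)

/-- The unit two-sphere. -/
abbrev S2 : Type := Metric.sphere (0 : E3) 1

/-- The north pole of the unit sphere; the south pole is `-north`. -/
noncomputable def north : E3 := !₂[0, 0, 1]

/-- Spherical coordinates on the unit sphere: longitude `ψ` and colatitude `φ`. -/
noncomputable def sph (ψ φ : ℝ) : E3 := !₂[cos ψ * sin φ, sin ψ * sin φ, cos φ]

/-- The direction of the latitude circle through the point `x` of the sphere. -/
noncomputable def latDir (x : E3) : E3 := !₂[-x 1, x 0, 0]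

/-- The direction of the meridian through the point `x` of the sphere: the orthogonal projection of
`north` to the tangent plane at `x`. -/
noncomputable def lonDir (x : E3) : E3 := north - x 2 • x

/-- `A` is a rotation, that is, an element of `SO(3) = PSU(2)`. -/
def IsRotation (A : E3 ≃ₗᵢ[ℝ] E3) : Prop :=
  LinearMap.det (A.toLinearEquiv : E3 →ₗ[ℝ] E3) = 1

/-- `A` lies in the subgroup `O(2)` of `SO(3)` of all rotations that preserve the pair of antipodal
points `{north, -north}`, i.e. the maps `z ↦ exp(iθ) z` and `z ↦ exp(iθ) / z` of the Riemann
sphere. -/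
def IsAxisPreserving (A : E3 ≃ₗᵢ[ℝ] E3) : Prop :=
  IsRotation A ∧ (A north = north ∨ A north = -north)

/-- The distance on the spherical cone of total angle `2πθ` (whose metric is
`dr² + θ² sin² r dt²`, `t ∈ ℝ/2πℤ`) between two points in geodesic polar coordinates `(r, ψ)`, where
`ψ = θ t` is taken modulo `2πθ`: the spherical law of cosines, with the angle at the apex replaced
by `π` (a geodesic through the apex) if it exceeds `π`. -/
noncomputable def coneDist (θ : ℝ) (r₁ : ℝ) (ψ₁ : AddCircle (2 * π * θ)) (r₂ : ℝ)
    (ψ₂ : AddCircle (2 * π * θ)) : ℝ :=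
  arccos (cos r₁ * cos r₂ + sin r₁ * sin r₂ * cos (min ‖ψ₁ - ψ₂‖ π))

/-- Some metric ball about `x` is isometric, by polar coordinates `e` centred at `x`, to the ball of
the same radius about the apex of the spherical cone of angle `2πθ`. -/
def HasConeAngle {X : Type u} [MetricSpace X] (x : X) (θ : ℝ) : Prop :=
  0 < θ ∧ ∃ r : ℝ, 0 < r ∧ r ≤ π ∧ ∃ e : ℝ → AddCircle (2 * π * θ) → X,
    (∀ ψ, e 0 ψ = x) ∧
    (∀ r₁ ∈ Ico 0 r, ∀ r₂ ∈ Ico 0 r, ∀ ψ₁ ψ₂,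
      dist (e r₁ ψ₁) (e r₂ ψ₂) = coneDist θ r₁ ψ₁ r₂ ψ₂) ∧
    (∀ y ∈ Metric.ball x r, ∃ r₁ ∈ Ico 0 r, ∃ ψ, e r₁ ψ = y)

/-- A cone spherical structure on the metric space `X`: every point has a neighbourhood isometric to
a spherical cone, of angle `2πθ` with `θ ≠ 1` at finitely many cone points, and of angle `2π`
elsewhere. (Compactness and connectedness of `X` are assumed separately, and orientability follows
from the existence of a developing map with monodromy in `SO(3)`.) -/
structure ConeSphericalSurface (X : Type u) [MetricSpace X] where
  /-- the set `P` of cone points -/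
  conePts : Set X
  finite_conePts : conePts.Finite
  conePts_spec : ∀ x ∈ conePts, ∃ θ : ℝ, θ ≠ 1 ∧ HasConeAngle x θ
  smooth_spec : ∀ x ∉ conePts, HasConeAngle x 1

/-- A developing map of a cone spherical surface: a locally isometric map `dev` from the universal
cover of the surface punctured at its cone points to the unit sphere, equivariant for a monodromy
representation in `SO(3)`. The surface is oriented so that `dev` preserves orientation. -/
structure DevelopingMap {X : Type u} [MetricSpace X] (S : ConeSphericalSurface X) where
  /-- the universal cover of the punctured surface -/
  Cover : Type v
  [top : TopologicalSpace Cover]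
  [simplyConnected : SimplyConnectedSpace Cover]
  /-- the universal covering map -/
  proj : Cover → {x : X // x ∉ S.conePts}
  isCoveringMap : IsCoveringMap proj
  surjective : Function.Surjective proj
  /-- the developing map -/
  dev : Cover → S2
  locallyIsometric : ∀ y, ∃ U ∈ 𝓝 y, ∀ a ∈ U, ∀ b ∈ U,
    InnerProductGeometry.angle (dev a : E3) (dev b : E3) = dist (proj a) (proj b)
  equivariant : ∀ γ : Cover ≃ₜ Cover, (∀ y, proj (γ y) = proj y) →
    ∃ A : E3 ≃ₗᵢ[ℝ] E3, IsRotation A ∧ ∀ y, (dev (γ y) : E3) = A (dev y)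

attribute [instance] DevelopingMap.top DevelopingMap.simplyConnected

namespace DevelopingMap

variable {X : Type u} [MetricSpace X] {S : ConeSphericalSurface X} (D : DevelopingMap.{u, v} S)

/-- `γ` is a deck transformation of the universal cover, i.e. an element of the fundamental group of
the punctured surface. -/
def IsDeck (γ : D.Cover ≃ₜ D.Cover) : Prop := ∀ y, D.proj (γ y) = D.proj y

/-- `A` is the monodromy of the deck transformation `γ`. -/
def IsMonodromy (γ : D.Cover ≃ₜ D.Cover) (A : E3 ≃ₗᵢ[ℝ] E3) : Prop :=
  IsRotation A ∧ ∀ y, (D.dev (γ y) : E3) = A (D.dev y)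

/-- The monodromy group lies in `O(2)`. In this case the surface is dihedral, the latitude foliation
and the longitude foliation of the sphere pull back to `Cover` and descend to the surface, and `D`
makes the surface a foliated dihedral surface `(Σ; F, G)`. -/
def IsDihedral : Prop :=
  ∀ γ, D.IsDeck γ → ∀ A, D.IsMonodromy γ A → IsAxisPreserving A

/-- The set `Q` of poles of the foliations: the points `q` over which the (extended) developing map
takes values in `{north, -north}`, i.e. at which the absolute latitude function, the continuous
extension of `|cos φ|` from the punctured surface to the surface, has the value `1`. -/
def poles : Set X :=
  {q | Tendsto (fun y => |(D.dev y : E3) 2|) (comap (fun y => (D.proj y : X)) (𝓝 q)) (𝓝 1)}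

/-- The zeros of the foliations: the cone points that are not poles. -/
def zeros : Set X := S.conePts \ D.poles

/-- `c` restricted to `[a, b]` is a closed segment of a leaf of the longitude foliation `G`, whose
interior contains no singularity (neither a cone point nor a pole): a lift of its interior is
developed into a meridian, the parameter being the colatitude. The endpoints may be singularities;
every leaf segment can be parametrized in this way, after reversing it if need be. -/
def IsLeafSegment (c : ℝ → X) (a b : ℝ) : Prop :=
  0 ≤ a ∧ a < b ∧ b ≤ π ∧ ContinuousOn c (Icc a b) ∧
    ∃ (ψ : ℝ) (c' : ℝ → D.Cover), ContinuousOn c' (Ioo a b) ∧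
      ∀ t ∈ Ioo a b, (D.proj (c' t) : X) = c t ∧ (D.dev (c' t) : E3) = sph ψ t

/-- `Crit(G)`: the union of all leaves of `G` that start at a zero, with their endpoints. -/
def crit : Set X :=
  D.zeros ∪ {x | ∃ c a b, D.IsLeafSegment c a b ∧ (c a ∈ D.zeros ∨ c b ∈ D.zeros) ∧
    x ∈ c '' Icc a b}

/-- The foliated surface is generic: there is no leaf of `G` connecting two (possibly equal)
zeros. Equivalently (if there is a zero at all), each of the two sides of each bigon of the strip
decomposition contains exactly
one zero. -/
def IsGeneric : Prop :=
  ¬ ∃ c a b, D.IsLeafSegment c a b ∧ c a ∈ D.zeros ∧ c b ∈ D.zeros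

/-- The poles, as a type. -/
abbrev Pole : Type u := D.poles

/-- The (open) bigons of the strip decomposition: the connected components of the complement of the
critical leaves and of the poles. (As soon as there is a zero, all poles lie on critical leaves.) -/
def Bigon : Type u :=
  {B : Set X // ∃ x ∈ (D.crit ∪ D.poles)ᶜ, B = connectedComponentIn (D.crit ∪ D.poles)ᶜ x}

variable {D} in
/-- The two vertices of the bigon `B` are glued to the poles `p` and `q`: these are the endpoints of
a leaf of `G`, of length `π`, inside `B`. -/
def Bigon.HasVertices (B : D.Bigon) (p q : D.Pole) : Prop :=
  ∃ c, D.IsLeafSegment c 0 π ∧ c '' Ioo 0 π ⊆ B.1 ∧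
    ((c 0 = p ∧ c π = q) ∨ (c 0 = q ∧ c π = p))

open Classical in
/-- The connection matrix, with rows indexed by poles and columns by bigons: the entry is `2` if both
vertices of the bigon are glued to the pole, `1` if exactly one of them is, and `0` otherwise. -/
noncomputable def connectionMatrix : Matrix D.Pole D.Bigon ℝ :=
  fun q B => if B.HasVertices q q then 2 else if ∃ p, p ≠ q ∧ B.HasVertices q p then 1 else 0

/-- The foliation of the surface induced by the foliation of the sphere with tangent direction
`ℓ x` at `x` is orientable: outside the singularities it has a continuous nowhere vanishing tangent
vector field. The vector field is given on the universal cover, where it is developed into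
`ℝ³`, and descends to the surface since it is equivariant. -/
def FoliationOrientable (ℓ : E3 → E3) : Prop :=
  ∃ V : D.Cover → E3,
    ContinuousOn V {y | (D.dev y : E3) ≠ north ∧ (D.dev y : E3) ≠ -north} ∧
    (∀ y, (D.dev y : E3) ≠ north → (D.dev y : E3) ≠ -north →
      ∃ k : ℝ, k ≠ 0 ∧ V y = k • ℓ (D.dev y)) ∧
    ∀ γ, D.IsDeck γ → ∀ A, D.IsMonodromy γ A →
      ∀ y, (D.dev y : E3) ≠ north → (D.dev y : E3) ≠ -north → V (γ y) = A (V y)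

/-- The latitude foliation `F` is orientable. -/
def LatitudeOrientable : Prop := D.FoliationOrientable latDir

/-- The longitude foliation `G` is orientable. -/
def LongitudeOrientable : Prop := D.FoliationOrientable lonDir

/-- The pair `(F, G)` is orientable. -/
def PairOrientable : Prop := D.LatitudeOrientable ∧ D.LongitudeOrientable

end DevelopingMap

/-! ### Linear algebra of the unit sphere -/

/-! A row vector `f` on the poles is killed by the connection matrix exactly when `f p + f q = 0`
for every bigon with vertices `p`, `q`, that is, when `f` takes opposite values at the two ends of
every leaf of length π (`vecMul_connectionMatrix_eq_zero_iff`). Everything reduces to these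
alternating functions.

Spread `f` over the universal cover: a leaf ending at the pole `q` in the direction of `σ • north`
gets the value `σ * f q`. On a generic surface every leaf has an end at a pole (`exists_isValue`).
If both ends are poles, the two values agree because `f` is alternating. The value is locally
constant because the set of points whose leaf ends at a given pole is open (`isOpen_setOf_ends`).
Its absolute value extends across the poles, and the cover is connected, so `|f|` is constant
(`IsAlternating.abs_eq`). An alternating function with one zero therefore vanishes, the left kernel
has dimension at most 1, and the rank is at least m - 1.

A nonzero alternating `f` makes the value on the cover a nowhere vanishing function that a deck
transformation multiplies by the sign ε with which its monodromy acts on `north`: an orientation of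
the direction towards north. Conversely such an orientation has a definite sign at each pole,
opposite at the two ends of a leaf of length π. A rotation in O(2) multiplies both the latitude and
the meridian direction by the same ε, so orientability of `F`, of `G` and of the pair all mean that
such a function exists.

For finiteness, poles are isolated and the surface is compact. Each bigon crosses a small circle
about a pole. This circle meets finitely many critical leaves: a zero emits leaves in finitely many
directions only, and by genericity each of these can be followed back to the zero from at most one
point of the circle.

The local tool is the cone chart (`nonempty_coneChart`): polar coordinates about any point, lifted
to the cover, develop to spherical coordinates up to one linear isometry. -/

theorem E3.inner_eq (x y : E3) : inner ℝ x y = x 0 * y 0 + x 1 * y 1 + x 2 * y 2 := by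
  simp [PiLp.inner_apply, Fin.sum_univ_three, mul_comm]

theorem E3.ext_coords {x y : E3} (h0 : x 0 = y 0) (h1 : x 1 = y 1) (h2 : x 2 = y 2) : x = y := by
  ext i; fin_cases i <;> assumption

@[simp] theorem north_zero : north 0 = 0 := rfl
@[simp] theorem north_one : north 1 = 0 := rfl
@[simp] theorem north_two : north 2 = 1 := rfl

theorem norm_north : ‖north‖ = 1 := by
  have : ‖north‖ ^ 2 = 1 := by
    rw [← real_inner_self_eq_norm_sq, E3.inner_eq]; simp
  nlinarith [norm_nonneg north]

theorem inner_north (x : E3) : inner ℝ x north = x 2 := by simp [E3.inner_eq]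

/-- Spherical coordinates about the pole `σ • north`, where `σ = ±1`. -/
noncomputable def sphAt (σ ψ φ : ℝ) : E3 := !₂[cos ψ * sin φ, sin ψ * sin φ, σ * cos φ]

@[simp] theorem sphAt_zero (σ ψ φ : ℝ) : sphAt σ ψ φ 0 = cos ψ * sin φ := rfl
@[simp] theorem sphAt_one (σ ψ φ : ℝ) : sphAt σ ψ φ 1 = sin ψ * sin φ := rfl
@[simp] theorem sphAt_two (σ ψ φ : ℝ) : sphAt σ ψ φ 2 = σ * cos φ := rfl
@[simp] theorem sph_zero (ψ φ : ℝ) : sph ψ φ 0 = cos ψ * sin φ := rfl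
@[simp] theorem sph_one (ψ φ : ℝ) : sph ψ φ 1 = sin ψ * sin φ := rfl
@[simp] theorem sph_two (ψ φ : ℝ) : sph ψ φ 2 = cos φ := rfl

theorem sphAt_one_eq (ψ φ : ℝ) : sphAt 1 ψ φ = sph ψ φ := by
  apply E3.ext_coords <;> simp

theorem sphAt_neg_eq (σ ψ φ : ℝ) : sphAt (-σ) ψ φ = sphAt σ ψ (π - φ) := by
  apply E3.ext_coords <;> simp

theorem sphAt_colat_zero (σ ψ : ℝ) : sphAt σ ψ 0 = σ • north := by
  apply E3.ext_coords <;> simp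

theorem sph_colat_zero (ψ : ℝ) : sph ψ 0 = north := by
  apply E3.ext_coords <;> simp

theorem continuous_sphAt (σ : ℝ) : Continuous fun p : ℝ × ℝ => sphAt σ p.1 p.2 := by
  unfold sphAt
  apply (PiLp.continuous_toLp 2 _).comp
  refine continuous_pi fun i => ?_
  fin_cases i <;> simp <;> fun_prop

theorem inner_sph (ψ₁ φ₁ ψ₂ φ₂ : ℝ) : inner ℝ (sph ψ₁ φ₁) (sph ψ₂ φ₂) =
    cos φ₁ * cos φ₂ + sin φ₁ * sin φ₂ * cos (ψ₁ - ψ₂) := by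
  rw [E3.inner_eq, cos_sub]; simp; ring

theorem norm_sph (ψ φ : ℝ) : ‖sph ψ φ‖ = 1 := by
  have : ‖sph ψ φ‖ ^ 2 = 1 := by
    rw [← real_inner_self_eq_norm_sq, inner_sph]; simp [← sq]
  nlinarith [norm_nonneg (sph ψ φ)]

/-- An inner-product-preserving map between families of vectors, the first of which spans, is
induced by a linear isometry. -/
theorem exists_linearIsometryEquiv_of_inner_eq {ι : Type*} (u f : ι → E3)
    (h : ∀ i j, inner ℝ (f i) (f j) = inner ℝ (u i) (u j))
    (hu : Submodule.span ℝ (range u) = ⊤) : ∃ A : E3 ≃ₗᵢ[ℝ] E3, ∀ i, f i = A (u i) := by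
  set U := Finsupp.linearCombination ℝ u
  set T := Finsupp.linearCombination ℝ f
  have hn : ∀ c, ‖T c‖ = ‖U c‖ := fun c => by
    have : ‖T c‖ ^ 2 = ‖U c‖ ^ 2 := by
      rw [← real_inner_self_eq_norm_sq, ← real_inner_self_eq_norm_sq]
      simp only [T, U, Finsupp.linearCombination_apply, Finsupp.sum, sum_inner, inner_sum,
        inner_smul_left, inner_smul_right, h]
    exact (pow_left_inj₀ (norm_nonneg _) (norm_nonneg _) two_ne_zero).1 this
  have hU : LinearMap.range U = ⊤ := by rw [Finsupp.range_linearCombination, hu]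
  obtain ⟨s, hs⟩ := U.exists_rightInverse_of_surjective hU
  have hs' : ∀ v, U (s v) = v := fun v => LinearMap.congr_fun hs v
  -- `T` and `U` have equal norms on every combination, so `T` vanishes wherever `U` does, and `T ∘
  -- s` does not depend on the right inverse `s`.
  let A : E3 →ₗᵢ[ℝ] E3 := ⟨T ∘ₗ s, fun v => by simp [hn, hs']⟩
  have hA : ∀ c, A (U c) = T c := fun c => by
    have : ‖T (s (U c) - c)‖ = 0 := by rw [hn]; simp [hs']
    have := norm_eq_zero.1 this
    rw [map_sub, sub_eq_zero] at this
    exact this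
  refine ⟨A.toLinearIsometryEquiv rfl, fun i => ?_⟩
  have := hA (Finsupp.single i 1)
  simpa [U, T] using this.symm

/-- The four vectors are the corners of a coordinate rectangle. Elimination along each meridian,
then between the two meridians, leaves 2 × 2 systems whose determinants are the two sines. -/
theorem eq_zero_of_inner_sph {a b c d : ℝ} (hab : sin (a - b) ≠ 0) (hcd : sin (c - d) ≠ 0) {w : E3}
    (hac : inner ℝ w (sph a c) = 0) (had : inner ℝ w (sph a d) = 0)
    (hbc : inner ℝ w (sph b c) = 0) (hbd : inner ℝ w (sph b d) = 0) : w = 0 := by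
  rw [sin_sub] at hab hcd
  simp only [E3.inner_eq, sph_zero, sph_one, sph_two] at hac had hbc hbd
  have h2 : w 2 = 0 := by
    have : (w 2) * (sin c * cos d - cos c * sin d) = 0 := by
      linear_combination sin c * had - sin d * hac
    exact (mul_eq_zero.1 this).resolve_right hcd
  have ha : w 0 * cos a + w 1 * sin a = 0 := by
    have : (w 0 * cos a + w 1 * sin a) * (sin c * cos d - cos c * sin d) = 0 := by
      linear_combination cos d * hac - cos c * had
    exact (mul_eq_zero.1 this).resolve_right hcd
  have hb : w 0 * cos b + w 1 * sin b = 0 := by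
    have : (w 0 * cos b + w 1 * sin b) * (sin c * cos d - cos c * sin d) = 0 := by
      linear_combination cos d * hbc - cos c * hbd
    exact (mul_eq_zero.1 this).resolve_right hcd
  have h0 : w 0 = 0 := by
    have : w 0 * (sin a * cos b - cos a * sin b) = 0 := by
      linear_combination sin a * hb - sin b * ha
    exact (mul_eq_zero.1 this).resolve_right hab
  have h1 : w 1 = 0 := by
    have : w 1 * (sin a * cos b - cos a * sin b) = 0 := by
      linear_combination cos b * ha - cos a * hb
    exact (mul_eq_zero.1 this).resolve_right hab
  exact E3.ext_coords h0 h1 h2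

/-- Spherical coordinate rectangles span. -/
theorem span_eq_top_of_sph_mem {s : Set E3} {I J : Set ℝ} {a b c d : ℝ}
    (ha : a ∈ I) (hb : b ∈ I) (hc : c ∈ J) (hd : d ∈ J)
    (hab : sin (a - b) ≠ 0) (hcd : sin (c - d) ≠ 0) (hs : ∀ ψ ∈ I, ∀ φ ∈ J, sph ψ φ ∈ s) :
    Submodule.span ℝ s = ⊤ := by
  rw [← Submodule.orthogonal_eq_bot_iff, Submodule.eq_bot_iff]
  intro w hw
  have key : ∀ ψ ∈ I, ∀ φ ∈ J, inner ℝ w (sph ψ φ) = 0 := fun ψ hψ φ hφ =>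
    Submodule.inner_left_of_mem_orthogonal (Submodule.subset_span (hs ψ hψ φ hφ)) hw
  exact eq_zero_of_inner_sph hab hcd (key a ha c hc) (key a ha d hd) (key b hb c hc)
    (key b hb d hd)

theorem linearIsometryEquiv_ext_of_span {s : Set E3} (hs : Submodule.span ℝ s = ⊤)
    {A B : E3 ≃ₗᵢ[ℝ] E3} (h : ∀ x ∈ s, A x = B x) : A = B := by
  have : (A.toLinearEquiv : E3 →ₗ[ℝ] E3) = B.toLinearEquiv :=
    LinearMap.ext_on hs fun x hx => h x hx
  ext1 x
  exact LinearMap.congr_fun this x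

theorem sq_add_sq_add_sq_eq_one {x : E3} (hx : ‖x‖ = 1) : x 0 ^ 2 + x 1 ^ 2 + x 2 ^ 2 = 1 := by
  have h : inner ℝ x x = 1 := by rw [real_inner_self_eq_norm_sq, hx]; norm_num
  rw [E3.inner_eq] at h; linarith

theorem exists_angle_of_sq_add_sq {a b ρ : ℝ} (hρ : 0 ≤ ρ) (h : a ^ 2 + b ^ 2 = ρ ^ 2) :
    ∃ ψ : ℝ, a = cos ψ * ρ ∧ b = sin ψ * ρ := by
  refine ⟨Complex.arg ⟨a, b⟩, ?_⟩
  have hn : ‖(⟨a, b⟩ : ℂ)‖ = ρ := by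
    have h1 := Complex.sq_norm (⟨a, b⟩ : ℂ)
    rw [Complex.normSq_mk] at h1
    exact (pow_left_inj₀ (norm_nonneg _) hρ two_ne_zero).1 (by rw [h1]; linarith)
  have h1 := Complex.norm_mul_cos_arg (⟨a, b⟩ : ℂ)
  have h2 := Complex.norm_mul_sin_arg (⟨a, b⟩ : ℂ)
  rw [hn] at h1 h2
  exact ⟨by rw [mul_comm]; exact h1.symm, by rw [mul_comm]; exact h2.symm⟩

theorem abs_two_le_one {x : E3} (hx : ‖x‖ = 1) : |x 2| ≤ 1 := by
  rw [← sq_le_one_iff_abs_le_one]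
  nlinarith [sq_add_sq_add_sq_eq_one hx, sq_nonneg (x 0), sq_nonneg (x 1)]

theorem exists_sphAt_eq {x : E3} (hx : ‖x‖ = 1) {σ φ : ℝ} (hσ : σ * σ = 1) (h : x 2 = σ * cos φ)
    (h0 : 0 ≤ φ) (h1 : φ ≤ π) : ∃ ψ, x = sphAt σ ψ φ := by
  have h2 := sq_add_sq_add_sq_eq_one hx
  obtain ⟨ψ, ha, hb⟩ := exists_angle_of_sq_add_sq (a := x 0) (b := x 1)
    (sin_nonneg_of_nonneg_of_le_pi h0 h1)
    (by rw [sin_sq]; rw [h] at h2; linear_combination h2 - cos φ ^ 2 * hσ)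
  exact ⟨ψ, E3.ext_coords ha hb h⟩

theorem norm_sphAt {σ : ℝ} (hσ : σ * σ = 1) (ψ φ : ℝ) : ‖sphAt σ ψ φ‖ = 1 := by
  have : ‖sphAt σ ψ φ‖ ^ 2 = 1 := by
    rw [← real_inner_self_eq_norm_sq, E3.inner_eq]; simp
    linear_combination cos φ ^ 2 * hσ + sin φ ^ 2 * sin_sq_add_cos_sq ψ + sin_sq_add_cos_sq φ
  nlinarith [norm_nonneg (sphAt σ ψ φ)]

theorem exists_sph_eq {x : E3} (hx : ‖x‖ = 1) : ∃ ψ φ, φ ∈ Icc 0 π ∧ x = sph ψ φ := by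
  have h := abs_le.1 (abs_two_le_one hx)
  obtain ⟨ψ, hψ⟩ := exists_sphAt_eq hx (σ := 1) (φ := arccos (x 2)) (by norm_num)
    (by rw [cos_arccos h.1 h.2, one_mul]) (arccos_nonneg _) (arccos_le_pi _)
  exact ⟨ψ, _, ⟨arccos_nonneg _, arccos_le_pi _⟩, by rw [hψ, sphAt_one_eq]⟩

/-- Meridians through a common point coincide. -/
theorem sphAt_congr {σ ψ ψ' φ : ℝ} (hφ : φ ∈ Ioo 0 π) (h : sphAt σ ψ φ = sphAt σ ψ' φ) (t : ℝ) :
    sphAt σ ψ t = sphAt σ ψ' t := by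
  have hs := (sin_pos_of_mem_Ioo hφ).ne'
  have h0 : cos ψ = cos ψ' := mul_right_cancel₀ hs (congrArg (fun x : E3 => x 0) h)
  have h1 : sin ψ = sin ψ' := mul_right_cancel₀ hs (congrArg (fun x : E3 => x 1) h)
  simp [sphAt, h0, h1]

theorem IsAxisPreserving.exists_sign {A : E3 ≃ₗᵢ[ℝ] E3} (hA : IsAxisPreserving A) :
    ∃ ε : ℝ, ε * ε = 1 ∧ A north = ε • north := by
  rcases hA.2 with h | h
  · exact ⟨1, by norm_num, by simpa using h⟩
  · exact ⟨-1, by norm_num, by simpa using h⟩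

theorem map_two_of_map_north {A : E3 ≃ₗᵢ[ℝ] E3} {ε : ℝ} (hε : ε * ε = 1)
    (hA : A north = ε • north) (x : E3) : A x 2 = ε * x 2 := by
  have h : inner ℝ (A x) (A north) = x 2 := by rw [A.inner_map_map, inner_north]
  rw [hA, inner_smul_right, inner_north] at h
  linear_combination ε * h - (A x) 2 * hε

/-- A linear isometry preserving the axis maps meridians to meridians. -/
theorem exists_map_sphAt {A : E3 ≃ₗᵢ[ℝ] E3} {ε : ℝ} (hε : ε * ε = 1)
    (hA : A north = ε • north) {σ : ℝ} (hσ : σ * σ = 1) (ψ : ℝ) :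
    ∃ ψ', ∀ t, A (sphAt σ ψ t) = sphAt (ε * σ) ψ' t := by
  have hεσ : (ε * σ) * (ε * σ) = 1 := by linear_combination σ * σ * hε + hσ
  obtain ⟨ψ', h⟩ := exists_sphAt_eq (x := A (sphAt σ ψ (π / 2))) (σ := ε * σ) (φ := π / 2)
    (by rw [A.norm_map, norm_sphAt hσ]) hεσ
    (by rw [map_two_of_map_north hε hA]; simp) (by positivity) (by linarith [pi_pos])
  refine ⟨ψ', fun t => ?_⟩
  -- A meridian lies on the circle spanned by its equator point and `north`, so the image of the
  -- equator point determines the image of the meridian.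
  have h1 : ∀ τ χ : ℝ, sphAt τ χ t = sin t • sphAt τ χ (π / 2) + (τ * cos t) • north := by
    intro τ χ
    apply E3.ext_coords <;> simp [mul_comm]
  rw [h1, h1 (ε * σ), map_add, map_smul, map_smul, hA, h, smul_smul]
  congr 2; ring

/-! ### Polar coordinates -/

theorem cos_norm_coe (η : ℝ) : cos ‖(η : AddCircle (2 * π * 1))‖ = cos η := by
  rw [AddCircle.norm_eq, cos_abs, mul_one, cos_sub_int_mul_two_pi]

/-- On a circle of length 2π no two points are further apart than π, so for θ = 1 the truncation in
`coneDist` never acts. -/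
theorem cos_coneDist_one (s₁ η₁ s₂ η₂ : ℝ) :
    cos (coneDist 1 s₁ (η₁ : AddCircle (2 * π * 1)) s₂ (η₂ : AddCircle (2 * π * 1))) =
      inner ℝ (sph η₁ s₁) (sph η₂ s₂) := by
  have hle : ‖((η₁ - η₂ : ℝ) : AddCircle (2 * π * 1))‖ ≤ π := by
    refine (AddCircle.norm_le_half_period (2 * π * 1) (by positivity)).trans_eq ?_
    rw [mul_one, abs_of_pos (by positivity), mul_div_cancel_left₀ _ two_ne_zero]
  rw [coneDist, ← AddCircle.coe_sub, min_eq_left hle, cos_norm_coe, ← inner_sph]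
  have h := abs_le.1 (abs_real_inner_le_norm (sph η₁ s₁) (sph η₂ s₂))
  rw [norm_sph, norm_sph, one_mul] at h
  exact cos_arccos h.1 h.2

/-- Longitudes that differ by at most half the cone angle need no reduction modulo the period, and
if they differ by at most π no truncation either: away from the apex a cone is locally a piece of
the sphere. -/
theorem cos_coneDist_of_near {θ : ℝ} (hθ : 0 < θ) (s₁ s₂ : ℝ) {η₁ η₂ : ℝ} (h : |η₁ - η₂| ≤ π * θ)
    (h' : |η₁ - η₂| ≤ π) :
    cos (coneDist θ s₁ (η₁ : AddCircle (2 * π * θ)) s₂ (η₂ : AddCircle (2 * π * θ))) =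
      inner ℝ (sph η₁ s₁) (sph η₂ s₂) := by
  have hp : 0 < 2 * π * θ := by positivity
  have hn : ‖((η₁ - η₂ : ℝ) : AddCircle (2 * π * θ))‖ = |η₁ - η₂| := by
    rw [AddCircle.norm_coe_eq_abs_iff _ hp.ne', abs_of_pos hp]
    linarith
  rw [coneDist, ← AddCircle.coe_sub, hn, min_eq_left h', cos_abs, ← inner_sph]
  have h := abs_le.1 (abs_real_inner_le_norm (sph η₁ s₁) (sph η₂ s₂))
  rw [norm_sph, norm_sph, one_mul] at h
  exact cos_arccos h.1 h.2

/-- Polar coordinates `e` on the ball of radius `r ≤ 1` about `x`. -/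
structure IsPolar {X : Type u} [MetricSpace X] (x : X) (θ r : ℝ)
    (e : ℝ → AddCircle (2 * π * θ) → X) : Prop where
  angle_pos : 0 < θ
  radius_pos : 0 < r
  radius_le : r ≤ 1
  center : ∀ ψ, e 0 ψ = x
  dist_eq : ∀ r₁ ∈ Ico 0 r, ∀ r₂ ∈ Ico 0 r, ∀ ψ₁ ψ₂,
      dist (e r₁ ψ₁) (e r₂ ψ₂) = coneDist θ r₁ ψ₁ r₂ ψ₂
  surj : ∀ y ∈ Metric.ball x r, ∃ r₁ ∈ Ico 0 r, ∃ ψ, e r₁ ψ = y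

/-- The radial coordinate is the distance to the centre, so a chart may be shrunk. Radius at most 1
keeps the cosine of the radial coordinate positive. -/
theorem HasConeAngle.exists_isPolar {X : Type u} [MetricSpace X] {x : X} {θ : ℝ}
    (h : HasConeAngle x θ) {U : Set X} (hU : U ∈ 𝓝 x) :
    ∃ r e, IsPolar x θ r e ∧ Metric.ball x r ⊆ U := by
  obtain ⟨hθ, r, hr, hrπ, e, he0, hd, hs⟩ := h
  obtain ⟨ρ, hρ, hρU⟩ := Metric.mem_nhds_iff.1 hU
  have hlt : min (min r ρ) 1 ≤ r := (min_le_left _ _).trans (min_le_left _ _)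
  refine ⟨min (min r ρ) 1, e, ⟨hθ, by positivity, min_le_right _ _, he0, ?_, ?_⟩, ?_⟩
  · exact fun r₁ h₁ r₂ h₂ => hd r₁ ⟨h₁.1, h₁.2.trans_le hlt⟩ r₂ ⟨h₂.1, h₂.2.trans_le hlt⟩
  · intro y hy
    obtain ⟨r₁, h₁, ψ, rfl⟩ := hs y (Metric.ball_subset_ball hlt hy)
    refine ⟨r₁, ⟨h₁.1, ?_⟩, ψ, rfl⟩
    rw [Metric.mem_ball, ← he0 ψ, hd r₁ h₁ 0 ⟨le_rfl, hr⟩, coneDist] at hy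
    simpa [arccos_cos h₁.1 (h₁.2.le.trans hrπ)] using hy
  · exact (Metric.ball_subset_ball ((min_le_left _ _).trans (min_le_right _ _))).trans hρU

namespace IsPolar

variable {X : Type u} [MetricSpace X] {x : X} {θ r : ℝ} {e : ℝ → AddCircle (2 * π * θ) → X}
  (h : IsPolar x θ r e)
include h

theorem radius_lt_pi : r < π := by linarith [h.radius_le, pi_gt_three]

theorem dist_center {s : ℝ} (hs : s ∈ Ico 0 r) (ψ : AddCircle (2 * π * θ)) :
    dist (e s ψ) x = s := by
  rw [← h.center ψ, h.dist_eq s hs 0 ⟨le_rfl, h.radius_pos⟩, coneDist]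
  simp [arccos_cos hs.1 (hs.2.le.trans h.radius_lt_pi.le)]

theorem continuousOn : ContinuousOn (fun p : ℝ × ℝ => e p.1 (p.2 : AddCircle (2 * π * θ)))
    (Ico 0 r ×ˢ univ) := by
  intro p hp
  rw [ContinuousWithinAt, tendsto_iff_dist_tendsto_zero]
  have hc : Continuous fun q : ℝ × ℝ =>
      coneDist θ q.1 (q.2 : AddCircle (2 * π * θ)) p.1 (p.2 : AddCircle (2 * π * θ)) := by
    unfold coneDist
    have : Continuous fun q : ℝ × ℝ => (q.2 : AddCircle (2 * π * θ)) :=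
      (AddCircle.continuous_mk' _).comp continuous_snd
    fun_prop
  have h0 : coneDist θ p.1 (p.2 : AddCircle (2 * π * θ)) p.1 (p.2 : AddCircle (2 * π * θ)) = 0 := by
    rw [← h.dist_eq _ hp.1 _ hp.1, dist_self]
  have := (hc.tendsto p).mono_left (nhdsWithin_le_nhds (s := Ico 0 r ×ˢ univ))
  rw [h0] at this
  refine this.congr' ?_
  filter_upwards [self_mem_nhdsWithin] with q hq
  exact (h.dist_eq _ hq.1 _ hp.1 _ _).symm

/-- Distance zero forces cosine 1 for the truncated apex angle. This angle lies in [0, π], so it is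
zero and was not truncated. -/
theorem angle_eq_of_eq {s : ℝ} (hs : s ∈ Ioo 0 r) {ψ ψ' : AddCircle (2 * π * θ)}
    (he : e s ψ = e s ψ') : ψ = ψ' := by
  have h1 := h.dist_eq s ⟨hs.1.le, hs.2⟩ s ⟨hs.1.le, hs.2⟩ ψ ψ'
  rw [he, dist_self, coneDist, eq_comm, arccos_eq_zero] at h1
  have hsin : 0 < sin s := sin_pos_of_pos_of_lt_pi hs.1 (hs.2.trans h.radius_lt_pi)
  have hc : 1 ≤ cos (min ‖ψ - ψ'‖ π) := by
    have h2 := sin_sq_add_cos_sq s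
    by_contra hlt
    nlinarith [mul_pos (mul_pos hsin hsin) (sub_pos.2 (not_le.1 hlt))]
  have h3 := (cos_eq_one_iff_of_lt_of_lt (x := min ‖ψ - ψ'‖ π)
    (by have : 0 ≤ min ‖ψ - ψ'‖ π := by positivity
        linarith [pi_pos])
    (by linarith [min_le_right ‖ψ - ψ'‖ π, pi_pos])).1 (le_antisymm (cos_le_one _) hc)
  rcases min_choice ‖ψ - ψ'‖ π with h4 | h4
  · rw [h4] at h3
    exact sub_eq_zero.1 (norm_eq_zero.1 h3)
  · rw [h4] at h3; exact absurd h3 pi_ne_zero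

end IsPolar

namespace DevelopingMap

variable {X : Type u} [MetricSpace X] {S : ConeSphericalSurface X} (D : DevelopingMap.{u, v} S)

/-! ### Topology of the universal cover -/

theorem norm_dev (y : D.Cover) : ‖(D.dev y : E3)‖ = 1 := by
  simp

theorem inner_dev_of_angle_eq {a b : D.Cover} {d : ℝ}
    (h : InnerProductGeometry.angle (D.dev a : E3) (D.dev b : E3) = d) :
    inner ℝ (D.dev a : E3) (D.dev b : E3) = cos d := by
  rw [← h, InnerProductGeometry.cos_angle, norm_dev, norm_dev, mul_one, div_one]

theorem continuous_proj : Continuous fun y => (D.proj y : X) :=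
  continuous_subtype_val.comp D.isCoveringMap.continuous

instance : T2Space D.Cover where
  t2 a b hab := by
    by_cases h : D.proj a = D.proj b
    · exact D.isCoveringMap.isSeparatedMap a b h hab
    · exact separated_by_continuous D.isCoveringMap.continuous h

theorem continuous_dev : Continuous D.dev := by
  rw [continuous_induced_rng, continuous_iff_continuousAt]
  intro y
  obtain ⟨U, hU, h⟩ := D.locallyIsometric y
  rw [ContinuousAt, tendsto_iff_norm_sub_tendsto_zero]
  -- The chord between unit vectors at angle d has length √(2 - 2 cos d).
  have h1 : Tendsto (fun a => √(2 - 2 * cos (dist (D.proj a) (D.proj y)))) (𝓝 y) (𝓝 0) := by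
    have hc : Continuous fun a => √(2 - 2 * cos (dist (D.proj a) (D.proj y))) := by
      have := D.isCoveringMap.continuous
      fun_prop
    simpa using hc.tendsto y
  refine h1.congr' ?_
  filter_upwards [hU] with a ha
  rw [eq_comm, ← sq_eq_sq₀ (norm_nonneg _) (sqrt_nonneg _),
    sq_sqrt (by linarith [cos_le_one (dist (D.proj a) (D.proj y))]), Function.comp_apply,
    Function.comp_apply, @norm_sub_sq_real, norm_dev, norm_dev,
    D.inner_dev_of_angle_eq (h a ha y (mem_of_mem_nhds hU))]
  ring

theorem continuous_dev_coe : Continuous fun y => (D.dev y : E3) :=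
  continuous_subtype_val.comp D.continuous_dev

theorem isLocallyInjective_dev : IsLocallyInjective D.dev := by
  intro y
  obtain ⟨U, hU, h⟩ := D.locallyIsometric y
  obtain ⟨V, hV, hyV, hinj⟩ := D.isCoveringMap.isLocalHomeomorph.isLocallyInjective y
  refine ⟨interior U ∩ V, isOpen_interior.inter hV, ⟨mem_interior_iff_mem_nhds.2 hU, hyV⟩, ?_⟩
  intro a ha b hb hab
  refine hinj ha.2 hb.2 (dist_eq_zero.1 ?_)
  rw [← h a (interior_subset ha.1) b (interior_subset hb.1), hab]
  exact InnerProductGeometry.angle_self (by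
    intro h0; have := D.norm_dev b; rw [h0, norm_zero] at this; norm_num at this)

theorem isOpen_compl_conePts : IsOpen (S.conePts)ᶜ := S.finite_conePts.isClosed.isOpen_compl

theorem image_proj_mem_nhds {y : D.Cover} {V : Set D.Cover} (hV : V ∈ 𝓝 y) :
    (fun y => (D.proj y : X)) '' V ∈ 𝓝 (D.proj y : X) := by
  have h : IsOpenMap fun y => (D.proj y : X) :=
    (isOpen_compl_conePts (S := S)).isOpenMap_subtype_val.comp D.isCoveringMap.isOpenMap
  exact h.image_mem_nhds hV

/-- A point of the cover lies over a point of cone angle 2π. Polar coordinates there, followed by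
`dev`, preserve inner products with the vectors `sph`, so they are given by one linear isometry `A`,
and the image contains the `A`-image of a full cap about `north`. -/
theorem isOpenMap_dev : IsOpenMap D.dev := by
  rw [isOpenMap_iff_nhds_le]
  intro y
  rw [le_map_iff]
  intro V' hV'
  obtain ⟨U, hU, h⟩ := D.locallyIsometric y
  set V := V' ∩ U
  have hV : V ∈ 𝓝 y := inter_mem hV' hU
  suffices hs : D.dev '' V ∈ 𝓝 (D.dev y) from mem_of_superset hs (image_mono inter_subset_left)
  obtain ⟨r, e, hp, hrV⟩ := (S.smooth_spec _ (D.proj y).2).exists_isPolar (D.image_proj_mem_nhds hV)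
  have hch : ∀ p : {p : ℝ × ℝ // p.1 ∈ Ico 0 r}, ∃ a ∈ V, (D.proj a : X) = e p.1.1 p.1.2 := by
    intro p
    have : e p.1.1 p.1.2 ∈ Metric.ball (D.proj y : X) r := by
      rw [Metric.mem_ball, hp.dist_center p.2]; exact p.2.2
    obtain ⟨a, ha, hae⟩ := hrV this
    exact ⟨a, ha, hae⟩
  choose a haV ha using hch
  have hr := hp.radius_pos
  have hr1 := hp.radius_le
  obtain ⟨A, hA⟩ := exists_linearIsometryEquiv_of_inner_eq
    (fun p : {p : ℝ × ℝ // p.1 ∈ Ico 0 r} => sph p.1.2 p.1.1) (fun p => (D.dev (a p) : E3)) (by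
      intro p q
      rw [D.inner_dev_of_angle_eq (h _ (haV p).2 _ (haV q).2), Subtype.dist_eq, ha, ha,
        hp.dist_eq _ p.2 _ q.2, cos_coneDist_one]) (by
      refine span_eq_top_of_sph_mem (I := univ) (J := Ico 0 r) (a := π / 2) (b := 0) (c := r / 2)
        (d := 0) trivial trivial ⟨by linarith, by linarith⟩ ⟨le_rfl, hr⟩ (by simp) ?_ ?_
      · rw [sub_zero]
        exact (sin_pos_of_pos_of_lt_pi (by linarith) (by linarith [pi_gt_three])).ne'
      · exact fun ψ _ φ hφ => ⟨⟨(φ, ψ), hφ⟩, rfl⟩)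
  have hy : (D.dev y : E3) = A north := by
    have h0 : (0 : ℝ) ∈ Ico 0 r := ⟨le_rfl, hr⟩
    have h1 := hA ⟨(0, 0), h0⟩
    simp only [sph_colat_zero] at h1
    rw [← h1, ← inner_eq_one_iff_of_norm_eq_one (𝕜 := ℝ) (D.norm_dev _) (D.norm_dev _),
      D.inner_dev_of_angle_eq (h _ (mem_of_mem_nhds hU) _ (haV _).2), Subtype.dist_eq, ha]
    rw [hp.center]; simp
  have hO : IsOpen {w : S2 | cos r < A.symm (w : E3) 2} := by
    refine isOpen_lt continuous_const ?_
    exact (EuclideanSpace.proj (2 : Fin 3)).continuous.comp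
      (A.symm.continuous.comp continuous_subtype_val)
  refine mem_of_superset (hO.mem_nhds ?_) ?_
  · rw [mem_ofPred_eq, hy, A.symm_apply_apply, north_two, ← cos_zero]
    exact cos_lt_cos_of_nonneg_of_le_pi le_rfl hp.radius_lt_pi.le hr
  · intro w hw
    obtain ⟨ψ, φ, hφ, hwe⟩ := exists_sph_eq (x := A.symm (w : E3)) (by
      rw [A.symm.norm_map]; simp)
    rw [mem_ofPred_eq, hwe, sph_two] at hw
    have hφr : φ < r := (strictAntiOn_cos.lt_iff_gt ⟨hr.le, hp.radius_lt_pi.le⟩ hφ).1 hw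
    refine ⟨a ⟨(φ, ψ), hφ.1, hφr⟩, haV _, Subtype.ext ?_⟩
    rw [hA, ← hwe, A.apply_symm_apply]

theorem isLocalHomeomorph_dev : IsLocalHomeomorph D.dev := by
  rw [isLocalHomeomorph_iff_isOpenEmbedding_restrict]
  intro y
  obtain ⟨U, hU, hyU, hinj⟩ := D.isLocallyInjective_dev y
  exact ⟨U, hU.mem_nhds hyU, .of_continuous_injective_isOpenMap
    (D.continuous_dev.comp continuous_subtype_val) (injOn_iff_injective.1 hinj)
    (D.isOpenMap_dev.comp hU.isOpenMap_subtype_val)⟩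

/-- Two lifts of a path on the sphere by the developing map coincide if they agree at a point. -/
theorem eqOn_of_dev_eqOn {A : Type*} [TopologicalSpace A] {s : Set A} (hs : IsPreconnected s)
    {g₁ g₂ : A → D.Cover} (h₁ : ContinuousOn g₁ s) (h₂ : ContinuousOn g₂ s)
    (he : ∀ t ∈ s, (D.dev (g₁ t) : E3) = D.dev (g₂ t)) {a : A} (ha : a ∈ s) (hg : g₁ a = g₂ a) :
    EqOn g₁ g₂ s :=
  (T2Space.isSeparatedMap D.dev).eqOn_of_comp_eqOn D.isLocallyInjective_dev hs h₁ h₂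
    (fun t ht => Subtype.ext (he t ht)) ha hg

/-- Local inverses of `dev` are charts with values in the sphere. Local path connectedness is
required for the lifts in `exists_deck`. -/
instance : LocallyPathConnectedSpace D.Cover := by
  have : Fact (Module.finrank ℝ E3 = 2 + 1) := ⟨by simp⟩
  have : LocallyPathConnectedSpace S2 :=
    ChartedSpace.locallyPathConnectedSpace (EuclideanSpace ℝ (Fin 2)) S2
  choose c hc hc' using fun y => D.isLocalHomeomorph_dev y
  let _ : ChartedSpace S2 D.Cover :=
    { atlas := range c
      chartAt := c
      mem_chart_source := hc
      chart_mem_atlas := fun y => mem_range_self y }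
  exact ChartedSpace.locallyPathConnectedSpace S2 D.Cover

variable {D} in
theorem IsDeck.coe {γ : D.Cover ≃ₜ D.Cover} (h : D.IsDeck γ) (y : D.Cover) :
    (D.proj (γ y) : X) = D.proj y := by rw [h]

/-- As the cover is simply connected, `proj` lifts through itself with any prescribed value in the
fibre. The lifts taking `a` to `b` and `b` to `a` are inverse to each other by uniqueness. -/
theorem exists_deck {a b : D.Cover} (hab : (D.proj a : X) = D.proj b) :
    ∃ γ, D.IsDeck γ ∧ γ a = b := by
  have hab' : D.proj a = D.proj b := Subtype.ext hab
  let f : C(D.Cover, {x : X // x ∉ S.conePts}) := ⟨D.proj, D.isCoveringMap.continuous⟩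
  obtain ⟨F, ⟨hF, hF'⟩, -⟩ := D.isCoveringMap.existsUnique_continuousMap_lifts f a b hab'.symm
  obtain ⟨G, ⟨hG, hG'⟩, -⟩ := D.isCoveringMap.existsUnique_continuousMap_lifts f b a hab'
  have hF'' : ∀ y, D.proj (F y) = D.proj y := fun y => congrFun hF' y
  have hG'' : ∀ y, D.proj (G y) = D.proj y := fun y => congrFun hG' y
  have h1 : (fun y => G (F y)) = id := D.isCoveringMap.eq_of_comp_eq (G.continuous.comp F.continuous)
    continuous_id (funext fun y => by simp [hF'', hG'']) a (by simp [hF, hG])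
  have h2 : (fun y => F (G y)) = id := D.isCoveringMap.eq_of_comp_eq (F.continuous.comp G.continuous)
    continuous_id (funext fun y => by simp [hF'', hG'']) b (by simp [hF, hG])
  exact ⟨⟨⟨F, G, congrFun h1, congrFun h2⟩, F.continuous, G.continuous⟩, hF'', hF⟩

theorem exists_proj_eq {x : X} (hx : x ∉ S.conePts) : ∃ y, (D.proj y : X) = x := by
  obtain ⟨y, hy⟩ := D.surjective ⟨x, hx⟩
  exact ⟨y, by rw [hy]⟩

theorem proj_notMem (y : D.Cover) : (D.proj y : X) ∉ S.conePts := (D.proj y).2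

variable {D} in
theorem IsDihedral.exists_sign (hd : D.IsDihedral) {γ : D.Cover ≃ₜ D.Cover} (hγ : D.IsDeck γ) :
    ∃ (A : E3 ≃ₗᵢ[ℝ] E3) (ε : ℝ), D.IsMonodromy γ A ∧ ε * ε = 1 ∧ A north = ε • north := by
  obtain ⟨A, hA⟩ := D.equivariant γ hγ
  obtain ⟨ε, hε, h⟩ := (hd γ hγ A hA).exists_sign
  exact ⟨A, ε, hA, hε, h⟩

end DevelopingMap

/-! ### Cone charts: lifted and developed polar coordinates -/

theorem ConeSphericalSurface.exists_hasConeAngle {X : Type u} [MetricSpace X]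
    (S : ConeSphericalSurface X) (x : X) : ∃ θ, HasConeAngle x θ := by
  by_cases hx : x ∈ S.conePts
  · obtain ⟨θ, -, h⟩ := S.conePts_spec x hx
    exact ⟨θ, h⟩
  · exact ⟨1, S.smooth_spec x hx⟩

/-- A neighbourhood contains a coordinate rectangle with sides in (0, π), whose corners span. Hence
a linear isometry is determined by its values on the vectors `sph` near one parameter. -/
theorem span_sph_eq_top_of_mem_nhds {r : ℝ} (p : (Ioo 0 r ×ˢ univ : Set (ℝ × ℝ)))
    {N : Set (Ioo 0 r ×ˢ univ : Set (ℝ × ℝ))} (hN : N ∈ 𝓝 p) :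
    Submodule.span ℝ ((fun q : (Ioo 0 r ×ˢ univ : Set (ℝ × ℝ)) => sph q.1.2 q.1.1) '' N) = ⊤ := by
  rw [mem_nhds_subtype] at hN
  obtain ⟨M, hM, hMN⟩ := hN
  have hO : IsOpen (Ioo 0 r ×ˢ univ : Set (ℝ × ℝ)) := isOpen_Ioo.prod isOpen_univ
  obtain ⟨ρ, hρ, hρM⟩ := Metric.mem_nhds_iff.1 (inter_mem hM (hO.mem_nhds p.2))
  have hl : 0 < min ρ 1 / 2 := by positivity
  have hl1 : min ρ 1 / 2 < ρ := by linarith [min_le_left ρ 1]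
  have hl2 : min ρ 1 / 2 < π := by linarith [min_le_right ρ 1, pi_gt_three]
  have hsin : sin (min ρ 1 / 2) ≠ 0 := (sin_pos_of_pos_of_lt_pi hl hl2).ne'
  have hmem : ∀ c : ℝ, c ∈ Metric.ball c ρ := fun c => Metric.mem_ball_self hρ
  have hmem' : ∀ c : ℝ, c + min ρ 1 / 2 ∈ Metric.ball c ρ := fun c => by
    rw [Metric.mem_ball, dist_eq, add_sub_cancel_left, abs_of_pos hl]; exact hl1
  refine span_eq_top_of_sph_mem (hmem' p.1.2) (hmem p.1.2) (hmem' p.1.1) (hmem p.1.1)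
    (by simpa using hsin) (by simpa using hsin) ?_
  intro ψ hψ φ hφ
  have hq : (φ, ψ) ∈ Metric.ball (p : ℝ × ℝ) ρ := by
    rw [← ball_prod_same]; exact ⟨hφ, hψ⟩
  obtain ⟨h1, h2⟩ := hρM hq
  exact ⟨⟨(φ, ψ), h2⟩, hMN h1, rfl⟩

namespace DevelopingMap

variable {X : Type u} [MetricSpace X] {S : ConeSphericalSurface X} (D : DevelopingMap.{u, v} S)

/-- Polar coordinates about `x`, lifted to the universal cover and developed: `lift (s, η)` lies over
the point with coordinates `(s, η)` and is developed into the point with spherical coordinates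
`(s, η)` up to a fixed linear isometry. -/
structure ConeChart (x : X) where
  θ : ℝ
  r : ℝ
  e : ℝ → AddCircle (2 * π * θ) → X
  polar : IsPolar x θ r e
  lift : ℝ × ℝ → D.Cover
  iso : E3 ≃ₗᵢ[ℝ] E3
  continuousOn_lift : ContinuousOn lift (Ioo 0 r ×ˢ univ)
  proj_lift : ∀ s ∈ Ioo 0 r, ∀ η : ℝ, (D.proj (lift (s, η)) : X) = e s η
  dev_lift : ∀ s ∈ Ioo 0 r, ∀ η, (D.dev (lift (s, η)) : E3) = iso (sph η s)
  notMem : ∀ y ∈ Metric.ball x r, y ≠ x → y ∉ S.conePts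

/-- The strip `T` of polar coordinates is contractible, so it lifts to the cover. The developed lift
is locally a linear isometry applied to `sph`. That isometry is locally unique, hence locally
constant, hence constant on the connected strip. -/
theorem nonempty_coneChart (x : X) : Nonempty (D.ConeChart x) := by
  obtain ⟨θ, hθ⟩ := S.exists_hasConeAngle x
  have hU : (S.conePts \ {x})ᶜ ∈ 𝓝 x :=
    (S.finite_conePts.subset sdiff_subset).isClosed.isOpen_compl.mem_nhds (by simp)
  obtain ⟨r, e, hp, hrU⟩ := hθ.exists_isPolar hU
  have hball : ∀ y ∈ Metric.ball x r, y ≠ x → y ∉ S.conePts := fun y hy hyx hyP => hrU hy ⟨hyP, hyx⟩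
  set T : Set (ℝ × ℝ) := Ioo 0 r ×ˢ univ
  have hTc : Convex ℝ T := (convex_Ioo 0 r).prod convex_univ
  have hTn : T.Nonempty := ⟨(r / 2, 0), ⟨by linarith [hp.radius_pos], by linarith [hp.radius_pos]⟩,
    trivial⟩
  have : ContractibleSpace T := hTc.contractibleSpace hTn
  have : LocallyPathConnectedSpace T := hTc.locallyPathConnectedSpace
  have hmem : ∀ p : T, e p.1.1 (p.1.2 : AddCircle (2 * π * θ)) ∉ S.conePts := fun p => by
    have hs : p.1.1 ∈ Ico 0 r := ⟨p.2.1.1.le, p.2.1.2⟩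
    refine hball _ ?_ ?_
    · rw [Metric.mem_ball, hp.dist_center hs]; exact hs.2
    · rw [← dist_pos, hp.dist_center hs]; exact p.2.1.1
  let f : C(T, {x : X // x ∉ S.conePts}) := ⟨fun p => ⟨_, hmem p⟩, by
    refine Continuous.subtype_mk ?_ _
    have := hp.continuousOn.mono (prod_mono_left Ioo_subset_Ico_self)
    exact this.domRestrict⟩
  obtain ⟨p₀⟩ : Nonempty T := hTn.to_subtype
  obtain ⟨y₀, hy₀⟩ := D.surjective (f p₀)
  obtain ⟨F, ⟨-, hF⟩, -⟩ := D.isCoveringMap.existsUnique_continuousMap_lifts f p₀ y₀ hy₀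
  have hF' : ∀ p, D.proj (F p) = f p := fun p => congrFun hF p
  have hloc : ∀ p : T, ∃ B : E3 ≃ₗᵢ[ℝ] E3, ∀ᶠ q in 𝓝 p, (D.dev (F q) : E3) = B (sph q.1.2 q.1.1) := by
    intro p
    obtain ⟨U, hU, h⟩ := D.locallyIsometric (F p)
    -- Two longitudes this close to that of `p` differ by less than min π (πθ), the range of
    -- `cos_coneDist_of_near`.
    have hδ : 0 < min π (π * θ) / 2 := by have := hθ.1; positivity
    have hN : {q : T | F q ∈ U ∧ |q.1.2 - p.1.2| < min π (π * θ) / 2} ∈ 𝓝 p := by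
      refine inter_mem (F.continuous.continuousAt hU) ?_
      have hc : Continuous fun q : T => |q.1.2 - p.1.2| := by fun_prop
      exact hc.continuousAt.eventually (gt_mem_nhds (by simpa using hδ))
    set N := {q : T | F q ∈ U ∧ |q.1.2 - p.1.2| < min π (π * θ) / 2}
    obtain ⟨B, hB⟩ := exists_linearIsometryEquiv_of_inner_eq
      (fun q : N => sph q.1.1.2 q.1.1.1) (fun q => (D.dev (F q) : E3)) (by
        intro q q'
        have hq : |q.1.1.2 - q'.1.1.2| < min π (π * θ) := by
          have h1 := q.2.2
          have h2 := q'.2.2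
          rw [abs_lt] at h1 h2 ⊢
          constructor <;> linarith
        rw [D.inner_dev_of_angle_eq (h _ q.2.1 _ q'.2.1), hF', hF']
        change cos (dist (e _ _) (e _ _)) = _
        rw [hp.dist_eq _ ⟨q.1.2.1.1.le, q.1.2.1.2⟩ _ ⟨q'.1.2.1.1.le, q'.1.2.1.2⟩,
          cos_coneDist_of_near hθ.1 _ _ (hq.le.trans (min_le_right _ _))
            (hq.le.trans (min_le_left _ _))]) (by
        rw [← span_sph_eq_top_of_mem_nhds p hN, image_eq_range])
    exact ⟨B, mem_of_superset hN fun q hq => hB ⟨q, hq⟩⟩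
  choose B hB using hloc
  have hBc : IsLocallyConstant B := by
    rw [IsLocallyConstant.iff_eventually_eq]
    intro p
    filter_upwards [eventually_eventually_nhds.2 (hB p)] with q hq
    have := hq.and (hB q)
    refine linearIsometryEquiv_ext_of_span (span_sph_eq_top_of_mem_nhds q this) ?_
    rintro _ ⟨q', hq', rfl⟩
    exact hq'.2.symm.trans hq'.1
  have hconst : ∀ p, (D.dev (F p) : E3) = B p₀ (sph p.1.2 p.1.1) := fun p => by
    rw [← hBc.apply_eq_of_preconnectedSpace p p₀]
    exact (hB p).self_of_nhds
  classical
  refine ⟨⟨θ, r, e, hp, fun p => if h : p ∈ T then F ⟨p, h⟩ else y₀, B p₀, ?_, ?_, ?_, hball⟩⟩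
  · rw [continuousOn_iff_continuous_domRestrict]
    convert F.continuous using 1
    ext q
    simp
  · intro s hs η
    have : (s, η) ∈ T := ⟨hs, trivial⟩
    rw [dif_pos this, hF']
    rfl
  · intro s hs η
    have : (s, η) ∈ T := ⟨hs, trivial⟩
    rw [dif_pos this, hconst]

namespace ConeChart

variable {D} {x : X} (c : D.ConeChart x)

/-- The set of points of the universal cover covered by the chart. -/
def image : Set D.Cover := c.lift '' (Ioo 0 c.r ×ˢ univ)

/-- Composition of a chart with a deck transformation. -/
noncomputable def translate {γ : D.Cover ≃ₜ D.Cover} (hγ : D.IsDeck γ) {A : E3 ≃ₗᵢ[ℝ] E3}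
    (hA : D.IsMonodromy γ A) : D.ConeChart x where
  θ := c.θ
  r := c.r
  e := c.e
  polar := c.polar
  lift p := γ (c.lift p)
  iso := c.iso.trans A
  continuousOn_lift := γ.continuous.comp_continuousOn c.continuousOn_lift
  proj_lift s hs η := by rw [hγ, c.proj_lift s hs]
  dev_lift s hs η := by rw [hA.2, c.dev_lift s hs]; rfl
  notMem := c.notMem

theorem r_pos : 0 < c.r := c.polar.radius_pos
theorem r_le : c.r ≤ 1 := c.polar.radius_le

theorem dist_proj_lift {s : ℝ} (hs : s ∈ Ioo 0 c.r) (η : ℝ) :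
    dist (D.proj (c.lift (s, η)) : X) x = s := by
  rw [c.proj_lift s hs, c.polar.dist_center ⟨hs.1.le, hs.2⟩]

theorem exists_proj_lift {y : X} (hy : y ∈ Metric.ball x c.r) (hyx : y ≠ x) :
    ∃ s ∈ Ioo 0 c.r, ∃ η : ℝ, (D.proj (c.lift (s, η)) : X) = y := by
  obtain ⟨s, hs, ψ, rfl⟩ := c.polar.surj y hy
  obtain ⟨η, rfl⟩ := QuotientAddGroup.mk_surjective ψ
  have hs0 : 0 < s := hs.1.lt_of_ne (by rintro rfl; exact hyx (c.polar.center _))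
  exact ⟨s, ⟨hs0, hs.2⟩, η, c.proj_lift s ⟨hs0, hs.2⟩ η⟩

/-- Every point over the punctured ball is covered by some translate of the chart. -/
theorem exists_translate {y : D.Cover} (hy : (D.proj y : X) ∈ Metric.ball x c.r)
    (hyx : (D.proj y : X) ≠ x) : ∃ (γ : D.Cover ≃ₜ D.Cover) (hγ : D.IsDeck γ) (A : E3 ≃ₗᵢ[ℝ] E3)
      (hA : D.IsMonodromy γ A), y ∈ (c.translate hγ hA).image := by
  obtain ⟨s, hs, η, h⟩ := c.exists_proj_lift hy hyx
  obtain ⟨γ, hγ, hγy⟩ := D.exists_deck h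
  obtain ⟨A, hA⟩ := D.equivariant γ hγ
  exact ⟨γ, hγ, A, hA, (s, η), ⟨hs, trivial⟩, hγy⟩

theorem isOpen_domain : IsOpen (Ioo 0 c.r ×ˢ univ : Set (ℝ × ℝ)) := isOpen_Ioo.prod isOpen_univ

theorem isPreconnected_image : IsPreconnected c.image :=
  (isPreconnected_Ioo.prod isPreconnected_univ).image _ c.continuousOn_lift

end ConeChart

end DevelopingMap

/-! ### Openness and separation of charts in the universal cover -/

/-- Spherical coordinates are open. -/
theorem eventually_exists_sphAt_eq {σ : ℝ} (hσ : σ * σ = 1) {p : ℝ × ℝ} (hp : p.2 ∈ Ioo 0 π)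
    {W : Set (ℝ × ℝ)} (hW : W ∈ 𝓝 p) :
    ∀ᶠ x in 𝓝 (sphAt σ p.1 p.2), ‖x‖ = 1 → ∃ q ∈ W, sphAt σ q.1 q.2 = x := by
  have hcoord : ∀ i : Fin 3, Continuous fun x : E3 => x i := fun i =>
    (EuclideanSpace.proj (𝕜 := ℝ) i).continuous
  have h0 := hcoord 0
  have h1 := hcoord 1
  have h2 := hcoord 2
  have hsin := sin_pos_of_mem_Ioo hp
  -- The horizontal part of `x` in the frame turned by the longitude of `p`: `w` is the component
  -- along that meridian and `z` the one across, so the longitude of `x` is recovered as `p.1 +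
  -- arctan (z / w)`.
  let w : E3 → ℝ := fun x => cos p.1 * x 0 + sin p.1 * x 1
  let z : E3 → ℝ := fun x => -sin p.1 * x 0 + cos p.1 * x 1
  have hw0 : w (sphAt σ p.1 p.2) = sin p.2 := by
    simp only [w, sphAt_zero, sphAt_one]
    linear_combination sin p.2 * sin_sq_add_cos_sq p.1
  have hz0 : z (sphAt σ p.1 p.2) = 0 := by simp only [z, sphAt_zero, sphAt_one]; ring
  have hwc : Continuous w := by fun_prop
  have hzc : Continuous z := by fun_prop
  have hwpos : ∀ᶠ x in 𝓝 (sphAt σ p.1 p.2), 0 < w x :=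
    hwc.continuousAt.eventually (lt_mem_nhds (by rw [hw0]; exact hsin))
  have hlim : Tendsto (fun x : E3 => (p.1 + arctan (z x / w x), arccos (σ * x 2)))
      (𝓝 (sphAt σ p.1 p.2)) (𝓝 p) := by
    have hc : ContinuousAt (fun x : E3 => (p.1 + arctan (z x / w x), arccos (σ * x 2)))
        (sphAt σ p.1 p.2) := by
      refine ContinuousAt.prodMk ?_ ?_
      · exact continuousAt_const.add (continuous_arctan.continuousAt.comp
          (hzc.continuousAt.div hwc.continuousAt (by rw [hw0]; exact hsin.ne')))
      · exact (continuous_arccos.comp (continuous_const.mul h2)).continuousAt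
    have hv : (p.1 + arctan (z (sphAt σ p.1 p.2) / w (sphAt σ p.1 p.2)),
        arccos (σ * sphAt σ p.1 p.2 2)) = p := by
      rw [hz0, sphAt_two, ← mul_assoc, hσ, one_mul, arccos_cos hp.1.le hp.2.le]
      simp
    have := hc.tendsto
    rwa [hv] at this
  filter_upwards [hwpos, hlim hW] with x hx hxW hnorm
  refine ⟨_, hxW, ?_⟩
  have habs := abs_le.1 (abs_two_le_one hnorm)
  have hsq := sq_add_sq_add_sq_eq_one hnorm
  have habs' : -1 ≤ σ * x 2 ∧ σ * x 2 ≤ 1 := by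
    rcases mul_self_eq_one_iff.1 hσ with h | h <;> rw [h] <;> constructor <;> linarith
  have hwz : w x ^ 2 + z x ^ 2 = x 0 ^ 2 + x 1 ^ 2 := by
    simp only [w, z]
    linear_combination (x 0 ^ 2 + x 1 ^ 2) * sin_sq_add_cos_sq p.1
  have hρ : sin (arccos (σ * x 2)) = √(w x ^ 2 + z x ^ 2) := by
    rw [sin_arccos, hwz]
    congr 1
    linear_combination -hsq - x 2 ^ 2 * hσ
  have hsq' : √(1 + (z x / w x) ^ 2) * w x = √(w x ^ 2 + z x ^ 2) := by
    have : w x ^ 2 + z x ^ 2 = (1 + (z x / w x) ^ 2) * w x ^ 2 := by field_simp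
    rw [this, sqrt_mul (by positivity), sqrt_sq hx.le]
  have hpos : 0 < √(1 + (z x / w x) ^ 2) := by positivity
  have hcos : cos (arctan (z x / w x)) * sin (arccos (σ * x 2)) = w x := by
    rw [hρ, cos_arctan, ← hsq']; field_simp
  have hsin' : sin (arctan (z x / w x)) * sin (arccos (σ * x 2)) = z x := by
    rw [hρ, sin_arctan, ← hsq']; field_simp
  apply E3.ext_coords
  · rw [sphAt_zero, cos_add, sub_mul, mul_assoc, mul_assoc, hcos, hsin']
    simp only [w, z]
    linear_combination x 0 * sin_sq_add_cos_sq p.1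
  · rw [sphAt_one, sin_add, add_mul, mul_assoc, mul_assoc, hcos, hsin']
    simp only [w, z]
    linear_combination x 1 * sin_sq_add_cos_sq p.1
  · rw [sphAt_two, cos_arccos habs'.1 habs'.2, ← mul_assoc, hσ, one_mul]

namespace DevelopingMap

variable {X : Type u} [MetricSpace X] {S : ConeSphericalSurface X} (D : DevelopingMap.{u, v} S)

/-- By local injectivity of `dev`, a point near `g p` with the same development as a nearby `g q`
equals `g q`. Openness of `g` may thus be checked on the sphere. -/
theorem image_mem_nhds_of_dev {A : Type*} [TopologicalSpace A] {g : A → D.Cover} {p : A}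
    (hg : ContinuousAt g p)
    (h : ∀ W ∈ 𝓝 p, ∀ᶠ x in 𝓝 (D.dev (g p) : E3), ‖x‖ = 1 → ∃ q ∈ W, (D.dev (g q) : E3) = x)
    {W : Set A} (hW : W ∈ 𝓝 p) : g '' W ∈ 𝓝 (g p) := by
  obtain ⟨U, hU, hpU, hinj⟩ := D.isLocallyInjective_dev (g p)
  have h1 := D.continuous_dev_coe.continuousAt.eventually
    (h _ (inter_mem hW (hg (hU.mem_nhds hpU))))
  filter_upwards [h1, hU.mem_nhds hpU] with y hy hyU
  obtain ⟨q, hq, hqy⟩ := hy (D.norm_dev y)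
  exact ⟨q, hq.1, hinj hq.2 hyU (Subtype.ext hqy)⟩

/-- Near a point that is not a pole, the spherical coordinates lift to the universal cover. -/
theorem exists_box {σ : ℝ} (hσ : σ * σ = 1) {y : D.Cover} {p : ℝ × ℝ} (hp : p.2 ∈ Ioo 0 π)
    (hy : (D.dev y : E3) = sphAt σ p.1 p.2) :
    ∃ δ > 0, ∃ g : ℝ × ℝ → D.Cover, ContinuousOn g (Metric.ball p δ) ∧
      (∀ q ∈ Metric.ball p δ, (D.dev (g q) : E3) = sphAt σ q.1 q.2) ∧ g p = y ∧
      (∀ q ∈ Metric.ball p δ, q.2 ∈ Ioo 0 π) ∧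
      ∀ q ∈ Metric.ball p δ, ∀ W ∈ 𝓝 q, g '' W ∈ 𝓝 (g q) := by
  obtain ⟨f, hyf, hf⟩ := D.isLocalHomeomorph_dev y
  let s : ℝ × ℝ → S2 := fun q => ⟨sphAt σ q.1 q.2, by simp [norm_sphAt hσ]⟩
  have hs : Continuous s := (continuous_sphAt σ).subtype_mk _
  have hsy : s p = f y := by rw [← hf]; exact Subtype.ext hy.symm
  have hN : s ⁻¹' f.target ∩ {q | q.2 ∈ Ioo 0 π} ∈ 𝓝 p := by
    refine inter_mem (hs.continuousAt (f.open_target.mem_nhds ?_)) ?_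
    · rw [hsy]; exact f.map_source hyf
    · exact (isOpen_Ioo.preimage continuous_snd).mem_nhds hp
  obtain ⟨δ, hδ, hball⟩ := Metric.mem_nhds_iff.1 hN
  have hc : ContinuousOn (fun q => f.symm (s q)) (Metric.ball p δ) :=
    f.continuousOn_symm.comp hs.continuousOn fun q hq => (hball hq).1
  have hdev : ∀ q ∈ Metric.ball p δ, (D.dev (f.symm (s q)) : E3) = sphAt σ q.1 q.2 := by
    intro q hq
    have : D.dev (f.symm (s q)) = s q := by rw [hf, f.right_inv (hball hq).1]
    rw [this]
  refine ⟨δ, hδ, fun q => f.symm (s q), hc, hdev, ?_, fun q hq => (hball hq).2, ?_⟩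
  · simp only [hsy, f.left_inv hyf]
  · intro q hq W hW
    have hq' := Metric.isOpen_ball.mem_nhds hq
    refine D.image_mem_nhds_of_dev (hc.continuousAt hq') ?_ hW
    intro W' hW'
    rw [hdev q hq]
    filter_upwards [eventually_exists_sphAt_eq hσ (hball hq).2 (inter_mem hW' hq')] with x hx hn
    obtain ⟨q', h1, h2⟩ := hx hn
    exact ⟨q', h1.1, (hdev q' h1.2).trans h2⟩

namespace ConeChart

variable {D} {x : X} (c : D.ConeChart x)

theorem isOpen_image : IsOpen c.image := by
  rw [isOpen_iff_mem_nhds]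
  rintro _ ⟨p, hp, rfl⟩
  refine D.image_mem_nhds_of_dev (c.continuousOn_lift.continuousAt (c.isOpen_domain.mem_nhds hp))
    ?_ (c.isOpen_domain.mem_nhds hp)
  intro W hW
  have hπ := c.polar.radius_lt_pi
  rw [show p = (p.1, p.2) from rfl, c.dev_lift p.1 hp.1]
  have hW' : Prod.swap ⁻¹' (W ∩ Ioo 0 c.r ×ˢ univ) ∈ 𝓝 p.swap :=
    continuous_swap.continuousAt (inter_mem hW (c.isOpen_domain.mem_nhds hp))
  have h1 := eventually_exists_sphAt_eq (σ := 1) (one_mul 1) (p := p.swap)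
    ⟨hp.1.1, hp.1.2.trans hπ⟩ hW'
  have h2 : Tendsto c.iso.symm (𝓝 (c.iso (sph p.2 p.1))) (𝓝 (sph p.2 p.1)) := by
    have := c.iso.symm.continuous.tendsto (c.iso (sph p.2 p.1))
    rwa [c.iso.symm_apply_apply] at this
  simp only [sphAt_one_eq] at h1
  filter_upwards [h2.eventually h1] with x hx hn
  obtain ⟨q, hq, hqx⟩ := hx (by rw [c.iso.symm.norm_map, hn])
  refine ⟨q.swap, hq.1, ?_⟩
  rw [show q.swap = (q.2, q.1) from rfl, c.dev_lift q.2 hq.2.1, hqx, c.iso.apply_symm_apply]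

/-- At a common point the radii agree and the angles agree modulo the period. By uniqueness of lifts
the translate is then the chart itself with shifted longitude. -/
theorem image_subset_of_mem_image_translate {γ : D.Cover ≃ₜ D.Cover} (hγ : D.IsDeck γ)
    {A : E3 ≃ₗᵢ[ℝ] E3} (hA : D.IsMonodromy γ A) {y : D.Cover} (hy : y ∈ c.image)
    (hy' : y ∈ (c.translate hγ hA).image) : (c.translate hγ hA).image ⊆ c.image := by
  obtain ⟨⟨s, η⟩, ⟨hs, -⟩, rfl⟩ := hy
  obtain ⟨⟨s', η'⟩, ⟨hs', -⟩, h⟩ := hy'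
  change γ (c.lift (s', η')) = c.lift (s, η) at h
  change s ∈ Ioo 0 c.r at hs
  change s' ∈ Ioo 0 c.r at hs'
  have h1 : (D.proj (c.lift (s', η')) : X) = D.proj (c.lift (s, η)) := by rw [← h, hγ]
  have h2 : s' = s := by rw [← c.dist_proj_lift hs' η', h1, c.dist_proj_lift hs]
  subst h2
  rw [c.proj_lift _ hs, c.proj_lift _ hs] at h1
  have h3 := c.polar.angle_eq_of_eq hs h1
  have h4 : EqOn (fun p => γ (c.lift p)) (fun p => c.lift (p.1, p.2 + (η - η')))
      (Ioo 0 c.r ×ˢ univ) := by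
    refine D.isCoveringMap.eqOn_of_comp_eqOn (isPreconnected_Ioo.prod isPreconnected_univ)
      (γ.continuous.comp_continuousOn c.continuousOn_lift)
      (c.continuousOn_lift.comp (by fun_prop) fun p hp => ⟨hp.1, trivial⟩) ?_ (a := (s', η'))
      ⟨hs, trivial⟩ (by simpa using h)
    intro p hp
    refine Subtype.ext ?_
    have : ((p.2 + (η - η') : ℝ) : AddCircle (2 * π * c.θ)) = p.2 := by
      rw [AddCircle.coe_add, AddCircle.coe_sub, h3, sub_self, add_zero]
    change (D.proj (γ (c.lift p)) : X) = D.proj (c.lift (p.1, p.2 + (η - η')))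
    rw [hγ, show p = (p.1, p.2) from rfl, c.proj_lift _ hp.1, c.proj_lift _ hp.1, this]
  rintro _ ⟨p, hp, rfl⟩
  exact ⟨(p.1, p.2 + (η - η')), ⟨hp.1, trivial⟩, (h4 hp).symm⟩

/-- A connected set over the punctured ball that meets the image of the chart lies in it. -/
theorem subset_image_of_isPreconnected {T : Set D.Cover} (hT : IsPreconnected T)
    (hball : ∀ y ∈ T, (D.proj y : X) ∈ Metric.ball x c.r ∧ (D.proj y : X) ≠ x)
    (hne : (T ∩ c.image).Nonempty) : T ⊆ c.image := by
  -- The union of all translates of the chart through points over the punctured ball outside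
  -- `c.image`. It is open and disjoint from `c.image`, and the two cover `T`.
  let V : Set D.Cover := ⋃ y ∈ {y | y ∉ c.image ∧
    (D.proj y : X) ∈ Metric.ball x c.r ∧ (D.proj y : X) ≠ x}, ⋃ (γ : D.Cover ≃ₜ D.Cover)
      (hγ : D.IsDeck γ) (A : E3 ≃ₗᵢ[ℝ] E3) (hA : D.IsMonodromy γ A)
      (_ : y ∈ (c.translate hγ hA).image), (c.translate hγ hA).image
  have hV : IsOpen V := isOpen_biUnion fun y _ => isOpen_iUnion fun γ => isOpen_iUnion fun hγ =>
    isOpen_iUnion fun A => isOpen_iUnion fun hA => isOpen_iUnion fun _ =>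
      (c.translate hγ hA).isOpen_image
  refine hT.subset_left_of_subset_union c.isOpen_image hV ?_ ?_ hne
  · rw [Set.disjoint_left]
    intro z hz hzV
    simp only [V, mem_iUnion] at hzV
    obtain ⟨y, hy, γ, hγ, A, hA, hyt, hzt⟩ := hzV
    exact hy.1 (c.image_subset_of_mem_image_translate hγ hA hz hzt hyt)
  · intro y hy
    by_cases hyc : y ∈ c.image
    · exact Or.inl hyc
    · obtain ⟨h1, h2⟩ := hball y hy
      obtain ⟨γ, hγ, A, hA, h⟩ := c.exists_translate h1 h2
      refine Or.inr ?_
      simp only [V, mem_iUnion]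
      exact ⟨y, ⟨hyc, h1, h2⟩, γ, hγ, A, hA, h, h⟩

end ConeChart

end DevelopingMap

/-! ### Absolute latitude and poles -/

theorem norm_sph_sub_north_le {s : ℝ} (hs : 0 ≤ s) (η : ℝ) : ‖sph η s - north‖ ≤ s := by
  rw [← sq_le_sq₀ (norm_nonneg _) hs, @norm_sub_sq_real, norm_sph, norm_north, inner_north, sph_two]
  linarith [one_sub_sq_div_two_le_cos (x := s)]

theorem abs_two_sub_two_le (x y : E3) : |x 2 - y 2| ≤ ‖x - y‖ := by
  simpa using PiLp.norm_apply_le (x - y) 2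

namespace DevelopingMap

variable {X : Type u} [MetricSpace X] {S : ConeSphericalSurface X} {D : DevelopingMap.{u, v} S}

theorem IsDihedral.abs_two_map (hd : D.IsDihedral) {γ : D.Cover ≃ₜ D.Cover} (hγ : D.IsDeck γ)
    {A : E3 ≃ₗᵢ[ℝ] E3} (hA : D.IsMonodromy γ A) (x : E3) : |A x 2| = |x 2| := by
  obtain ⟨ε, hε, h⟩ := (hd γ hγ A hA).exists_sign
  rw [map_two_of_map_north hε h, abs_mul]
  rcases mul_self_eq_one_iff.1 hε with rfl | rfl <;> simp

theorem IsDihedral.absLat_eq_of_proj_eq (hd : D.IsDihedral) {a b : D.Cover}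
    (hab : (D.proj a : X) = D.proj b) : |(D.dev a : E3) 2| = |(D.dev b : E3) 2| := by
  obtain ⟨γ, hγ, rfl⟩ := D.exists_deck hab
  obtain ⟨A, hA⟩ := D.equivariant γ hγ
  rw [hA.2, hd.abs_two_map hγ hA]

namespace ConeChart

variable {x : X} (c : D.ConeChart x)

theorem exists_proj_mem {U : Set X} (hU : U ∈ 𝓝 x) :
    ∀ᶠ s in 𝓝[>] 0, s ∈ Ioo 0 c.r ∧ ∀ η, (D.proj (c.lift (s, η)) : X) ∈ U := by
  obtain ⟨ρ, hρ, h⟩ := Metric.mem_nhds_iff.1 hU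
  have : Ioo 0 (min ρ c.r) ∈ 𝓝[>] (0 : ℝ) := Ioo_mem_nhdsGT (lt_min hρ c.r_pos)
  filter_upwards [this] with s hs
  have hs' : s ∈ Ioo 0 c.r := ⟨hs.1, hs.2.trans_le (min_le_right _ _)⟩
  refine ⟨hs', fun η => h ?_⟩
  rw [Metric.mem_ball, c.dist_proj_lift hs']
  exact hs.2.trans_le (min_le_left _ _)

/-- The absolute latitude depends only on the point of the surface, so it may be computed at a chart
point with the same image, where it is 1-Lipschitz in the radius. -/
theorem abs_absLat_sub_le (hd : D.IsDihedral) {y : D.Cover}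
    (hy : (D.proj y : X) ∈ Metric.ball x c.r) :
    |(|(D.dev y : E3) 2| - |c.iso north 2|)| ≤ dist (D.proj y : X) x := by
  have key : ∀ s ∈ Ioo 0 c.r, ∀ η : ℝ, ∀ a, (D.proj a : X) = D.proj (c.lift (s, η)) →
      |(|(D.dev a : E3) 2| - |c.iso north 2|)| ≤ s := by
    intro s hs η a ha
    rw [hd.absLat_eq_of_proj_eq ha, c.dev_lift s hs]
    refine (abs_abs_sub_abs_le _ _).trans ((abs_two_sub_two_le _ _).trans ?_)
    rw [← map_sub, c.iso.norm_map]
    exact norm_sph_sub_north_le hs.1.le η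
  by_cases hyx : (D.proj y : X) = x
  -- The chart has no point over its centre, so `y` is approximated: a point `a` near `y`, at small
  -- positive radius, gives the bound up to ε/2 twice.
  · rw [hyx, dist_self]
    refine le_of_forall_pos_le_add fun ε hε => ?_
    have hc : ∀ᶠ a in 𝓝 y, |(|(D.dev a : E3) 2| - |(D.dev y : E3) 2|)| < ε / 2 := by
      have hcont : Continuous fun a => |(|(D.dev a : E3) 2| - |(D.dev y : E3) 2|)| := by
        have := (EuclideanSpace.proj (𝕜 := ℝ) (2 : Fin 3)).continuous.comp D.continuous_dev_coe
        exact ((this.abs).sub continuous_const).abs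
      exact hcont.continuousAt.eventually (gt_mem_nhds (by simpa using hε))
    have hU := D.image_proj_mem_nhds hc
    rw [hyx] at hU
    have h2 : ∀ᶠ s in 𝓝[>] (0 : ℝ), s < ε / 2 :=
      nhdsWithin_le_nhds (gt_mem_nhds (by positivity))
    obtain ⟨s, ⟨hs, hsU⟩, hsε⟩ := ((c.exists_proj_mem hU).and h2).exists
    obtain ⟨a, ha, hae⟩ := hsU 0
    have h3 := key s hs 0 a hae
    rw [mem_ofPred_eq, abs_lt] at ha
    rw [abs_le] at h3 ⊢
    constructor <;> linarith
  · obtain ⟨s, hs, η, h⟩ := c.exists_proj_lift hy hyx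
    rw [← h, c.dist_proj_lift hs]
    exact key s hs η y h.symm

theorem tendsto_absLat (hd : D.IsDihedral) : Tendsto (fun y => |(D.dev y : E3) 2|)
    (comap (fun y => (D.proj y : X)) (𝓝 x)) (𝓝 |c.iso north 2|) := by
  rw [tendsto_iff_dist_tendsto_zero]
  have h1 : Tendsto (fun y => dist (D.proj y : X) x) (comap (fun y => (D.proj y : X)) (𝓝 x))
      (𝓝 0) := by
    have := (continuous_id.dist continuous_const : Continuous fun z : X => dist z x).tendsto x
    simp only [id, dist_self] at this
    exact this.comp tendsto_comap
  refine squeeze_zero' (Eventually.of_forall fun _ => dist_nonneg) ?_ h1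
  have : Metric.ball x c.r ∈ 𝓝 x := Metric.ball_mem_nhds _ c.r_pos
  filter_upwards [preimage_mem_comap this] with y hy
  exact c.abs_absLat_sub_le hd hy

theorem mem_poles_iff (hd : D.IsDihedral) : x ∈ D.poles ↔ |c.iso north 2| = 1 := by
  have : (comap (fun y => (D.proj y : X)) (𝓝 x)).NeBot := by
    rw [comap_neBot_iff]
    intro t ht
    obtain ⟨s, -, hs⟩ := (c.exists_proj_mem ht).exists
    exact ⟨_, hs 0⟩
  constructor
  · intro h
    exact tendsto_nhds_unique (c.tendsto_absLat hd) h
  · intro h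
    have := c.tendsto_absLat hd
    rwa [h] at this

end ConeChart

theorem IsDihedral.proj_mem_poles_iff (hd : D.IsDihedral) (y : D.Cover) :
    (D.proj y : X) ∈ D.poles ↔ |(D.dev y : E3) 2| = 1 := by
  obtain ⟨c⟩ := D.nonempty_coneChart (D.proj y : X)
  rw [c.mem_poles_iff hd]
  have h := c.abs_absLat_sub_le hd (y := y) (Metric.mem_ball_self c.r_pos)
  rw [dist_self, abs_nonpos_iff, sub_eq_zero] at h
  rw [h]

theorem eq_north_or_eq_neg_north_iff {x : E3} (hx : ‖x‖ = 1) :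
    (x = north ∨ x = -north) ↔ |x 2| = 1 := by
  constructor
  · rintro (h | h) <;> simp [h]
  · intro h
    have h2 := sq_add_sq_add_sq_eq_one hx
    have h3 : x 2 ^ 2 = 1 := by rw [← sq_abs, h, one_pow]
    have h0 : x 0 = 0 := by nlinarith [sq_nonneg (x 0), sq_nonneg (x 1)]
    have h1 : x 1 = 0 := by nlinarith [sq_nonneg (x 0), sq_nonneg (x 1)]
    rcases eq_or_eq_neg_of_abs_eq h with h | h
    · exact Or.inl (E3.ext_coords (by simp [h0]) (by simp [h1]) (by simp [h]))
    · exact Or.inr (E3.ext_coords (by simp [h0]) (by simp [h1]) (by simp [h]))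

theorem ConeChart.exists_sign (hd : D.IsDihedral) {x : X} (c : D.ConeChart x)
    (hx : x ∈ D.poles) : ∃ ε : ℝ, ε * ε = 1 ∧ c.iso north = ε • north := by
  have h1 := (c.mem_poles_iff hd).1 hx
  rcases (eq_north_or_eq_neg_north_iff (by rw [c.iso.norm_map, norm_north])).2 h1 with h | h
  · exact ⟨1, by norm_num, by simpa using h⟩
  · exact ⟨-1, by norm_num, by simpa using h⟩

/-- At radius s from a pole the absolute latitude is cos s, strictly between 0 and 1 since 0 < s <
1. Poles are therefore isolated. -/
theorem ConeChart.eq_of_mem_poles (hd : D.IsDihedral) {x : X} (c : D.ConeChart x)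
    (hx : x ∈ D.poles) {z : X} (hz : z ∈ D.poles) (hzx : z ∈ Metric.ball x c.r) : z = x := by
  by_contra hne
  obtain ⟨s, hs, η, rfl⟩ := c.exists_proj_lift hzx hne
  rw [hd.proj_mem_poles_iff, c.dev_lift s hs] at hz
  obtain ⟨ε, hε, hN⟩ := c.exists_sign hd hx
  rw [map_two_of_map_north hε hN, abs_mul, sph_two,
    show |ε| = 1 by rcases mul_self_eq_one_iff.1 hε with rfl | rfl <;> simp, one_mul] at hz
  have hpos : 0 < cos s := cos_pos_of_mem_Ioo ⟨by linarith [hs.1, pi_pos],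
    by linarith [hs.2, c.r_le, pi_gt_three]⟩
  have hlt : cos s < 1 := by
    rw [← cos_zero]
    exact cos_lt_cos_of_nonneg_of_le_pi le_rfl (hs.2.trans c.polar.radius_lt_pi).le hs.1
  rw [abs_of_pos hpos] at hz
  linarith

/-- An accumulation point of poles has absolute latitude 1 by continuity, so it is itself a pole,
contradicting isolation. -/
theorem IsDihedral.finite_poles [CompactSpace X] (hd : D.IsDihedral) : D.poles.Finite := by
  by_contra hinf
  obtain ⟨x, -, hx⟩ := (show D.poles.Infinite from hinf).exists_accPt_of_subset_isCompact
    isCompact_univ (subset_univ _)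
  obtain ⟨c⟩ := D.nonempty_coneChart x
  rw [accPt_iff_nhds] at hx
  have hxp : x ∈ D.poles := by
    rw [c.mem_poles_iff hd]
    refine eq_of_forall_dist_le fun ε hε => ?_
    obtain ⟨z, ⟨hz, hzp⟩, hzx⟩ := hx _ (Metric.ball_mem_nhds x (lt_min c.r_pos hε))
    have hz1 := Metric.ball_subset_ball (min_le_left _ _) hz
    obtain ⟨s, hs, η, rfl⟩ := c.exists_proj_lift hz1 hzx
    rw [hd.proj_mem_poles_iff] at hzp
    have h := c.abs_absLat_sub_le hd hz1
    rw [hzp] at h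
    rw [dist_comm, dist_eq]
    exact h.trans ((Metric.mem_ball.1 hz).le.trans (min_le_right _ _))
  obtain ⟨z, ⟨hz, hzp⟩, hzx⟩ := hx _ (Metric.ball_mem_nhds x c.r_pos)
  exact hzx (c.eq_of_mem_poles hd hxp hzp hz)

end DevelopingMap

/-! ### Lifted leaf segments (rays) -/

theorem inner_sphAt {σ : ℝ} (hσ : σ * σ = 1) (ψ s t : ℝ) :
    inner ℝ (sphAt σ ψ s) (sphAt σ ψ t) = cos (s - t) := by
  rw [E3.inner_eq, cos_sub]; simp
  linear_combination cos s * cos t * hσ + sin s * sin t * sin_sq_add_cos_sq ψ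

theorem sphAt_add (σ ψ a t : ℝ) :
    sphAt σ ψ (a + t) = cos t • sphAt σ ψ a + sin t • sphAt σ ψ (a + π / 2) := by
  apply E3.ext_coords <;> simp [cos_add, sin_add] <;> ring

theorem sph_eq_cos_add_sin (ψ t : ℝ) : sph ψ t = cos t • north + sin t • sph ψ (π / 2) := by
  apply E3.ext_coords <;> simp <;> ring

theorem abs_sphAt_two {σ : ℝ} (hσ : σ * σ = 1) (ψ t : ℝ) : |sphAt σ ψ t 2| = |cos t| := by
  rw [sphAt_two, abs_mul]
  rcases mul_self_eq_one_iff.1 hσ with rfl | rfl <;> simp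

theorem abs_cos_eq_one_iff {t : ℝ} (h0 : 0 ≤ t) (hπ : t < π) : |cos t| = 1 ↔ t = 0 := by
  constructor
  · intro h
    by_contra hne
    have hs : 0 < sin t := sin_pos_of_pos_of_lt_pi (h0.lt_of_ne (Ne.symm hne)) hπ
    have := sin_sq_add_cos_sq t
    rw [← sq_abs (cos t), h] at this
    nlinarith
  · rintro rfl; simp

theorem eventually_Ioc_nhdsGT {a b : ℝ} (h : a < b) : ∀ᶠ t in 𝓝[>] a, t ∈ Ioc a b :=
  Ioc_mem_nhdsGT h

theorem exists_isPreconnected_mem_nhdsGT {a : ℝ} {U : Set ℝ} (hU : U ∈ 𝓝[>] a) :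
    ∃ V ∈ 𝓝[>] a, V ⊆ U ∧ IsPreconnected V := by
  obtain ⟨b, hb, hbU⟩ := mem_nhdsGT_iff_exists_Ioo_subset.1 hU
  exact ⟨_, Ioo_mem_nhdsGT hb, hbU, isPreconnected_Ioo⟩

theorem exists_isPreconnected_mem_nhdsLT {a : ℝ} {U : Set ℝ} (hU : U ∈ 𝓝[<] a) :
    ∃ V ∈ 𝓝[<] a, V ⊆ U ∧ IsPreconnected V := by
  obtain ⟨b, hb, hbU⟩ := mem_nhdsLT_iff_exists_Ioo_subset.1 hU
  exact ⟨_, Ioo_mem_nhdsLT hb, hbU, isPreconnected_Ioo⟩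

/-- A continuous path upstairs converges if its projection converges to a point of the base. -/
theorem IsCoveringMap.exists_tendsto_of_tendsto {E B : Type*} [TopologicalSpace E]
    [TopologicalSpace B] {p : E → B} (hp : IsCoveringMap p) {l : Filter ℝ} [l.NeBot]
    (hl : ∀ U ∈ l, ∃ V ∈ l, V ⊆ U ∧ IsPreconnected V) {c : ℝ → E} {T : Set ℝ} (hT : T ∈ l)
    (hc : ContinuousOn c T) {x : B} (hx : Tendsto (fun t => p (c t)) l (𝓝 x)) :
    ∃ y, p y = x ∧ Tendsto c l (𝓝 y) := by
  have hne : (p ⁻¹' {x}).Nonempty := by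
    by_contra hem
    -- A point over an evenly covered neighbourhood of `x` lies in a sheet, and this sheet contains
    -- a point over `x`.
    have hev := hp x
    obtain ⟨-, U, hxU, hU, -, H, hH⟩ := hev
    obtain ⟨t, ht⟩ := (hx.eventually (hU.mem_nhds hxU)).exists
    exact hem ⟨(H.symm (⟨x, hxU⟩, (H ⟨c t, ht⟩).2)).1, by
      have := hH (H.symm (⟨x, hxU⟩, (H ⟨c t, ht⟩).2))
      rw [H.apply_symm_apply] at this
      exact this.symm⟩
  have : Nonempty (p ⁻¹' {x}) := hne.to_subtype
  have : DiscreteTopology (p ⁻¹' {x}) := (hp x).discreteTopology_fiber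
  let τ := (hp x).toTrivialization
  have hxτ : x ∈ τ.baseSet := (hp x).mem_toTrivialization_baseSet
  obtain ⟨V, hV, hVU, hVc⟩ := hl _ (inter_mem hT (hx (τ.open_baseSet.mem_nhds hxτ)))
  obtain ⟨t₀, ht₀⟩ := Filter.nonempty_of_mem hV
  have hsrc : ∀ t ∈ V, c t ∈ τ.source := fun t ht => τ.mem_source.2 (hVU ht).2
  have hcont : ContinuousOn (fun t => (τ (c t)).2) V := continuous_snd.comp_continuousOn
    (τ.continuousOn_toFun.comp (hc.mono fun t ht => (hVU ht).1) hsrc)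
  -- The sheet index is continuous with values in a discrete fibre, hence constant on the connected
  -- set `V`.
  have hconst : ∀ t ∈ V, (τ (c t)).2 = (τ (c t₀)).2 := fun t ht =>
    hVc.constant hcont ht ht₀
  have htgt : (x, (τ (c t₀)).2) ∈ τ.target := τ.mem_target.2 hxτ
  refine ⟨τ.toOpenPartialHomeomorph.symm (x, (τ (c t₀)).2), τ.proj_symm_apply htgt, ?_⟩
  have h1 : Tendsto (fun t => (p (c t), (τ (c t₀)).2)) l (𝓝 (x, (τ (c t₀)).2)) :=
    hx.prodMk_nhds tendsto_const_nhds
  have h2 := (τ.continuousOn_invFun.continuousAt (τ.open_target.mem_nhds htgt)).tendsto.comp h1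
  refine h2.congr' ?_
  filter_upwards [hV] with t ht
  have : τ (c t) = (p (c t), (τ (c t₀)).2) := Prod.ext (τ.coe_fst (hsrc t ht)) (hconst t ht)
  change τ.toOpenPartialHomeomorph.symm (p (c t), (τ (c t₀)).2) = c t
  rw [← this]
  exact τ.toOpenPartialHomeomorph.left_inv (hsrc t ht)

namespace DevelopingMap

variable {X : Type u} [MetricSpace X] {S : ConeSphericalSurface X} {D : DevelopingMap.{u, v} S}

variable (D) in
/-- `c` is a segment of a leaf of the longitude foliation, lifted to the universal cover. Its
parameter is the distance to the pole `σ • north`, with values in `(a, φ]`. -/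
structure IsRay (σ ψ a φ : ℝ) (c : ℝ → D.Cover) : Prop where
  nonneg : 0 ≤ a
  lt : a < φ
  lt_pi : φ < π
  continuousOn : ContinuousOn c (Ioc a φ)
  dev_eq : ∀ t ∈ Ioc a φ, (D.dev (c t) : E3) = sphAt σ ψ t

namespace IsRay

variable {σ ψ ψ' a a' φ φ' : ℝ} {c c' : ℝ → D.Cover}

theorem mem_Ioo (h : D.IsRay σ ψ a φ c) {t : ℝ} (ht : t ∈ Ioc a φ) : t ∈ Ioo 0 π :=
  ⟨h.nonneg.trans_lt ht.1, ht.2.trans_lt h.lt_pi⟩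

theorem mono (h : D.IsRay σ ψ a φ c) (h1 : a ≤ a') (h2 : a' < φ') (h3 : φ' ≤ φ) :
    D.IsRay σ ψ a' φ' c where
  nonneg := h.nonneg.trans h1
  lt := h2
  lt_pi := h3.trans_lt h.lt_pi
  continuousOn := h.continuousOn.mono (Ioc_subset_Ioc h1 h3)
  dev_eq t ht := h.dev_eq t (Ioc_subset_Ioc h1 h3 ht)

theorem congr_angle (h : D.IsRay σ ψ a φ c) (hψ : ∀ t, sphAt σ ψ t = sphAt σ ψ' t) :
    D.IsRay σ ψ' a φ c :=
  { h with dev_eq := fun t ht => (h.dev_eq t ht).trans (hψ t) }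

/-- Agreement at one point forces the developed meridians to coincide, and unique lifting through
`dev` does the rest. -/
theorem eqOn (h : D.IsRay σ ψ a φ c) (h' : D.IsRay σ ψ' a φ c') {t : ℝ} (ht : t ∈ Ioc a φ)
    (he : c t = c' t) : EqOn c c' (Ioc a φ) := by
  refine D.eqOn_of_dev_eqOn isPreconnected_Ioc h.continuousOn h'.continuousOn ?_ ht he
  intro s hs
  rw [h.dev_eq s hs, h'.dev_eq s hs]
  exact sphAt_congr (h.mem_Ioo ht) (by rw [← h.dev_eq t ht, ← h'.dev_eq t ht, he]) s

theorem colat_eq (hσ : σ * σ = 1) (h : D.IsRay σ ψ a φ c) (h' : D.IsRay σ ψ' a' φ' c') {t t' : ℝ}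
    (ht : t ∈ Ioc a φ) (ht' : t' ∈ Ioc a' φ') (he : c t = c' t') : t = t' := by
  have h1 : σ * cos t = σ * cos t' := by
    rw [← sphAt_two σ ψ, ← sphAt_two σ ψ', ← h.dev_eq t ht, ← h'.dev_eq t' ht', he]
  have hσ0 : σ ≠ 0 := by rintro rfl; norm_num at hσ
  exact injOn_cos (Ioo_subset_Icc_self (h.mem_Ioo ht)) (Ioo_subset_Icc_self (h'.mem_Ioo ht'))
    (mul_left_cancel₀ hσ0 h1)

theorem eq_of_eq (h : D.IsRay σ ψ a φ c) (h' : D.IsRay σ ψ' a' φ c')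
    (he : c φ = c' φ) {t : ℝ} (ht : t ∈ Ioc a φ) (ht' : t ∈ Ioc a' φ) : c t = c' t :=
  (h.mono (le_max_left a a') (max_lt h.lt h'.lt) le_rfl).eqOn
    (h'.mono (le_max_right a a') (max_lt h.lt h'.lt) le_rfl) ⟨max_lt h.lt h'.lt, le_rfl⟩ he
    ⟨max_lt ht.1 ht'.1, ht.2⟩

open Classical in
/-- Concatenation of rays. -/
theorem glue {t₁ : ℝ} (h : D.IsRay σ ψ a t₁ c) (h' : D.IsRay σ ψ a' φ c') (h1 : a' < t₁)
    (h2 : t₁ ≤ φ) (he : c t₁ = c' t₁) :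
    D.IsRay σ ψ a φ (fun t => if t ≤ t₁ then c t else c' t) where
  nonneg := h.nonneg
  lt := h.lt.trans_le h2
  lt_pi := h'.lt_pi
  continuousOn := by
    refine ContinuousOn.if ?_ ?_ ?_
    · rintro t ⟨-, ht⟩
      rw [show {t : ℝ | t ≤ t₁} = Iic t₁ from rfl, frontier_Iic, mem_singleton_iff] at ht
      rw [ht, he]
    · rw [show {t : ℝ | t ≤ t₁} = Iic t₁ from rfl, closure_Iic]
      exact h.continuousOn.mono fun t ht => ⟨ht.1.1, ht.2⟩
    · have : closure {t : ℝ | ¬ t ≤ t₁} = Ici t₁ := by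
        rw [← closure_Ioi]; congr 1; ext t; simp
      rw [this]
      exact h'.continuousOn.mono fun t ht => ⟨h1.trans_le ht.2, ht.1.2⟩
  dev_eq t ht := by
    by_cases htt : t ≤ t₁
    · rw [if_pos htt, h.dev_eq t ⟨ht.1, htt⟩]
    · rw [if_neg htt, h'.dev_eq t ⟨h1.trans (not_le.1 htt), ht.2⟩]

theorem deck (h : D.IsRay σ ψ a φ c) {γ : D.Cover ≃ₜ D.Cover} {A : E3 ≃ₗᵢ[ℝ] E3}
    (hA : D.IsMonodromy γ A) {ε : ℝ} (hε : ε * ε = 1) (hN : A north = ε • north)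
    (hσ : σ * σ = 1) : ∃ ψ', D.IsRay (ε * σ) ψ' a φ (fun t => γ (c t)) := by
  obtain ⟨ψ', hψ'⟩ := exists_map_sphAt hε hN hσ ψ
  exact ⟨ψ', h.nonneg, h.lt, h.lt_pi, γ.continuous.comp_continuousOn h.continuousOn,
    fun t ht => by rw [hA.2, h.dev_eq t ht, hψ']⟩

/-- A ray has unit speed: `proj` and `dev` being locally compatible isometrically, short steps have
exactly the length of their parameter interval, and continuous induction with the triangle
inequality adds them up. -/
theorem dist_le (hσ : σ * σ = 1) (h : D.IsRay σ ψ a φ c) {s t : ℝ} (hs : s ∈ Ioc a φ)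
    (ht : t ∈ Ioc a φ) (hst : s ≤ t) : dist (D.proj (c s)) (D.proj (c t)) ≤ t - s := by
  have hsub : Icc s t ⊆ Ioc a φ := fun u hu => ⟨hs.1.trans_le hu.1, hu.2.trans ht.2⟩
  have hcp : ContinuousOn (fun u => D.proj (c u)) (Icc s t) :=
    D.isCoveringMap.continuous.comp_continuousOn (h.continuousOn.mono hsub)
  have key : Icc s t ⊆ {u | dist (D.proj (c s)) (D.proj (c u)) ≤ u - s} := by
    refine IsClosed.Icc_subset_of_forall_exists_gt ?_ (by simp) ?_
    · have : {u | dist (D.proj (c s)) (D.proj (c u)) ≤ u - s} ∩ Icc s t =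
          {u ∈ Icc s t | dist (D.proj (c s)) (D.proj (c u)) ≤ u - s} := by
        ext u; exact and_comm
      rw [this]
      exact isClosed_Icc.isClosed_le (continuous_const.dist continuous_id |>.comp_continuousOn hcp) (by fun_prop)
    · rintro u ⟨hu, hut⟩ w hw
      obtain ⟨U, hU, hloc⟩ := D.locallyIsometric (c u)
      have hu' : u ∈ Ioc a φ := hsub ⟨hut.1, hut.2.le⟩
      have h0 : ContinuousOn c (Icc u t) :=
        h.continuousOn.mono fun v hv => hsub ⟨hut.1.trans hv.1, hv.2⟩
      have h1 : ∀ᶠ v in 𝓝[Icc u t] u, c v ∈ U := h0 u ⟨le_rfl, hut.2.le⟩ hU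
      have h2 : ∀ᶠ v in 𝓝[>] u, c v ∈ U := by
        rw [nhdsWithin_Icc_eq_nhdsGE hut.2] at h1
        exact h1.filter_mono (nhdsWithin_mono _ Ioi_subset_Ici_self)
      obtain ⟨v, hvU, hv⟩ :=
        (h2.and (eventually_Ioc_nhdsGT (lt_min hw hut.2))).exists
      have hv' : v ∈ Ioc a φ :=
        ⟨hu'.1.trans hv.1, (hv.2.trans (min_le_right _ _)).trans ht.2⟩
      refine ⟨v, ?_, hv.1, hv.2.trans (min_le_left _ _)⟩
      have h3 : dist (D.proj (c u)) (D.proj (c v)) = v - u := by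
        rw [dist_comm, ← hloc _ hvU _ (mem_of_mem_nhds hU), InnerProductGeometry.angle, norm_dev,
          norm_dev, h.dev_eq u hu', h.dev_eq v hv', inner_sphAt hσ, mul_one, div_one,
          arccos_cos (sub_nonneg.2 hv.1.le)]
        linarith [(h.mem_Ioo hv').2, (h.mem_Ioo hu').1]
      have h4 := dist_triangle (D.proj (c s)) (D.proj (c u)) (D.proj (c v))
      rw [mem_ofPred_eq] at hu ⊢
      linarith
  exact key ⟨hst, le_rfl⟩

theorem exists_tendsto [CompactSpace X] (hσ : σ * σ = 1) (h : D.IsRay σ ψ a φ c) :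
    ∃ x, Tendsto (fun t => (D.proj (c t) : X)) (𝓝[>] a) (𝓝 x) := by
  refine CompleteSpace.complete (f := map (fun t => (D.proj (c t) : X)) (𝓝[>] a)) ?_
  rw [Metric.cauchy_iff]
  refine ⟨inferInstance, fun ε hε => ?_⟩
  refine ⟨_, image_mem_map (Ioc_mem_nhdsGT (show a < min φ (a + ε / 2) from
    lt_min h.lt (by linarith))), ?_⟩
  have key : ∀ s ∈ Ioc a (min φ (a + ε / 2)), ∀ t ∈ Ioc a (min φ (a + ε / 2)), s ≤ t →
      dist (D.proj (c s) : X) (D.proj (c t)) < ε := by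
    intro s hs t ht hst
    have h1 := h.dist_le hσ ⟨hs.1, hs.2.trans (min_le_left _ _)⟩
      ⟨ht.1, ht.2.trans (min_le_left _ _)⟩ hst
    have h2 := ht.2.trans (min_le_right _ _)
    have h3 := hs.1
    rw [Subtype.dist_eq] at h1
    linarith
  rintro _ ⟨s, hs, rfl⟩ _ ⟨t, ht, rfl⟩
  rcases le_total s t with hst | hst
  · exact key s hs t ht hst
  · rw [dist_comm]; exact key t ht s hs hst

theorem tendsto_abs_cos (hσ : σ * σ = 1) (h : D.IsRay σ ψ a φ c) :
    Tendsto (fun t => |(D.dev (c t) : E3) 2|) (𝓝[>] a) (𝓝 |cos a|) := by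
  have h1 : Tendsto (fun t => |cos t|) (𝓝[>] a) (𝓝 |cos a|) :=
    (continuous_cos.abs.tendsto a).mono_left nhdsWithin_le_nhds
  refine h1.congr' ?_
  filter_upwards [eventually_Ioc_nhdsGT h.lt] with t ht
  rw [h.dev_eq t ht, abs_sphAt_two hσ]

/-- The absolute latitude along the ray is |cos t|, so at the end it is |cos a|, which equals 1 only
for a = 0 because 0 ≤ a < π. -/
theorem mem_poles_iff (hd : D.IsDihedral) (hσ : σ * σ = 1) (h : D.IsRay σ ψ a φ c) {x : X}
    (hx : Tendsto (fun t => (D.proj (c t) : X)) (𝓝[>] a) (𝓝 x)) : x ∈ D.poles ↔ a = 0 := by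
  obtain ⟨C⟩ := D.nonempty_coneChart x
  have h1 := (C.tendsto_absLat hd).comp (tendsto_comap_iff.2 hx)
  rw [C.mem_poles_iff hd, tendsto_nhds_unique h1 (h.tendsto_abs_cos hσ),
    abs_cos_eq_one_iff h.nonneg (h.lt.trans h.lt_pi)]

end IsRay

/-- Every leaf can be followed until it reaches a pole or a zero. -/
theorem exists_maximal_isRay [CompactSpace X] (hd : D.IsDihedral) {σ ψ φ : ℝ} (hσ : σ * σ = 1)
    (hφ : φ ∈ Ioo 0 π) {y : D.Cover} (hy : (D.dev y : E3) = sphAt σ ψ φ) :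
    ∃ a c x, D.IsRay σ ψ a φ c ∧ c φ = y ∧
      Tendsto (fun t => (D.proj (c t) : X)) (𝓝[>] a) (𝓝 x) ∧
      (a = 0 ∧ x ∈ D.poles ∨ 0 < a ∧ x ∈ D.zeros) := by
  have hbox : ∀ (y : D.Cover) (t : ℝ), t ∈ Ioo 0 π → (D.dev y : E3) = sphAt σ ψ t →
      ∃ δ > 0, ∃ c, (∀ b ∈ Ioo t (t + δ), D.IsRay σ ψ (t - δ) b c) ∧ c t = y := by
    intro y t ht hyt
    obtain ⟨δ, hδ, g, hg, hgd, hgp, hgπ, -⟩ := D.exists_box hσ (p := (ψ, t)) ht hyt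
    have hball : ∀ s : ℝ, |s - t| < δ → (ψ, s) ∈ Metric.ball ((ψ, t) : ℝ × ℝ) δ := by
      intro s hs
      rw [← ball_prod_same]
      exact ⟨Metric.mem_ball_self hδ, by rwa [Metric.mem_ball, dist_eq]⟩
    refine ⟨min δ t / 2, by have := ht.1; positivity, fun s => g (ψ, s), fun b hb => ?_, hgp⟩
    have h1 := min_le_left δ t
    have h2 := min_le_right δ t
    have h3 : 0 < min δ t := lt_min hδ ht.1
    have hb1 := hb.1
    have hb2 := hb.2
    have hmem : ∀ s ∈ Ioc (t - min δ t / 2) b, (ψ, s) ∈ Metric.ball ((ψ, t) : ℝ × ℝ) δ := by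
      intro s hs
      refine hball s (abs_lt.2 ⟨?_, ?_⟩) <;> linarith [hs.1, hs.2]
    exact ⟨by linarith [ht.1], by linarith, (hgπ _ (hmem b ⟨by linarith, le_rfl⟩)).2,
      hg.comp (by fun_prop) hmem, fun s hs => hgd _ (hmem s hs)⟩
  let 𝒜 : Set ℝ := {a | ∃ c, D.IsRay σ ψ a φ c ∧ c φ = y}
  have hne : 𝒜.Nonempty := by
    obtain ⟨δ, hδ, c, hc, hcy⟩ := hbox y φ hφ hy
    exact ⟨φ - δ, c, (hc (φ + δ / 2) ⟨by linarith, by linarith⟩).mono le_rfl (by linarith)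
      (by linarith), hcy⟩
  have hbdd : BddBelow 𝒜 := ⟨0, fun a ⟨_, hc, _⟩ => hc.nonneg⟩
  set a₀ := sInf 𝒜
  have ha₀ : 0 ≤ a₀ := le_csInf hne fun a ⟨_, hc, _⟩ => hc.nonneg
  have haφ : a₀ < φ := by
    obtain ⟨a, ha⟩ := hne
    have h1 := csInf_le hbdd ha
    obtain ⟨c, hc, -⟩ := ha
    exact h1.trans_lt hc.lt
  have hch : ∀ t : ℝ, ∃ a c, a₀ < t → (D.IsRay σ ψ a φ c ∧ c φ = y ∧ a < t) := by
    intro t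
    by_cases ht : a₀ < t
    · obtain ⟨a, ⟨c, hc, hcy⟩, hat⟩ := exists_lt_of_csInf_lt hne ht
      exact ⟨a, c, fun _ => ⟨hc, hcy, hat⟩⟩
    · exact ⟨0, fun _ => y, fun h => absurd h ht⟩
  choose b d hbd using hch
  have heq : ∀ t ∈ Ioc a₀ φ, ∀ s ∈ Ioc (b t) φ, a₀ < s → d s s = d t s := by
    intro t ht s hs has
    obtain ⟨h1, h2, h3⟩ := hbd t ht.1
    obtain ⟨h4, h5, h6⟩ := hbd s has
    exact h4.eq_of_eq h1 (h5.trans h2.symm) ⟨h6, hs.2⟩ hs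
  -- Rays ending at `y` agree wherever both are defined, so the diagonal of the family `d` is one
  -- ray on all of `(a₀, φ]`.
  have hray : D.IsRay σ ψ a₀ φ fun t => d t t := by
    refine ⟨ha₀, haφ, hφ.2, fun t ht => ?_, fun t ht => ?_⟩
    · obtain ⟨h1, h2, h3⟩ := hbd t ht.1
      have h4 := h1.continuousOn t ⟨h3, ht.2⟩
      have hN : Ioi (b t) ∈ 𝓝 t := Ioi_mem_nhds h3
      have h5 : ContinuousWithinAt (d t) (Ioc a₀ φ ∩ Ioi (b t)) t :=
        h4.mono fun s hs => ⟨hs.2, hs.1.2⟩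
      have h6 : ContinuousWithinAt (fun t => d t t) (Ioc a₀ φ ∩ Ioi (b t)) t :=
        h5.congr (fun s hs => heq t ht s ⟨hs.2, hs.1.2⟩ hs.1.1) rfl
      exact h6.mono_of_mem_nhdsWithin (inter_mem self_mem_nhdsWithin (nhdsWithin_le_nhds hN))
    · obtain ⟨h1, h2, h3⟩ := hbd t ht.1
      exact h1.dev_eq t ⟨h3, ht.2⟩
  have hrayφ : d φ φ = y := (hbd φ haφ).2.1
  obtain ⟨x, hx⟩ := hray.exists_tendsto hσ
  have hpole := hray.mem_poles_iff hd hσ hx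
  refine ⟨a₀, _, x, hray, hrayφ, hx, ?_⟩
  rcases ha₀.eq_or_lt with h0 | h0
  · exact Or.inl ⟨h0.symm, hpole.2 h0.symm⟩
  refine Or.inr ⟨h0, ?_, fun h => h0.ne' (hpole.1 h)⟩
  -- If the limit were not a cone point, the ray would converge in the cover, and a coordinate box
  -- at the limit would prolong it below the infimum `a₀`.
  by_contra hxP
  have hx' : Tendsto (fun t => D.proj (d t t)) (𝓝[>] a₀) (𝓝 ⟨x, hxP⟩) :=
    tendsto_subtype_rng.2 hx
  obtain ⟨y₀, -, hlim⟩ := D.isCoveringMap.exists_tendsto_of_tendsto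
    (fun U hU => exists_isPreconnected_mem_nhdsGT hU) (eventually_Ioc_nhdsGT haφ)
    hray.continuousOn hx'
  have hy₀ : (D.dev y₀ : E3) = sphAt σ ψ a₀ := by
    have h1 := (D.continuous_dev_coe.tendsto y₀).comp hlim
    have h2 : Tendsto (fun t => sphAt σ ψ t) (𝓝[>] a₀) (𝓝 (sphAt σ ψ a₀)) :=
      (((continuous_sphAt σ).comp (Continuous.prodMk_right ψ)).tendsto a₀).mono_left
        nhdsWithin_le_nhds
    refine tendsto_nhds_unique h1 (h2.congr' ?_)
    filter_upwards [eventually_Ioc_nhdsGT haφ] with t ht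
    exact (hray.dev_eq t ht).symm
  obtain ⟨δ, hδ, g, hg, hgy⟩ := hbox y₀ a₀ ⟨h0, haφ.trans hφ.2⟩ hy₀
  obtain ⟨U, hU, hyU, hinj⟩ := D.isLocallyInjective_dev y₀
  have hg' := hg (a₀ + δ / 2) ⟨by linarith, by linarith⟩
  have hgc : Tendsto g (𝓝[>] a₀) (𝓝 y₀) := by
    rw [← hgy]
    refine (hg'.continuousOn.continuousAt ?_).tendsto.mono_left nhdsWithin_le_nhds
    exact Ioc_mem_nhds (by linarith) (by linarith)
  obtain ⟨t, ⟨htU, htgU⟩, ht⟩ := ((hlim.eventually (hU.mem_nhds hyU)).and (hgc.eventually (hU.mem_nhds hyU))).and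
    (eventually_Ioc_nhdsGT (lt_min haφ (show a₀ < a₀ + δ / 2 by linarith))) |>.exists
  have ht1 : t ≤ φ := ht.2.trans (min_le_left _ _)
  have ht2 : t ≤ a₀ + δ / 2 := ht.2.trans (min_le_right _ _)
  have hge : g t = d t t := by
    refine hinj htgU htU (Subtype.ext ?_)
    rw [hg'.dev_eq t ⟨by linarith [ht.1], ht2⟩, hray.dev_eq t ⟨ht.1, ht1⟩]
  have hglue := (hg'.mono le_rfl (by linarith [ht.1]) ht2).glue hray ht.1 ht1 hge
  have hmem : a₀ - δ ∈ 𝒜 := by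
    refine ⟨_, hglue, ?_⟩
    by_cases htφ : φ ≤ t
    · have : t = φ := le_antisymm ht1 htφ
      subst this
      simp only [le_refl, if_true]
      exact hge.trans hrayφ
    · simp only [if_neg htφ]
      exact hrayφ
  linarith [csInf_le hbdd hmem]

end DevelopingMap

/-! ### Ends of leaves -/

namespace DevelopingMap

variable {X : Type u} [MetricSpace X] {S : ConeSphericalSurface X} {D : DevelopingMap.{u, v} S}

namespace IsRay

variable {σ ψ ψ' a a' b φ φ' : ℝ} {c c' : ℝ → D.Cover}

/-- Near its end point, a ray is radial in the polar coordinates about this point. -/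
theorem exists_radial (hσ : σ * σ = 1) (h : D.IsRay σ ψ a φ c) {x : X}
    (hx : Tendsto (fun t => (D.proj (c t) : X)) (𝓝[>] a) (𝓝 x))
    (hne : ∀ t ∈ Ioc a φ, (D.proj (c t) : X) ≠ x) (C : D.ConeChart x) :
    ∃ (γ : D.Cover ≃ₜ D.Cover) (hγ : D.IsDeck γ) (A : E3 ≃ₗᵢ[ℝ] E3) (hA : D.IsMonodromy γ A)
      (η t₁ : ℝ), t₁ ∈ Ioc a φ ∧ t₁ - a < C.r ∧
      (∀ u, (C.translate hγ hA).iso (sph η u) = sphAt σ ψ (a + u)) ∧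
      ∀ t ∈ Ioc a t₁, c t = (C.translate hγ hA).lift (t - a, η) := by
  have hev : ∀ᶠ t in 𝓝[>] a, (D.proj (c t) : X) ∈ Metric.ball x C.r :=
    hx.eventually (Metric.ball_mem_nhds _ C.r_pos)
  obtain ⟨t₀, ht₀, ht₀'⟩ := mem_nhdsGT_iff_exists_Ioo_subset.1
    (hev.and (eventually_Ioc_nhdsGT h.lt))
  set t₁ := (a + t₀) / 2
  have hat₁ : a < t₁ := by simp only [t₁]; linarith [mem_Ioi.1 ht₀]
  have ht₁ : t₁ < t₀ := by simp only [t₁]; linarith [mem_Ioi.1 ht₀]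
  have hmem : ∀ t ∈ Ioc a t₁, (D.proj (c t) : X) ∈ Metric.ball x C.r ∧ t ∈ Ioc a φ := fun t ht =>
    ht₀' ⟨ht.1, ht.2.trans_lt ht₁⟩
  have h1 := hmem t₁ ⟨hat₁, le_rfl⟩
  obtain ⟨γ, hγ, A, hA, hc⟩ := C.exists_translate h1.1 (hne t₁ h1.2)
  set C' := C.translate hγ hA
  have hsub : c '' Ioc a t₁ ⊆ C'.image := by
    refine C'.subset_image_of_isPreconnected (isPreconnected_Ioc.image _
      (h.continuousOn.mono fun t ht => (hmem t ht).2)) ?_ ⟨_, ⟨t₁, ⟨hat₁, le_rfl⟩, rfl⟩, hc⟩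
    rintro _ ⟨t, ht, rfl⟩
    exact ⟨(hmem t ht).1, hne t (hmem t ht).2⟩
  have hcoord : ∀ t ∈ Ioc a t₁, ∃ s ∈ Ioo 0 C.r, ∃ η, C'.lift (s, η) = c t := by
    intro t ht
    obtain ⟨⟨s, η⟩, hp, he⟩ := hsub ⟨t, ht, rfl⟩
    exact ⟨s, hp.1, η, he⟩
  -- The developed ray converges both to the developed centre of the chart and to the point of
  -- parameter `a` on its meridian.
  have hN : C'.iso north = sphAt σ ψ a := by
    have h2 : Tendsto (fun t => sphAt σ ψ t) (𝓝[>] a) (𝓝 (sphAt σ ψ a)) :=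
      (((continuous_sphAt σ).comp (Continuous.prodMk_right ψ)).tendsto a).mono_left
        nhdsWithin_le_nhds
    refine tendsto_nhds_unique ?_ h2
    rw [tendsto_iff_norm_sub_tendsto_zero]
    have h3 : Tendsto (fun t => dist (D.proj (c t) : X) x) (𝓝[>] a) (𝓝 0) :=
      tendsto_iff_dist_tendsto_zero.1 hx
    refine squeeze_zero' (Eventually.of_forall fun _ => norm_nonneg _) ?_ h3
    filter_upwards [eventually_Ioc_nhdsGT hat₁] with t ht
    obtain ⟨s, hs, η, he⟩ := hcoord t ht
    rw [← h.dev_eq t (hmem t ht).2, ← he, C'.dev_lift s hs, C'.dist_proj_lift hs, ← map_sub,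
      C'.iso.norm_map]
    exact norm_sph_sub_north_le hs.1.le η
  obtain ⟨s, hs, η, he⟩ := hcoord t₁ ⟨hat₁, le_rfl⟩
  have hπ : t₁ < π := h1.2.2.trans_lt h.lt_pi
  have hs' : s = t₁ - a := by
    have h2 : inner ℝ (D.dev (c t₁) : E3) (C'.iso north) = cos s := by
      rw [← he, C'.dev_lift s hs, C'.iso.inner_map_map, inner_north, sph_two]
    rw [h.dev_eq t₁ h1.2, hN, inner_sphAt hσ] at h2
    refine injOn_cos ⟨hs.1.le, (hs.2.trans C.polar.radius_lt_pi).le⟩ ⟨by linarith, ?_⟩ h2.symm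
    linarith [h.nonneg]
  subst hs'
  -- Two great circle arcs from the developed centre that share the point at distance `t₁ - a`, in
  -- (0, π), have the same initial direction.
  have hdir : C'.iso (sph η (π / 2)) = sphAt σ ψ (a + π / 2) := by
    have h2 := C'.dev_lift _ hs η
    rw [he, h.dev_eq t₁ h1.2, sph_eq_cos_add_sin, map_add, map_smul, map_smul, hN,
      show t₁ = a + (t₁ - a) by ring, sphAt_add, add_sub_cancel_left] at h2
    have hsin : sin (t₁ - a) ≠ 0 := (sin_pos_of_pos_of_lt_pi hs.1 (by linarith [h.nonneg])).ne'
    exact (smul_right_injective _ hsin (add_left_cancel h2)).symm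
  have hiso : ∀ u, C'.iso (sph η u) = sphAt σ ψ (a + u) := fun u => by
    rw [sph_eq_cos_add_sin, map_add, map_smul, map_smul, hN, hdir, sphAt_add σ ψ a u]
  refine ⟨γ, hγ, A, hA, η, t₁, h1.2, hs.2, hiso, ?_⟩
  have hmaps : MapsTo (fun t => (t - a, η)) (Ioc a t₁) (Ioo 0 C'.r ×ˢ univ) := fun t ht =>
    ⟨⟨by simpa using ht.1, (sub_le_sub_right ht.2 a).trans_lt hs.2⟩, trivial⟩
  refine D.eqOn_of_dev_eqOn isPreconnected_Ioc (h.continuousOn.mono fun t ht => (hmem t ht).2)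
    (C'.continuousOn_lift.comp (by fun_prop) hmaps) ?_ ⟨hat₁, le_rfl⟩ he.symm
  intro t ht
  rw [h.dev_eq t (hmem t ht).2, C'.dev_lift _ (hmaps ht).1, hiso, add_sub_cancel]

theorem proj_ne (hd : D.IsDihedral) (hσ : σ * σ = 1) (h : D.IsRay σ ψ a φ c) {x : X}
    (hx : x ∈ D.poles ∨ x ∈ S.conePts) : ∀ t ∈ Ioc a φ, (D.proj (c t) : X) ≠ x := by
  rintro t ht rfl
  rcases hx with hx | hx
  · rw [hd.proj_mem_poles_iff, h.dev_eq t ht, abs_sphAt_two hσ,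
      abs_cos_eq_one_iff (h.mem_Ioo ht).1.le (h.mem_Ioo ht).2] at hx
    exact (h.mem_Ioo ht).1.ne' hx
  · exact D.proj_notMem _ hx

/-- A ray that extends beyond the end point of another one does not meet a cone point there. -/
theorem notMem_of_lt (h : D.IsRay σ ψ b φ c) (h' : D.IsRay σ ψ' a φ c') (he : c φ = c' φ)
    (hba : b < a) {x : X} (hx : Tendsto (fun t => (D.proj (c' t) : X)) (𝓝[>] a) (𝓝 x)) :
    x ∉ S.conePts := by
  have ha : a ∈ Ioc b φ := ⟨hba, h'.lt.le⟩
  have h1 : Tendsto (fun t => (D.proj (c t) : X)) (𝓝[>] a) (𝓝 (D.proj (c a))) := by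
    have h2 : ContinuousWithinAt c (Ioo a φ) a :=
      (h.continuousOn a ha).mono fun t ht => ⟨hba.trans ht.1, ht.2.le⟩
    have h3 : ContinuousWithinAt (fun t => (D.proj (c t) : X)) (Ioo a φ) a :=
      D.continuous_proj.continuousAt.comp_continuousWithinAt h2
    rwa [ContinuousWithinAt, nhdsWithin_Ioo_eq_nhdsGT h'.lt] at h3
  have h4 : x = D.proj (c a) := by
    refine tendsto_nhds_unique hx (h1.congr' ?_)
    filter_upwards [eventually_Ioc_nhdsGT h'.lt] with t ht
    rw [h.eq_of_eq h' he ⟨hba.trans ht.1, ht.2⟩ ht]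
  rw [h4]
  exact D.proj_notMem _

end IsRay

variable (D) in
/-- The leaf of the longitude foliation through `y`, followed in the direction of `σ • north`, ends
at the point `x`, which is the pole `σ • north` if `a = 0` and has distance `a` from it otherwise. -/
def Ends (σ : ℝ) (y : D.Cover) (a : ℝ) (x : X) : Prop :=
  ∃ ψ φ c, D.IsRay σ ψ a φ c ∧ c φ = y ∧ Tendsto (fun t => (D.proj (c t) : X)) (𝓝[>] a) (𝓝 x) ∧
    (a = 0 ∨ x ∈ S.conePts)

theorem exists_ends [CompactSpace X] (hd : D.IsDihedral) {σ : ℝ} (hσ : σ * σ = 1) {y : D.Cover}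
    (hy : |(D.dev y : E3) 2| ≠ 1) : ∃ a x, D.Ends σ y a x := by
  have hle := abs_two_le_one (D.norm_dev y)
  have h1 : |σ * (D.dev y : E3) 2| < 1 := by
    rw [abs_mul, show |σ| = 1 by rcases mul_self_eq_one_iff.1 hσ with rfl | rfl <;> simp, one_mul]
    exact hle.lt_of_ne hy
  rw [abs_lt] at h1
  have hφ : arccos (σ * (D.dev y : E3) 2) ∈ Ioo 0 π := by
    refine ⟨arccos_pos.2 h1.2, (arccos_le_pi _).lt_of_ne ?_⟩
    rw [ne_eq, arccos_eq_pi]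
    linarith
  obtain ⟨ψ, hψ⟩ := exists_sphAt_eq (D.norm_dev y) (φ := arccos (σ * (D.dev y : E3) 2)) hσ
    (by rw [cos_arccos h1.1.le h1.2.le, ← mul_assoc, hσ, one_mul]) hφ.1.le hφ.2.le
  obtain ⟨a, c, x, hc, hcy, hx, h⟩ := exists_maximal_isRay hd hσ hφ hψ
  exact ⟨a, x, ψ, _, c, hc, hcy, hx, h.imp And.left fun h => h.2.1⟩

namespace Ends

variable {σ a a' : ℝ} {y : D.Cover} {x x' : X}

theorem pole_or_zero (hd : D.IsDihedral) (hσ : σ * σ = 1) (h : D.Ends σ y a x) :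
    a = 0 ∧ x ∈ D.poles ∨ 0 < a ∧ x ∈ D.zeros := by
  obtain ⟨ψ, φ, c, hc, -, hx, h⟩ := h
  have hp := hc.mem_poles_iff hd hσ hx
  rcases hc.nonneg.eq_or_lt with h0 | h0
  · exact Or.inl ⟨h0.symm, hp.2 h0.symm⟩
  · exact Or.inr ⟨h0, h.resolve_left h0.ne', fun h' => h0.ne' (hp.1 h')⟩

theorem abs_ne (hσ : σ * σ = 1) (h : D.Ends σ y a x) : |(D.dev y : E3) 2| ≠ 1 := by
  obtain ⟨ψ, φ, c, hc, rfl, -, -⟩ := h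
  have hφ : φ ∈ Ioc a φ := ⟨hc.lt, le_rfl⟩
  rw [hc.dev_eq φ hφ, abs_sphAt_two hσ, ne_eq,
    abs_cos_eq_one_iff (hc.mem_Ioo hφ).1.le (hc.mem_Ioo hφ).2]
  exact (hc.mem_Ioo hφ).1.ne'

/-- The last clause of `Ends` makes the ray maximal: a ray reaching further than another would pass
through the cone point at which the other stops. -/
theorem unique (hσ : σ * σ = 1) (h : D.Ends σ y a x) (h' : D.Ends σ y a' x') : a = a' ∧ x = x' := by
  obtain ⟨ψ, φ, c, hc, hcy, hx, h⟩ := h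
  obtain ⟨ψ', φ', c', hc', hcy', hx', h'⟩ := h'
  obtain rfl : φ = φ' := hc.colat_eq hσ hc' ⟨hc.lt, le_rfl⟩ ⟨hc'.lt, le_rfl⟩ (hcy.trans hcy'.symm)
  have he := hcy.trans hcy'.symm
  obtain rfl : a = a' := by
    by_contra hne
    rcases lt_or_gt_of_ne hne with hlt | hlt
    · exact hc.notMem_of_lt hc' he hlt hx' (h'.resolve_left (hc.nonneg.trans_lt hlt).ne')
    · exact hc'.notMem_of_lt hc he.symm hlt hx (h.resolve_left (hc'.nonneg.trans_lt hlt).ne')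
  refine ⟨rfl, tendsto_nhds_unique hx (hx'.congr' ?_)⟩
  filter_upwards [eventually_Ioc_nhdsGT hc.lt] with t ht
  rw [hc.eq_of_eq hc' he ht ht]

/-- The end and its distance are read off in the surface and do not change. Only the direction is
affected, by the sign ε of the monodromy on `north`. -/
theorem deck (h : D.Ends σ y a x) (hσ : σ * σ = 1) {γ : D.Cover ≃ₜ D.Cover} (hγ : D.IsDeck γ)
    {A : E3 ≃ₗᵢ[ℝ] E3} (hA : D.IsMonodromy γ A) {ε : ℝ} (hε : ε * ε = 1)
    (hN : A north = ε • north) : D.Ends (ε * σ) (γ y) a x := by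
  obtain ⟨ψ, φ, c, hc, rfl, hx, h⟩ := h
  obtain ⟨ψ', hc'⟩ := hc.deck hA hε hN hσ
  refine ⟨ψ', φ, _, hc', rfl, ?_, h⟩
  simpa only [hγ.coe] using hx

end Ends

theorem IsRay.ends {σ ψ a φ : ℝ} {c : ℝ → D.Cover} (h : D.IsRay σ ψ a φ c) {x : X}
    (hx : Tendsto (fun t => (D.proj (c t) : X)) (𝓝[>] a) (𝓝 x)) (hax : a = 0 ∨ x ∈ S.conePts)
    {t : ℝ} (ht : t ∈ Ioc a φ) : D.Ends σ (c t) a x :=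
  ⟨ψ, t, c, h.mono le_rfl ht.1 ht.2, rfl, hx, hax⟩

/-- Points on a common leaf segment have the same ends. -/
theorem IsRay.ends_iff {σ ψ b φ a : ℝ} {c : ℝ → D.Cover} (hσ : σ * σ = 1)
    (h : D.IsRay σ ψ b φ c) {x : X} {s t : ℝ} (hs : s ∈ Ioc b φ) (ht : t ∈ Ioc b φ) :
    D.Ends σ (c s) a x ↔ D.Ends σ (c t) a x := by
  wlog hst : s ≤ t generalizing s t
  · exact (this ht hs (le_of_not_ge hst)).symm
  constructor
  · rintro ⟨ψ₁, φ₁, c₁, h₁, he, hx, hax⟩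
    obtain rfl : φ₁ = s := h₁.colat_eq hσ h ⟨h₁.lt, le_rfl⟩ hs he
    have hang := sphAt_congr (h.mem_Ioo hs)
      ((h₁.dev_eq φ₁ ⟨h₁.lt, le_rfl⟩).symm.trans ((by rw [he] : _ = _).trans (h.dev_eq φ₁ hs)))
    have hg := (h₁.congr_angle hang).glue (h.mono le_rfl ht.1 ht.2) hs.1 hst he
    refine ⟨ψ, t, _, hg, ?_, hx.congr' ?_, hax⟩
    · by_cases htφ : t ≤ φ₁
      · obtain rfl : φ₁ = t := le_antisymm hst htφ
        simpa using he
      · exact if_neg htφ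
    · filter_upwards [eventually_Ioc_nhdsGT h₁.lt] with u hu
      rw [if_pos hu.2]
  · rintro ⟨ψ₁, φ₁, c₁, h₁, he, hx, hax⟩
    obtain rfl : φ₁ = t := h₁.colat_eq hσ h ⟨h₁.lt, le_rfl⟩ ht he
    have h' := h.mono le_rfl ht.1 ht.2
    by_cases has : a < s
    · refine ⟨ψ₁, s, c₁, h₁.mono le_rfl has hst, ?_, hx, hax⟩
      exact h₁.eq_of_eq h' he ⟨has, hst⟩ ⟨hs.1, hst⟩
    · have hba : b < a := hs.1.trans_le (not_lt.1 has)
      exact absurd (hax.resolve_left (h.nonneg.trans_lt hba).ne')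
        (h'.notMem_of_lt h₁ he.symm hba hx)

/-- The radial segments of a chart about a pole are leaves ending at its centre, in the direction of
whichever of ± `north` the centre develops to. -/
theorem ConeChart.ends_of_mem_image {q : X} (C : D.ConeChart q) {σ : ℝ} (hσ : σ * σ = 1)
    (hN : C.iso north = σ • north) {y : D.Cover} (hy : y ∈ C.image) : D.Ends σ y 0 q := by
  obtain ⟨⟨s, η⟩, ⟨hs, -⟩, rfl⟩ := hy
  obtain ⟨ψ', hψ'⟩ := exists_map_sphAt hσ hN (one_mul 1) η
  simp only [sphAt_one_eq, mul_one] at hψ'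
  have hmaps : MapsTo (fun t => (t, η)) (Ioc 0 s) (Ioo 0 C.r ×ˢ univ) := fun t ht =>
    ⟨⟨ht.1, ht.2.trans_lt hs.2⟩, trivial⟩
  refine ⟨ψ', s, fun t => C.lift (t, η), ⟨le_rfl, hs.1, hs.2.trans C.polar.radius_lt_pi,
    C.continuousOn_lift.comp (by fun_prop) hmaps, fun t ht => ?_⟩, rfl, ?_, Or.inl rfl⟩
  · rw [C.dev_lift t (hmaps ht).1, hψ']
  · rw [tendsto_iff_dist_tendsto_zero]
    have : Tendsto (fun t : ℝ => t) (𝓝[>] 0) (𝓝 0) := nhdsWithin_le_nhds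
    refine this.congr' ?_
    filter_upwards [eventually_Ioc_nhdsGT hs.1] with t ht
    rw [C.dist_proj_lift (hmaps ht).1]

/-- The set of points whose leaf ends at a given pole is open. -/
theorem isOpen_setOf_ends (hd : D.IsDihedral) {σ : ℝ} (hσ : σ * σ = 1) (q : X) :
    IsOpen {y | D.Ends σ y 0 q} := by
  set O := {y | D.Ends σ y 0 q}
  rw [isOpen_iff_mem_nhds]
  intro y hy
  have hy' := hy
  obtain ⟨ψ, φ, c, hc, rfl, hx, h⟩ := hy
  obtain ⟨C⟩ := D.nonempty_coneChart q
  have hq : q ∈ D.poles := (hc.mem_poles_iff hd hσ hx).2 rfl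
  obtain ⟨γ, hγ, A, hA, η, t₁, ht₁, hr, hiso, hlift⟩ :=
    hc.exists_radial hσ hx (hc.proj_ne hd hσ (Or.inl hq)) C
  set C' := C.translate hγ hA
  have hN : C'.iso north = σ • north := by
    have := hiso 0
    rwa [sph_colat_zero, add_zero, sphAt_colat_zero] at this
  have h1 : O ∈ 𝓝 (c t₁) := by
    refine mem_of_superset (C'.isOpen_image.mem_nhds ?_) fun y hy => C'.ends_of_mem_image hσ hN hy
    rw [hlift t₁ ⟨ht₁.1, le_rfl⟩]
    exact ⟨_, ⟨⟨by simpa using ht₁.1, hr⟩, trivial⟩, rfl⟩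
  -- Near the pole all leaves are radial, so the claim holds at `c t₁`. It is carried along the leaf
  -- to `c φ`, and for this a local statement around each parameter `s` suffices.
  refine isPreconnected_Ioc.induction₂' (fun s t => O ∈ 𝓝 (c s) → O ∈ 𝓝 (c t)) ?_
    (fun _ _ _ _ _ _ h1 h2 h => h2 (h1 h)) ht₁ (⟨hc.lt, le_rfl⟩ : φ ∈ Ioc 0 φ) h1
  intro s hs
  obtain ⟨δ, hδ, g, hg, hgd, hgs, hgπ, hgo⟩ := D.exists_box hσ (p := (ψ, s)) (hc.mem_Ioo hs)
    (hc.dev_eq s hs)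
  rw [← ball_prod_same] at hg hgd hgπ hgo
  have hline : ∀ ψ' ∈ Metric.ball ψ δ,
      D.IsRay σ ψ' (s - δ / 2) (s + δ / 2) fun t => g (ψ', t) := by
    intro ψ' hψ'
    have hm : ∀ t ∈ Icc (s - δ / 2) (s + δ / 2), (ψ', t) ∈ Metric.ball ψ δ ×ˢ Metric.ball s δ := by
      intro t ht
      refine ⟨hψ', ?_⟩
      rw [Metric.mem_ball, dist_eq, abs_lt]
      constructor <;> linarith [ht.1, ht.2]
    exact ⟨(hgπ _ (hm _ ⟨le_rfl, by linarith⟩)).1.le, by linarith,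
      (hgπ _ (hm _ ⟨by linarith, le_rfl⟩)).2,
      hg.comp (by fun_prop) fun t ht => hm t ⟨ht.1.le, ht.2⟩,
      fun t ht => hgd _ (hm t ⟨ht.1.le, ht.2⟩)⟩
  have hmem : ∀ t ∈ Ioo (s - δ / 2) (s + δ / 2), (ψ, t) ∈ Metric.ball ψ δ ×ˢ Metric.ball s δ := by
    intro t ht
    refine ⟨Metric.mem_ball_self hδ, ?_⟩
    rw [Metric.mem_ball, dist_eq, abs_lt]
    constructor <;> linarith [ht.1, ht.2]
  -- In a coordinate box all points of a vertical line have the same ends, so a neighbourhood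
  -- contained in `O` at one height spreads to every other height.
  have hbox : ∀ t ∈ Ioo (s - δ / 2) (s + δ / 2), ∀ t' ∈ Ioo (s - δ / 2) (s + δ / 2),
      O ∈ 𝓝 (g (ψ, t)) → O ∈ 𝓝 (g (ψ, t')) := by
    intro t ht t' ht' hO
    have hball : ∀ᶠ ψ' in 𝓝 ψ, ψ' ∈ Metric.ball ψ δ := Metric.ball_mem_nhds _ hδ
    have hct : ContinuousAt g (ψ, t) := hg.continuousAt
      ((Metric.isOpen_ball.prod Metric.isOpen_ball).mem_nhds (hmem t ht))
    have h2 : ∀ᶠ ψ' in 𝓝 ψ, g (ψ', t) ∈ O :=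
      (hct.comp (f := fun ψ' => (ψ', t)) (by fun_prop)).eventually hO
    have h3 : ∀ᶠ p in 𝓝 (ψ, t'), g (p.1, t) ∈ O ∧ p.1 ∈ Metric.ball ψ δ ∧
        p.2 ∈ Ioo (s - δ / 2) (s + δ / 2) := by
      have hf : Tendsto Prod.fst (𝓝 (ψ, t')) (𝓝 ψ) := continuous_fst.tendsto _
      have hs : Tendsto Prod.snd (𝓝 (ψ, t')) (𝓝 t') := continuous_snd.tendsto _
      exact (hf.eventually h2).and ((hf.eventually hball).and (hs.eventually (isOpen_Ioo.mem_nhds ht')))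
    refine mem_of_superset (hgo _ (hmem t' ht') _ h3) ?_
    rintro _ ⟨p, ⟨hp1, hp2, hp3⟩, rfl⟩
    exact ((hline p.1 hp2).ends_iff hσ ⟨ht.1, ht.2.le⟩ ⟨hp3.1, hp3.2.le⟩).1 hp1
  have hgc : ∀ t ∈ Ioc 0 φ ∩ Ioo (s - δ / 2) (s + δ / 2), c t = g (ψ, t) := by
    have hpre : IsPreconnected (Ioc 0 φ ∩ Ioo (s - δ / 2) (s + δ / 2)) :=
      (ordConnected_Ioc.inter ordConnected_Ioo).isPreconnected
    have hss : s ∈ Ioc 0 φ ∩ Ioo (s - δ / 2) (s + δ / 2) := ⟨hs, by linarith, by linarith⟩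
    refine D.eqOn_of_dev_eqOn hpre (hc.continuousOn.mono inter_subset_left)
      (((hline ψ (Metric.mem_ball_self hδ)).continuousOn).mono fun t ht => ⟨ht.2.1, ht.2.2.le⟩) ?_
      hss hgs.symm
    intro t ht
    rw [hc.dev_eq t ht.1, hgd _ (hmem t ht.2)]
  have hIoo : Ioo (s - δ / 2) (s + δ / 2) ∈ 𝓝 s := Ioo_mem_nhds (by linarith) (by linarith)
  filter_upwards [self_mem_nhdsWithin, nhdsWithin_le_nhds hIoo] with t ht ht'
  have hs' := mem_of_mem_nhds hIoo
  rw [hgc s ⟨hs, hs'⟩, hgc t ⟨ht, ht'⟩]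
  exact ⟨hbox s hs' t ht', hbox t ht' s hs'⟩

end DevelopingMap

/-! ### Leaf segments in the surface and critical leaves -/

theorem tendsto_sub_nhdsGT (a b : ℝ) : Tendsto (fun t => a - t) (𝓝[>] (a - b)) (𝓝[<] b) := by
  refine tendsto_nhdsWithin_iff.2 ⟨?_, ?_⟩
  · have : Tendsto (fun t => a - t) (𝓝 (a - b)) (𝓝 (a - (a - b))) :=
      (continuous_const.sub continuous_id).tendsto _
    rw [sub_sub_cancel] at this
    exact this.mono_left nhdsWithin_le_nhds
  · filter_upwards [self_mem_nhdsWithin] with t ht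
    simp only [mem_Ioi, mem_Iio] at ht ⊢
    linarith

theorem tendsto_sub_nhdsLT (a b : ℝ) : Tendsto (fun t => a - t) (𝓝[<] (a - b)) (𝓝[>] b) := by
  refine tendsto_nhdsWithin_iff.2 ⟨?_, ?_⟩
  · have : Tendsto (fun t => a - t) (𝓝 (a - b)) (𝓝 (a - (a - b))) :=
      (continuous_const.sub continuous_id).tendsto _
    rw [sub_sub_cancel] at this
    exact this.mono_left nhdsWithin_le_nhds
  · filter_upwards [self_mem_nhdsWithin] with t ht
    simp only [mem_Ioi, mem_Iio] at ht ⊢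
    linarith

namespace DevelopingMap

variable {X : Type u} [MetricSpace X] {S : ConeSphericalSurface X} {D : DevelopingMap.{u, v} S}

theorem sphAt_sub_pi (σ ψ t : ℝ) : sphAt (-σ) ψ (π - t) = sphAt σ ψ t := by
  rw [sphAt_neg_eq, sub_sub_cancel]

theorem isRay_of_Ioo {σ ψ a b : ℝ} {c : ℝ → D.Cover} (ha : 0 ≤ a) (hb : b ≤ π)
    (hc : ContinuousOn c (Ioo a b)) (hdev : ∀ t ∈ Ioo a b, (D.dev (c t) : E3) = sphAt σ ψ t)
    {t : ℝ} (ht : t ∈ Ioo a b) : D.IsRay σ ψ a t c :=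
  ⟨ha, ht.1, ht.2.trans_le hb, hc.mono fun _ hs => ⟨hs.1, hs.2.trans_lt ht.2⟩,
    fun s hs => hdev s ⟨hs.1, hs.2.trans_lt ht.2⟩⟩

theorem isRay_reverse_of_Ioo {σ ψ a b : ℝ} {c : ℝ → D.Cover} (ha : 0 ≤ a) (hb : b ≤ π)
    (hc : ContinuousOn c (Ioo a b)) (hdev : ∀ t ∈ Ioo a b, (D.dev (c t) : E3) = sphAt σ ψ t)
    {t : ℝ} (ht : t ∈ Ioo a b) : D.IsRay (-σ) ψ (π - b) (π - t) fun s => c (π - s) := by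
  have hmaps : MapsTo (fun s => π - s) (Ioc (π - b) (π - t)) (Ioo a b) := fun s hs =>
    ⟨by linarith [hs.2, ht.1], by linarith [hs.1]⟩
  refine ⟨by linarith, by linarith [ht.2], by linarith [ht.1],
    hc.comp (by fun_prop) hmaps, fun s hs => ?_⟩
  rw [hdev _ (hmaps hs), sphAt_neg_eq]

theorem Ends.exists_of_proj_eq (hd : D.IsDihedral) {σ a : ℝ} (hσ : σ * σ = 1) {y y' : D.Cover}
    {x : X} (h : D.Ends σ y a x) (hy : (D.proj y : X) = D.proj y') :
    ∃ σ', σ' * σ' = 1 ∧ D.Ends σ' y' a x := by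
  obtain ⟨γ, hγ, rfl⟩ := D.exists_deck hy
  obtain ⟨A, ε, hA, hε, hN⟩ := hd.exists_sign hγ
  exact ⟨ε * σ, by linear_combination σ * σ * hε + hσ, h.deck hσ hγ hA hε hN⟩

open Classical in
/-- The two halves of a leaf through a point form a leaf segment. -/
theorem exists_isLeafSegment {y : D.Cover} {a b : ℝ} {p q : X} (h₁ : D.Ends 1 y a p)
    (h₂ : D.Ends (-1) y b q) : ∃ d, D.IsLeafSegment d a (π - b) ∧ d a = p ∧ d (π - b) = q ∧
      (D.proj y : X) ∈ d '' Ioo a (π - b) ∧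
      ∀ t ∈ Ioo a (π - b), ∃ y', (D.proj y' : X) = d t ∧ D.Ends 1 y' a p ∧ D.Ends (-1) y' b q := by
  obtain ⟨ψ, φ, c₁, hc₁, hy₁, hp, hap⟩ := h₁
  obtain ⟨ψ₂, φ₂, c₂, hc₂, hy₂, hq, hbq⟩ := h₂
  have hφ : φ ∈ Ioc a φ := ⟨hc₁.lt, le_rfl⟩
  have hφ₂ : φ₂ ∈ Ioc b φ₂ := ⟨hc₂.lt, le_rfl⟩
  have hdev : sphAt 1 ψ φ = sphAt 1 ψ₂ (π - φ₂) := by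
    rw [← sphAt_neg_eq, ← hc₁.dev_eq φ hφ, ← hc₂.dev_eq φ₂ hφ₂, hy₁, hy₂]
  have hφφ : φ = π - φ₂ := by
    have h1 := congrArg (fun x : E3 => x 2) hdev
    simp only [sphAt_two, one_mul] at h1
    have h2 := hc₁.mem_Ioo hφ
    have h3 := hc₂.mem_Ioo hφ₂
    exact injOn_cos (Ioo_subset_Icc_self h2) ⟨by linarith [h3.2], by linarith [h3.1]⟩ h1
  rw [← hφφ] at hdev
  have hang := sphAt_congr (hc₁.mem_Ioo hφ) hdev
  -- The half towards `-north` is traversed backwards, so that the colatitude becomes the common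
  -- parameter. The halves meet over `y` at `φ = π - φ₂`.
  let c : ℝ → D.Cover := fun t => if t ≤ φ then c₁ t else c₂ (π - t)
  have hcφ : c₁ φ = c₂ (π - φ) := by rw [hy₁, ← hy₂, hφφ, sub_sub_cancel]
  have haφ : a < φ := hc₁.lt
  have hφb : φ < π - b := by linarith [hc₂.lt]
  have hmaps : MapsTo (fun t => π - t) (Ico φ (π - b)) (Ioc b φ₂) := fun t ht =>
    ⟨by linarith [ht.2], by linarith [ht.1]⟩
  have hcont : ContinuousOn c (Ioo a (π - b)) := by
    refine ContinuousOn.if ?_ ?_ ?_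
    · rintro t ⟨-, ht⟩
      rw [show {t : ℝ | t ≤ φ} = Iic φ from rfl, frontier_Iic, mem_singleton_iff] at ht
      rw [ht, hcφ]
    · rw [show {t : ℝ | t ≤ φ} = Iic φ from rfl, closure_Iic]
      exact hc₁.continuousOn.mono fun t ht => ⟨ht.1.1, ht.2⟩
    · have : closure {t : ℝ | ¬ t ≤ φ} = Ici φ := by
        rw [← closure_Ioi]; congr 1; ext t; simp
      rw [this]
      exact hc₂.continuousOn.comp (by fun_prop) fun t ht => hmaps ⟨ht.2, ht.1.2⟩
  have hcdev : ∀ t ∈ Ioo a (π - b), (D.dev (c t) : E3) = sphAt 1 ψ t := by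
    intro t ht
    simp only [c]
    split_ifs with h
    · exact hc₁.dev_eq t ⟨ht.1, h⟩
    · rw [hc₂.dev_eq _ (hmaps ⟨(not_le.1 h).le, ht.2⟩), sphAt_sub_pi, hang]
  have hta : Tendsto (fun t => (D.proj (c t) : X)) (𝓝[>] a) (𝓝 p) := by
    refine hp.congr' ?_
    filter_upwards [eventually_Ioc_nhdsGT haφ] with t ht
    rw [show c t = c₁ t from if_pos ht.2]
  have htb' : Tendsto (fun t => (D.proj (c (π - t)) : X)) (𝓝[>] b) (𝓝 q) := by
    refine hq.congr' ?_
    filter_upwards [Ioo_mem_nhdsGT hc₂.lt] with t ht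
    have h1 : ¬ π - t ≤ φ := by linarith [ht.2]
    simp only [c, if_neg h1, sub_sub_cancel]
  have htb : Tendsto (fun t => (D.proj (c t) : X)) (𝓝[<] (π - b)) (𝓝 q) := by
    have := htb'.comp (tendsto_sub_nhdsLT π b)
    simpa [Function.comp_def] using this
  have hpc : ContinuousOn (fun t => (D.proj (c t) : X)) (Ioo a (π - b)) :=
    D.continuous_proj.comp_continuousOn hcont
  have hab : a < π - b := haφ.trans hφb
  have hext : ∀ t ∈ Ioo a (π - b), extendFrom (Ioo a (π - b)) (fun t => (D.proj (c t) : X)) t =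
      D.proj (c t) := fun t ht =>
    extendFrom_eq (subset_closure ht) (hpc t ht)
  refine ⟨extendFrom (Ioo a (π - b)) fun t => (D.proj (c t) : X), ⟨hc₁.nonneg, hab,
    by linarith [hc₂.nonneg], continuousOn_Icc_extendFrom_Ioo hpc hta htb, ψ, c, hcont,
    fun t ht => ⟨(hext t ht).symm, by rw [hcdev t ht, sphAt_one_eq]⟩⟩,
    eq_lim_at_left_extendFrom_Ioo hab hta, eq_lim_at_right_extendFrom_Ioo hab htb, ?_, ?_⟩
  · refine ⟨φ, ⟨haφ, hφb⟩, ?_⟩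
    rw [hext φ ⟨haφ, hφb⟩, show c φ = c₁ φ from if_pos le_rfl, hy₁]
  · intro t ht
    have hle : π - b ≤ π := by linarith [hc₂.nonneg]
    refine ⟨c t, (hext t ht).symm, ⟨ψ, t, c, isRay_of_Ioo hc₁.nonneg hle hcont hcdev ht, rfl, hta,
      hap⟩, ψ, π - t, _, by
        simpa using isRay_reverse_of_Ioo hc₁.nonneg hle hcont hcdev ht, by simp, htb', hbq⟩

theorem eq_one_or_eq_neg_one {σ : ℝ} (hσ : σ * σ = 1) : σ = 1 ∨ σ = -1 := mul_self_eq_one_iff.1 hσ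

/-- On a generic surface, no leaf connects two zeros. -/
theorem IsGeneric.notMem_zeros (hg : D.IsGeneric) {σ : ℝ} (hσ : σ * σ = 1) {y : D.Cover} {a b : ℝ}
    {p q : X} (h₁ : D.Ends σ y a p) (h₂ : D.Ends (-σ) y b q) (hp : p ∈ D.zeros) :
    q ∉ D.zeros := by
  intro hq
  rcases eq_one_or_eq_neg_one hσ with rfl | rfl
  · obtain ⟨d, hl, hda, hdb, -⟩ := exists_isLeafSegment h₁ h₂
    exact hg ⟨d, _, _, hl, hda ▸ hp, hdb ▸ hq⟩
  · rw [neg_neg] at h₂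
    obtain ⟨d, hl, hda, hdb, -⟩ := exists_isLeafSegment h₂ h₁
    exact hg ⟨d, _, _, hl, hda ▸ hq, hdb ▸ hp⟩

/-- Following the leaf in the opposite direction as well gives a closed leaf segment through the
point with the zero as one endpoint. -/
theorem Ends.mem_crit [CompactSpace X] (hd : D.IsDihedral) {σ : ℝ} (hσ : σ * σ = 1) {y : D.Cover}
    {a : ℝ} {z : X} (h : D.Ends σ y a z) (hz : z ∈ D.zeros) : (D.proj y : X) ∈ D.crit := by
  have hσ' : -σ * -σ = 1 := by linear_combination hσ
  obtain ⟨b, q, h'⟩ := exists_ends hd hσ' (h.abs_ne hσ)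
  rcases eq_one_or_eq_neg_one hσ with rfl | rfl
  · obtain ⟨d, hl, hda, hdb, ⟨t, ht, hdt⟩, -⟩ := exists_isLeafSegment h h'
    exact Or.inr ⟨d, _, _, hl, Or.inl (hda ▸ hz), t, Ioo_subset_Icc_self ht, hdt⟩
  · rw [neg_neg] at h'
    obtain ⟨d, hl, hda, hdb, ⟨t, ht, hdt⟩, -⟩ := exists_isLeafSegment h' h
    exact Or.inr ⟨d, _, _, hl, Or.inr (hdb ▸ hz), t, Ioo_subset_Icc_self ht, hdt⟩

/-- An endpoint of an `IsLeafSegment` may be a regular point. In that case the open lift converges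
in the cover and, with its limit added, becomes a ray ending at the zero `z`. -/
theorem exists_ends_of_tendsto (hd : D.IsDihedral) {σ ψ a b : ℝ} (hσ : σ * σ = 1) (ha : 0 ≤ a)
    (hab : a < b) (hb : b ≤ π) {c : ℝ → D.Cover} (hc : ContinuousOn c (Ioo a b))
    (hdev : ∀ t ∈ Ioo a b, (D.dev (c t) : E3) = sphAt σ ψ t) {z : X} (hz : z ∈ D.zeros)
    (hza : Tendsto (fun t => (D.proj (c t) : X)) (𝓝[>] a) (𝓝 z)) {y : D.Cover}
    (hy : (D.proj y : X) ∉ D.poles)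
    (hyb : Tendsto (fun t => (D.proj (c t) : X)) (𝓝[<] b) (𝓝 (D.proj y))) :
    ∃ σ' a, σ' * σ' = 1 ∧ D.Ends σ' y a z := by
  obtain ⟨y₀, hy₀, hlim⟩ := D.isCoveringMap.exists_tendsto_of_tendsto
    (fun U hU => exists_isPreconnected_mem_nhdsLT hU) (Ioo_mem_nhdsLT hab) hc
    (tendsto_subtype_rng.2 hyb)
  have hdev₀ : (D.dev y₀ : E3) = sphAt σ ψ b := by
    have h1 := (D.continuous_dev_coe.tendsto y₀).comp hlim
    have h2 : Tendsto (fun t => sphAt σ ψ t) (𝓝[<] b) (𝓝 (sphAt σ ψ b)) :=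
      (((continuous_sphAt σ).comp (Continuous.prodMk_right ψ)).tendsto b).mono_left
        nhdsWithin_le_nhds
    refine tendsto_nhds_unique h1 (h2.congr' ?_)
    filter_upwards [Ioo_mem_nhdsLT hab] with t ht
    exact (hdev t ht).symm
  have hbπ : b < π := by
    refine hb.lt_of_ne ?_
    rintro rfl
    rw [← hy₀, hd.proj_mem_poles_iff, hdev₀, abs_sphAt_two hσ] at hy
    simp at hy
  have hext : ∀ t ∈ Ioo a b, Function.update c b y₀ t = c t := fun t ht =>
    Function.update_of_ne ht.2.ne _ _
  have hcont : ContinuousOn (Function.update c b y₀) (Ioc a b) := by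
    rw [continuousOn_update_iff, Ioc_sdiff_right, nhdsWithin_Ioo_eq_nhdsLT hab]
    exact ⟨hc, fun _ => hlim⟩
  have hends : D.Ends σ y₀ a z := by
    refine ⟨ψ, b, Function.update c b y₀, ⟨ha, hab, hbπ, hcont, fun t ht => ?_⟩,
      Function.update_self .., ?_, Or.inr hz.1⟩
    · rcases ht.2.eq_or_lt with rfl | htb
      · rw [Function.update_self, hdev₀]
      · rw [hext t ⟨ht.1, htb⟩, hdev t ⟨ht.1, htb⟩]
    · refine hza.congr' ?_
      filter_upwards [Ioo_mem_nhdsGT hab] with t ht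
      rw [hext t ht]
  obtain ⟨σ', h1, h2⟩ := hends.exists_of_proj_eq hd hσ (y' := y) (by rw [hy₀])
  exact ⟨σ', a, h1, h2⟩

/-- A point on a critical leaf lies on a leaf that ends at a zero. -/
theorem exists_ends_of_mem_crit (hd : D.IsDihedral) {y : D.Cover} (hy : (D.proj y : X) ∈ D.crit)
    (hyp : (D.proj y : X) ∉ D.poles) : ∃ σ a z, σ * σ = 1 ∧ D.Ends σ y a z ∧ z ∈ D.zeros := by
  rcases hy with hy | ⟨d, a, b, ⟨ha, hab, hb, hdc, ψ, c, hc, hcd⟩, hz, t, ht, hdt⟩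
  · exact absurd hy.1 (D.proj_notMem y)
  have hdev : ∀ t ∈ Ioo a b, (D.dev (c t) : E3) = sphAt 1 ψ t := fun t ht => by
    rw [(hcd t ht).2, sphAt_one_eq]
  have hta : Tendsto (fun t => (D.proj (c t) : X)) (𝓝[>] a) (𝓝 (d a)) := by
    have h1 := (hdc a ⟨le_rfl, hab.le⟩).mono Ioo_subset_Icc_self
    rw [ContinuousWithinAt, nhdsWithin_Ioo_eq_nhdsGT hab] at h1
    refine h1.congr' ?_
    filter_upwards [Ioo_mem_nhdsGT hab] with s hs
    exact (hcd s hs).1.symm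
  have htb : Tendsto (fun t => (D.proj (c t) : X)) (𝓝[<] b) (𝓝 (d b)) := by
    have h1 := (hdc b ⟨hab.le, le_rfl⟩).mono Ioo_subset_Icc_self
    rw [ContinuousWithinAt, nhdsWithin_Ioo_eq_nhdsLT hab] at h1
    refine h1.congr' ?_
    filter_upwards [Ioo_mem_nhdsLT hab] with s hs
    exact (hcd s hs).1.symm
  have hta' : Tendsto (fun t => (D.proj (c (π - t)) : X)) (𝓝[<] (π - a)) (𝓝 (d a)) :=
    hta.comp (tendsto_sub_nhdsLT π a)
  have htb' : Tendsto (fun t => (D.proj (c (π - t)) : X)) (𝓝[>] (π - b)) (𝓝 (d b)) :=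
    htb.comp (tendsto_sub_nhdsGT π b)
  -- If the point is an endpoint of the segment, the zero must be the other endpoint, since `y` lies
  -- over no cone point.
  rcases eq_or_lt_of_le ht.1 with rfl | hat
  · have hz' : d b ∈ D.zeros := hz.resolve_left fun h => D.proj_notMem y (by rw [← hdt]; exact h.1)
    have hmaps : MapsTo (fun s => π - s) (Ioo (π - b) (π - a)) (Ioo a b) := fun s hs =>
      ⟨by linarith [hs.2], by linarith [hs.1]⟩
    obtain ⟨σ', a', h1, h2⟩ := exists_ends_of_tendsto hd (σ := -1) (ψ := ψ) (by norm_num)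
      (by linarith) (by linarith) (by linarith) (c := fun s => c (π - s))
      (hc.comp (by fun_prop) hmaps)
      (fun s hs => by rw [hdev _ (hmaps hs), sphAt_neg_eq]) hz' htb' hyp (hdt ▸ hta')
    exact ⟨σ', a', _, h1, h2, hz'⟩
  rcases eq_or_lt_of_le ht.2 with rfl | htb₁
  · have hz' : d a ∈ D.zeros := hz.resolve_right fun h => D.proj_notMem y (by rw [← hdt]; exact h.1)
    obtain ⟨σ', a', h1, h2⟩ := exists_ends_of_tendsto hd (one_mul 1) ha hab hb hc hdev hz' hta hyp
      (hdt ▸ htb)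
    exact ⟨σ', a', _, h1, h2, hz'⟩
  have ht' : t ∈ Ioo a b := ⟨hat, htb₁⟩
  have hproj : (D.proj (c t) : X) = D.proj y := (hcd t ht').1.trans hdt
  rcases hz with hz | hz
  · have he : D.Ends 1 (c t) a (d a) :=
      ⟨ψ, t, c, isRay_of_Ioo ha hb hc hdev ht', rfl, hta, Or.inr hz.1⟩
    obtain ⟨σ', h1, h2⟩ := he.exists_of_proj_eq hd (one_mul 1) hproj
    exact ⟨σ', _, _, h1, h2, hz⟩
  · have he : D.Ends (-1) (c t) (π - b) (d b) :=
      ⟨ψ, π - t, _, isRay_reverse_of_Ioo ha hb hc hdev ht', by simp, htb', Or.inr hz.1⟩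
    obtain ⟨σ', h1, h2⟩ := he.exists_of_proj_eq hd (by norm_num) hproj
    exact ⟨σ', _, _, h1, h2, hz⟩

end DevelopingMap

/-- The zeros of a nontrivial sinusoid in a bounded interval are finite in number. -/
theorem finite_setOf_sinusoid_eq_zero {α β : ℝ} (h : α ^ 2 + β ^ 2 ≠ 0) (L : ℝ) :
    {κ ∈ Ico 0 L | α * sin κ + β * cos κ = 0}.Finite := by
  -- Two zeros of the same nontrivial sinusoid differ by a multiple of π, so the integer part of κ/π
  -- is injective on them.
  have hmaps : MapsTo (fun κ : ℝ => ⌊κ / π⌋) {κ ∈ Ico 0 L | α * sin κ + β * cos κ = 0}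
      (Icc 0 ⌊L / π⌋) := fun κ hκ =>
    ⟨Int.floor_nonneg.2 (div_nonneg hκ.1.1 pi_pos.le),
      Int.floor_le_floor (div_le_div_of_nonneg_right hκ.1.2.le pi_pos.le)⟩
  refine Finite.of_injOn hmaps ?_ (finite_Icc _ _)
  intro κ hκ κ' hκ' he
  have hsin : sin (κ - κ') = 0 := by
    rw [sin_sub]
    have h1 : α * (sin κ * cos κ' - cos κ * sin κ') = 0 := by
      linear_combination cos κ' * hκ.2 - cos κ * hκ'.2
    have h2 : β * (sin κ * cos κ' - cos κ * sin κ') = 0 := by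
      linear_combination sin κ * hκ'.2 - sin κ' * hκ.2
    by_contra hne
    refine h ?_
    rw [(mul_eq_zero.1 h1).resolve_right hne, (mul_eq_zero.1 h2).resolve_right hne]
    norm_num
  have habs : |κ - κ'| < π := by
    have := Int.abs_sub_lt_one_of_floor_eq_floor he
    rwa [← sub_div, abs_div, abs_of_pos pi_pos, div_lt_one pi_pos] at this
  rw [abs_lt] at habs
  exact sub_eq_zero.1 ((sin_eq_zero_iff_of_lt_of_lt habs.1 habs.2).1 hsin)

/-! ### Leaves of length π and bigons -/

namespace DevelopingMap

variable {X : Type u} [MetricSpace X] {S : ConeSphericalSurface X} {D : DevelopingMap.{u, v} S}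

variable (D) in
/-- The leaf of the longitude foliation through `y` has length `π` and joins the pole `p` in the
direction of `north` to the pole `q` in the opposite direction. -/
def Joins (y : D.Cover) (p q : X) : Prop := D.Ends 1 y 0 p ∧ D.Ends (-1) y 0 q

/-- On a critical leaf one end is a zero. Ends are unique and both are poles here. -/
theorem Joins.notMem (hd : D.IsDihedral) {y : D.Cover} {p q : X} (h : D.Joins y p q) :
    (D.proj y : X) ∈ (D.crit ∪ D.poles)ᶜ := by
  have hp : (D.proj y : X) ∉ D.poles := by
    rw [hd.proj_mem_poles_iff]; exact h.1.abs_ne (one_mul 1)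
  rintro (hc | hc)
  · obtain ⟨σ, a, z, hσ, he, hz⟩ := exists_ends_of_mem_crit hd hc hp
    rcases eq_one_or_eq_neg_one hσ with rfl | rfl
    · obtain ⟨rfl, rfl⟩ := he.unique hσ h.1
      exact hz.2 ((h.1.pole_or_zero hd hσ).resolve_right fun h => h.1.ne' rfl).2
    · obtain ⟨rfl, rfl⟩ := he.unique hσ h.2
      exact hz.2 ((h.2.pole_or_zero hd hσ).resolve_right fun h => h.1.ne' rfl).2
  · exact hp hc

theorem Ends.mem_poles (hd : D.IsDihedral) {σ : ℝ} (hσ : σ * σ = 1) {y : D.Cover} {q : X}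
    (h : D.Ends σ y 0 q) : q ∈ D.poles :=
  ((h.pole_or_zero hd hσ).resolve_right fun h => h.1.ne' rfl).2

theorem exists_joins [CompactSpace X] (hd : D.IsDihedral) {y : D.Cover}
    (hy : (D.proj y : X) ∈ (D.crit ∪ D.poles)ᶜ) : ∃ p q, D.Joins y p q := by
  rw [mem_compl_iff, mem_union, not_or] at hy
  have hne := hy.2
  rw [hd.proj_mem_poles_iff] at hne
  have key : ∀ σ : ℝ, σ * σ = 1 → ∃ p, D.Ends σ y 0 p := by
    intro σ hσ
    obtain ⟨a, x, h⟩ := exists_ends hd hσ hne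
    rcases h.pole_or_zero hd hσ with ⟨rfl, -⟩ | ⟨-, hz⟩
    · exact ⟨x, h⟩
    · exact absurd (h.mem_crit hd hσ hz) hy.1
  obtain ⟨p, hp⟩ := key 1 (one_mul 1)
  obtain ⟨q, hq⟩ := key (-1) (by norm_num)
  exact ⟨p, q, hp, hq⟩

theorem exists_proj_eq_of_notMem {x : X} (hx : x ∈ (D.crit ∪ D.poles)ᶜ) :
    ∃ y, (D.proj y : X) = x := by
  refine D.exists_proj_eq fun hP => hx ?_
  by_cases hp : x ∈ D.poles
  · exact Or.inr hp
  · exact Or.inl (Or.inl ⟨hP, hp⟩)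

namespace Bigon

theorem subset (B : D.Bigon) : B.1 ⊆ (D.crit ∪ D.poles)ᶜ := by
  obtain ⟨x, hx, h⟩ := B.2
  rw [h]
  exact connectedComponentIn_subset _ _

theorem isPreconnected (B : D.Bigon) : IsPreconnected B.1 := by
  obtain ⟨x, hx, h⟩ := B.2
  rw [h]
  exact isPreconnected_connectedComponentIn

theorem nonempty (B : D.Bigon) : B.1.Nonempty := by
  obtain ⟨x, hx, h⟩ := B.2
  exact ⟨x, by rw [h]; exact mem_connectedComponentIn hx⟩

theorem eq_connectedComponentIn (B : D.Bigon) {x : X} (hx : x ∈ B.1) :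
    B.1 = connectedComponentIn (D.crit ∪ D.poles)ᶜ x := by
  obtain ⟨x', hx', h⟩ := B.2
  rw [h] at hx ⊢
  exact connectedComponentIn_eq hx

theorem subset_of_isPreconnected (B : D.Bigon) {T : Set X} (hT : IsPreconnected T)
    (hsub : T ⊆ (D.crit ∪ D.poles)ᶜ) {x : X} (hx : x ∈ T) (hxB : x ∈ B.1) : T ⊆ B.1 := by
  rw [B.eq_connectedComponentIn hxB]
  exact hT.subset_connectedComponentIn hx hsub

/-- The whole open leaf is connected and avoids critical leaves and poles, so it stays in one
component. -/
theorem hasVertices_of_joins (hd : D.IsDihedral) (B : D.Bigon) {y : D.Cover} {p q : D.Pole}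
    (h : D.Joins y p q) (hy : (D.proj y : X) ∈ B.1) : B.HasVertices p q := by
  obtain ⟨d, hl, hda, hdb, hyd, hj⟩ := exists_isLeafSegment h.1 h.2
  rw [sub_zero] at hl hdb hyd hj
  refine ⟨d, hl, ?_, Or.inl ⟨hda, hdb⟩⟩
  refine B.subset_of_isPreconnected (isPreconnected_Ioo.image _
    (hl.2.2.2.1.mono Ioo_subset_Icc_self)) ?_ hyd hy
  rintro _ ⟨t, ht, rfl⟩
  obtain ⟨y', hy', hj'⟩ := hj t ht
  rw [← hy']
  exact Joins.notMem hd hj'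

end Bigon

/-- A full leaf segment of length `π`, lifted to the universal cover. -/
theorem IsLeafSegment.exists_lift {d : ℝ → X} (h : D.IsLeafSegment d 0 π) :
    ∃ ψ c, (∀ b ∈ Ioo 0 π, D.IsRay 1 ψ 0 b c) ∧ (∀ t ∈ Ioo 0 π, (D.proj (c t) : X) = d t) ∧
      Tendsto (fun t => (D.proj (c t) : X)) (𝓝[>] 0) (𝓝 (d 0)) ∧
      ∀ t ∈ Ioo 0 π, D.Joins (c t) (d 0) (d π) := by
  obtain ⟨-, hπ, -, hdc, ψ, c, hc, hcd⟩ := h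
  have hdev : ∀ t ∈ Ioo 0 π, (D.dev (c t) : E3) = sphAt 1 ψ t := fun t ht => by
    rw [(hcd t ht).2, sphAt_one_eq]
  have hta : Tendsto (fun t => (D.proj (c t) : X)) (𝓝[>] 0) (𝓝 (d 0)) := by
    have h1 := (hdc 0 ⟨le_rfl, hπ.le⟩).mono Ioo_subset_Icc_self
    rw [ContinuousWithinAt, nhdsWithin_Ioo_eq_nhdsGT hπ] at h1
    refine h1.congr' ?_
    filter_upwards [Ioo_mem_nhdsGT hπ] with s hs
    exact (hcd s hs).1.symm
  have htb : Tendsto (fun t => (D.proj (c t) : X)) (𝓝[<] π) (𝓝 (d π)) := by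
    have h1 := (hdc π ⟨hπ.le, le_rfl⟩).mono Ioo_subset_Icc_self
    rw [ContinuousWithinAt, nhdsWithin_Ioo_eq_nhdsLT hπ] at h1
    refine h1.congr' ?_
    filter_upwards [Ioo_mem_nhdsLT hπ] with s hs
    exact (hcd s hs).1.symm
  refine ⟨ψ, c, fun b hb => isRay_of_Ioo le_rfl le_rfl hc hdev hb, fun t ht => (hcd t ht).1, hta,
    fun t ht => ⟨⟨ψ, t, c, isRay_of_Ioo le_rfl le_rfl hc hdev ht, rfl, hta, Or.inl rfl⟩, ?_⟩⟩
  have h1 := isRay_reverse_of_Ioo le_rfl le_rfl hc hdev ht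
  rw [sub_self] at h1
  have h2 := htb.comp (tendsto_sub_nhdsGT π π)
  rw [sub_self] at h2
  exact ⟨ψ, π - t, _, h1, by simp, h2, Or.inl rfl⟩

/-- The unordered pair of poles joined by a leaf only depends on the leaf in the surface. -/
theorem Joins.sym2_eq_of_proj_eq (hd : D.IsDihedral) {y y' : D.Cover}
    (hy : (D.proj y : X) = D.proj y') {p q p' q' : X} (h : D.Joins y p q)
    (h' : D.Joins y' p' q') : s(p, q) = s(p', q') := by
  obtain ⟨γ, hγ, rfl⟩ := D.exists_deck hy
  obtain ⟨A, ε, hA, hε, hN⟩ := hd.exists_sign hγ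
  have h1 := h.1.deck (one_mul 1) hγ hA hε hN
  have h2 := h.2.deck (by norm_num) hγ hA hε hN
  rcases eq_one_or_eq_neg_one hε with rfl | rfl
  · rw [one_mul] at h1 h2
    rw [(h1.unique (one_mul 1) h'.1).2, (h2.unique (by norm_num) h'.2).2]
  · norm_num at h1 h2
    rw [(h1.unique (by norm_num) h'.2).2, (h2.unique (by norm_num) h'.1).2]
    exact Sym2.eq_swap

/-- Having given ends is an open condition on the cover and `proj` is open, so the unordered pair of
ends is locally constant on the connected bigon. This lets the vertices be read off from any leaf.
-/
theorem Bigon.sym2_eq [CompactSpace X] (hd : D.IsDihedral) (B : D.Bigon) {y y' : D.Cover}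
    (hy : (D.proj y : X) ∈ B.1) (hy' : (D.proj y' : X) ∈ B.1) {p q p' q' : X} (h : D.Joins y p q)
    (h' : D.Joins y' p' q') : s(p, q) = s(p', q') := by
  refine B.isPreconnected.induction₂' (fun x x' => ∀ y y' p q p' q', (D.proj y : X) = x →
    (D.proj y' : X) = x' → D.Joins y p q → D.Joins y' p' q' → s(p, q) = s(p', q')) ?_ ?_ hy hy'
    y y' p q p' q' rfl rfl h h'
  · intro x hx
    obtain ⟨y₀, rfl⟩ := exists_proj_eq_of_notMem (B.subset hx)
    obtain ⟨p₀, q₀, h₀⟩ := exists_joins hd (B.subset hx)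
    have hO := ((isOpen_setOf_ends hd (one_mul 1) p₀).inter
      (isOpen_setOf_ends hd (show (-1 : ℝ) * -1 = 1 by norm_num) q₀)).mem_nhds h₀
    filter_upwards [nhdsWithin_le_nhds (D.image_proj_mem_nhds hO)] with x' hx'
    obtain ⟨y₁, h₁, rfl⟩ := hx'
    refine ⟨fun y y' p q p' q' hy hy' h h' => ?_, fun y y' p q p' q' hy hy' h h' => ?_⟩
    · rw [h.sym2_eq_of_proj_eq hd hy h₀, h'.sym2_eq_of_proj_eq hd hy' h₁]
    · rw [h.sym2_eq_of_proj_eq hd hy h₁, h'.sym2_eq_of_proj_eq hd hy' h₀]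
  · intro x x' x'' _ hx' _ h1 h2 y y'' p q p'' q'' hy hy'' h h''
    obtain ⟨y', hy'⟩ := exists_proj_eq_of_notMem (B.subset hx')
    obtain ⟨p', q', h'⟩ := exists_joins hd (y := y') (by rw [hy']; exact B.subset hx')
    exact (h1 y y' p q p' q' hy hy' h h').trans (h2 y' y'' p' q' p'' q'' hy' hy'' h' h'')

theorem Bigon.HasVertices.exists_joins {B : D.Bigon} {p q : D.Pole} (h : B.HasVertices p q) :
    ∃ y p' q', (D.proj y : X) ∈ B.1 ∧ D.Joins y p' q' ∧ s(p', q') = s((p : X), (q : X)) := by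
  obtain ⟨d, hl, hB, hpq⟩ := h
  obtain ⟨ψ, c, -, hproj, -, hj⟩ := hl.exists_lift
  have hmem : π / 2 ∈ Ioo 0 π := ⟨by positivity, by linarith [pi_pos]⟩
  refine ⟨c (π / 2), _, _, by rw [hproj _ hmem]; exact hB ⟨_, hmem, rfl⟩, hj _ hmem, ?_⟩
  rcases hpq with ⟨h1, h2⟩ | ⟨h1, h2⟩
  · rw [h1, h2]
  · rw [h1, h2]; exact Sym2.eq_swap

theorem Bigon.HasVertices.sym2_eq [CompactSpace X] (hd : D.IsDihedral) {B : D.Bigon}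
    {p q p' q' : D.Pole} (h : B.HasVertices p q) (h' : B.HasVertices p' q') :
    s(p, q) = s(p', q') := by
  obtain ⟨y₁, p₁, q₁, hy₁, hj₁, h₁⟩ := h.exists_joins
  obtain ⟨y₂, p₂, q₂, hy₂, hj₂, h₂⟩ := h'.exists_joins
  have h3 := h₁.symm.trans ((B.sym2_eq hd hy₁ hy₂ hj₁ hj₂).trans h₂)
  rw [Sym2.eq_iff] at h3 ⊢
  simpa only [Subtype.ext_iff] using h3

theorem Bigon.exists_hasVertices [CompactSpace X] (hd : D.IsDihedral) (B : D.Bigon) :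
    ∃ p q, B.HasVertices p q := by
  obtain ⟨x, hx⟩ := B.nonempty
  obtain ⟨y, rfl⟩ := exists_proj_eq_of_notMem (B.subset hx)
  obtain ⟨p, q, h⟩ := DevelopingMap.exists_joins hd (B.subset hx)
  exact ⟨⟨p, h.1.mem_poles hd (one_mul 1)⟩, ⟨q, h.2.mem_poles hd (by norm_num)⟩,
    B.hasVertices_of_joins hd h hx⟩

/-! ### Finiteness of the strip decomposition -/

/-- The directions of the critical leaves at a zero are among finitely many ones. -/
theorem ConeChart.exists_mem_directions (hd : D.IsDihedral) {z : X} (C : D.ConeChart z) {σ ψ a φ : ℝ}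
    {c : ℝ → D.Cover} (hσ : σ * σ = 1) (h : D.IsRay σ ψ a φ c)
    (hz : Tendsto (fun t => (D.proj (c t) : X)) (𝓝[>] a) (𝓝 z)) (hP : z ∈ S.conePts) :
    ∃ κ ∈ {κ ∈ Ico 0 (2 * π * C.θ) |
        -(C.iso.symm north 0) * sin κ + C.iso.symm north 1 * cos κ = 0},
      ∃ δ > 0, δ ≤ φ - a ∧ ∀ s ∈ Ioc 0 δ, (D.proj (c (a + s)) : X) = C.e s (κ : ℝ) := by
  obtain ⟨γ, hγ, A, hA, η, t₁, ht₁, hr, -, hlift⟩ :=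
    h.exists_radial hσ hz (h.proj_ne hd hσ (Or.inr hP)) C
  have hL : 0 < 2 * π * C.θ := by have := C.polar.angle_pos; positivity
  have : Fact (0 < 2 * π * C.θ) := ⟨hL⟩
  obtain ⟨κ, hκ, hκη⟩ : ∃ κ ∈ Ico 0 (2 * π * C.θ), (κ : AddCircle (2 * π * C.θ)) = η := by
    have h1 := AddCircle.coe_image_Ico_eq (2 * π * C.θ) 0
    rw [zero_add] at h1
    exact (h1 ▸ mem_univ (η : AddCircle (2 * π * C.θ)) : _ ∈ _ '' _)
  have hat : 0 < t₁ - a := sub_pos.2 ht₁.1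
  have hproj : ∀ s ∈ Ioc 0 (t₁ - a), (D.proj (c (a + s)) : X) = C.e s (κ : ℝ) := by
    intro s hs
    rw [hlift (a + s) ⟨by linarith [hs.1], by linarith [hs.2]⟩, add_sub_cancel_left,
      (C.translate hγ hA).proj_lift s ⟨hs.1, hs.2.trans_lt hr⟩, hκη]
    rfl
  refine ⟨κ, ⟨hκ, ?_⟩, t₁ - a, hat, by linarith [ht₁.2], hproj⟩
  set w := C.iso.symm north
  -- `w` is north as seen in the chart: the third coordinate of a developed point is the inner
  -- product with `w`.
  have hw : ∀ x, C.iso x 2 = inner ℝ x w := fun x => by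
    rw [← inner_north, ← C.iso.inner_map_map x w, C.iso.apply_symm_apply]
  have hwn := sq_add_sq_add_sq_eq_one (x := w) (by rw [C.iso.symm.norm_map, norm_north])
  have hwa : w 2 ^ 2 = cos a ^ 2 := by
    have h1 := (C.tendsto_absLat hd).comp (tendsto_comap_iff.2 hz)
    have h2 := tendsto_nhds_unique h1 (h.tendsto_abs_cos hσ)
    rw [hw, real_inner_comm, inner_north] at h2
    rw [← sq_abs, h2, sq_abs]
  set m := w 0 * cos κ + w 1 * sin κ
  -- Along the leaf the squared latitude is cos² (a + s) and also (w₂ cos s + m sin s)². The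
  -- difference, divided by sin s, is a sinusoid in s; two of its zeros give m² = sin² a.
  have hlat : ∀ s ∈ Ioc 0 (t₁ - a), cos s * (2 * (w 2 * m) + 2 * (cos a * sin a)) +
      sin s * (m ^ 2 - sin a ^ 2) = 0 := by
    intro s hs
    have hsC : s ∈ Ioo 0 C.r := ⟨hs.1, hs.2.trans_lt hr⟩
    have h1 : (D.proj (c (a + s)) : X) = D.proj (C.lift (s, κ)) := by
      rw [hproj s hs, C.proj_lift s hsC]
    have h2 := hd.absLat_eq_of_proj_eq h1
    rw [h.dev_eq _ ⟨by linarith [hs.1], by linarith [hs.2, ht₁.2]⟩, abs_sphAt_two hσ,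
      C.dev_lift s hsC, hw, E3.inner_eq, sph_zero, sph_one, sph_two] at h2
    have h3 : cos (a + s) ^ 2 = (cos s * w 2 + sin s * m) ^ 2 := by
      rw [← sq_abs, h2, sq_abs]
      simp only [m]; ring
    rw [cos_add] at h3
    have hsin : 0 < sin s := sin_pos_of_pos_of_lt_pi hs.1 (hsC.2.trans C.polar.radius_lt_pi)
    refine (mul_eq_zero.1 ?_).resolve_left hsin.ne'
    linear_combination -h3 - cos s ^ 2 * hwa
  have hm : m ^ 2 - sin a ^ 2 = 0 := by
    have h1 := hlat (t₁ - a) ⟨hat, le_rfl⟩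
    have h2 := hlat ((t₁ - a) / 2) ⟨by linarith, by linarith⟩
    have h3 : sin ((t₁ - a) - (t₁ - a) / 2) * (m ^ 2 - sin a ^ 2) = 0 := by
      rw [sin_sub]
      linear_combination cos ((t₁ - a) / 2) * h1 - cos (t₁ - a) * h2
    refine (mul_eq_zero.1 h3).resolve_left (sin_pos_of_pos_of_lt_pi (by linarith) ?_).ne'
    linarith [C.polar.radius_lt_pi]
  refine pow_eq_zero_iff (two_ne_zero) |>.1 ?_
  simp only [m] at hm
  -- Since w₂² = cos² a, the relation m² = sin² a says that the horizontal part of `w` has no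
  -- component across the direction κ. This is the sinusoidal equation.
  linear_combination (w 0 ^ 2 + w 1 ^ 2) * sin_sq_add_cos_sq κ - hm + hwn - hwa -
    sin_sq_add_cos_sq a

/-- The sinusoid is trivial only if north, seen in the chart, is vertical, which means that `z` is a
pole. -/
theorem finite_directions (hd : D.IsDihedral) {z : X} (hz : z ∉ D.poles) (C : D.ConeChart z) :
    {κ ∈ Ico 0 (2 * π * C.θ) |
      -(C.iso.symm north 0) * sin κ + C.iso.symm north 1 * cos κ = 0}.Finite := by
  refine finite_setOf_sinusoid_eq_zero (fun h => hz ?_) _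
  have hwn := sq_add_sq_add_sq_eq_one (x := C.iso.symm north)
    (by rw [C.iso.symm.norm_map, norm_north])
  rw [C.mem_poles_iff hd, ← inner_north, ← C.iso.symm.inner_map_map, C.iso.symm_apply_apply,
    real_inner_comm, inner_north]
  have : C.iso.symm north 2 ^ 2 = 1 := by linear_combination hwn - h
  rw [← sq_abs] at this
  exact (pow_eq_one_iff_of_nonneg (abs_nonneg _) two_ne_zero).1 this

end DevelopingMap

namespace DevelopingMap

variable {X : Type u} [MetricSpace X] {S : ConeSphericalSurface X} {D : DevelopingMap.{u, v} S}

/-- A small circle about a pole meets finitely many critical leaves. -/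
theorem ConeChart.finite_crit_inter_circle (hd : D.IsDihedral) (hg : D.IsGeneric)
    {q : X} (hq : q ∈ D.poles) (C : D.ConeChart q) {s : ℝ} (hs : s ∈ Ioo 0 C.r) :
    {x ∈ D.crit | ∃ η, (D.proj (C.lift (s, η)) : X) = x}.Finite := by
  obtain ⟨ε, hε, hN⟩ := C.exists_sign hd hq
  have hε' : -ε * -ε = 1 := by linear_combination hε
  have K : ∀ z, D.ConeChart z := fun z => Classical.choice (D.nonempty_coneChart z)
  let dir : X → Set ℝ := fun z => {κ ∈ Ico 0 (2 * π * (K z).θ) |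
    -((K z).iso.symm north 0) * sin κ + (K z).iso.symm north 1 * cos κ = 0}
  -- Each critical point of the circle will be recorded by the zero on its leaf and the direction in
  -- which the leaf leaves that zero.
  let W : Set (X × ℝ) := ⋃ z ∈ D.zeros, (fun κ => (z, κ)) '' dir z
  have hW : W.Finite := (S.finite_conePts.subset fun z hz => hz.1).biUnion fun z hz =>
    (finite_directions hd hz.2 (K z)).image _
  have key : ∀ x ∈ {x ∈ D.crit | ∃ η, (D.proj (C.lift (s, η)) : X) = x}, ∃ w : X × ℝ, w ∈ W ∧
      w.1 ∈ D.zeros ∧ ∃ ψ a c, D.IsRay (-ε) ψ a (π - s) c ∧ (D.proj (c (π - s)) : X) = x ∧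
        Tendsto (fun t => (D.proj (c t) : X)) (𝓝[>] a) (𝓝 w.1) ∧
        ∃ δ > 0, δ ≤ π - s - a ∧ ∀ u ∈ Ioc 0 δ, (D.proj (c (a + u)) : X) = (K w.1).e u (w.2 : ℝ) := by
    rintro x ⟨hx, η, rfl⟩
    have hend : D.Ends ε (C.lift (s, η)) 0 q :=
      C.ends_of_mem_image hε hN ⟨(s, η), ⟨hs, trivial⟩, rfl⟩
    have hnp : (D.proj (C.lift (s, η)) : X) ∉ D.poles := by
      rw [hd.proj_mem_poles_iff]; exact hend.abs_ne hε
    obtain ⟨σ, a, z, hσ, he, hz⟩ := exists_ends_of_mem_crit hd hx hnp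
    -- In the direction ε the leaf runs into the pole `q`, so the zero lies in the other direction,
    -- measured from the opposite pole. There the circle has colatitude π - s.
    obtain rfl : σ = -ε := by
      have : σ ≠ ε := by
        rintro rfl
        obtain ⟨rfl, rfl⟩ := he.unique hε hend
        exact hz.2 hq
      rcases eq_one_or_eq_neg_one hσ with rfl | rfl <;>
        rcases eq_one_or_eq_neg_one hε with rfl | rfl <;> first | exact absurd rfl this | norm_num
    obtain ⟨ψ, φ, c, hc, hcy, hcz, hP⟩ := he
    obtain rfl : φ = π - s := by
      have h1 := hc.dev_eq φ ⟨hc.lt, le_rfl⟩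
      rw [hcy, C.dev_lift s hs] at h1
      have h2 := congrArg (fun x : E3 => x 2) h1
      simp only [map_two_of_map_north hε hN, sph_two, sphAt_two] at h2
      have h3 : cos φ = cos (π - s) := by
        rw [cos_pi_sub]
        linear_combination ε * h2 - cos φ * hε - cos s * hε
      have h4 := hc.mem_Ioo ⟨hc.lt, le_rfl⟩
      exact injOn_cos (Ioo_subset_Icc_self h4)
        ⟨by linarith [hs.2, C.polar.radius_lt_pi], by linarith [hs.1]⟩ h3
    obtain ⟨κ, hκ, hδ⟩ := (K z).exists_mem_directions hd hε' hc hcz hz.1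
    exact ⟨(z, κ), mem_biUnion hz ⟨κ, hκ, rfl⟩, hz, ψ, a, c, hc, by rw [hcy], hcz, hδ⟩
  choose! f hfW hf using key
  refine Finite.of_injOn (f := f) hfW ?_ hW
  intro x hx x' hx' hff
  obtain ⟨hz, ψ, a, c, hc, hcx, hcz, δ, hδ, hδ', hδc⟩ := hf x hx
  obtain ⟨-, ψ', a', c', hc', hcx', hcz', δ', hδp', hδ'', hδc'⟩ := hf x' hx'
  rw [← hff] at hcz' hδc'
  set u := min δ δ'
  have hu : u ∈ Ioc 0 δ := ⟨lt_min hδ hδp', min_le_left _ _⟩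
  have hu' : u ∈ Ioc 0 δ' := ⟨lt_min hδ hδp', min_le_right _ _⟩
  have hau : a + u ∈ Ioc a (π - s) := ⟨by linarith [hu.1], by linarith [hu.2]⟩
  have hau' : a' + u ∈ Ioc a' (π - s) := ⟨by linarith [hu.1], by linarith [hu'.2]⟩
  obtain ⟨γ, hγ, hγc⟩ := D.exists_deck ((hδc u hu).trans (hδc' u hu').symm)
  obtain ⟨A, τ, hA, hτ, hτN⟩ := hd.exists_sign hγ
  have he := (hc.ends hcz (Or.inr hz.1) hau).deck hε' hγ hA hτ hτN
  have he' := hc'.ends hcz' (Or.inr hz.1) hau'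
  rw [hγc] at he
  -- Both leaves start at the same zero in the same direction, so a deck transformation matches them
  -- there. If it reversed the axis, one leaf would have a zero at both ends, against genericity.
  obtain rfl : τ = 1 := by
    refine (eq_one_or_eq_neg_one hτ).resolve_right ?_
    rintro rfl
    rw [neg_one_mul] at he
    exact hg.notMem_zeros hε' he' he hz hz
  obtain ⟨ψ₂, hγray⟩ := hc.deck hA hτ hτN hε'
  rw [one_mul] at hγray
  have haa : a = a' := add_right_cancel (hγray.colat_eq hε' hc' hau hau' hγc)
  subst haa
  have hfin := hγray.eqOn hc' hau hγc (⟨hc.lt, le_rfl⟩ : π - s ∈ Ioc a (π - s))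
  rw [← hcx, ← hcx', ← hfin, hγ.coe]

/-- Finitely many bigons have a vertex at a given pole. -/
theorem ConeChart.finite_bigons (hd : D.IsDihedral) (hg : D.IsGeneric) {q : X} (hq : q ∈ D.poles)
    (C : D.ConeChart q) {s : ℝ} (hs : s ∈ Ioo 0 C.r) :
    {B : D.Bigon | ∃ η, (D.proj (C.lift (s, η)) : X) ∈ B.1}.Finite := by
  have hL : 0 < 2 * π * C.θ := by have := C.polar.angle_pos; positivity
  have : Fact (0 < 2 * π * C.θ) := ⟨hL⟩
  have hcrit : {η ∈ Ico 0 (2 * π * C.θ) | (D.proj (C.lift (s, η)) : X) ∈ D.crit}.Finite := by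
    refine Finite.of_injOn (f := fun η => (D.proj (C.lift (s, η)) : X)) (fun η hη => ?_) ?_
      (C.finite_crit_inter_circle hd hg hq hs)
    · exact ⟨hη.2, η, rfl⟩
    · intro η hη η' hη' he
      simp only [C.proj_lift s hs] at he
      have h1 := C.polar.angle_eq_of_eq hs he
      have h2 := hη.1
      have h3 := hη'.1
      rw [← zero_add (2 * π * C.θ)] at h2 h3
      exact (AddCircle.coe_eq_coe_iff_of_mem_Ico h2 h3).1 h1
  set Z := {η ∈ Ico 0 (2 * π * C.θ) | (D.proj (C.lift (s, η)) : X) ∈ D.crit}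
  have hnp : ∀ η, (D.proj (C.lift (s, η)) : X) ∉ D.poles := by
    intro η h
    obtain ⟨ε, hε, hN⟩ := C.exists_sign hd hq
    rw [hd.proj_mem_poles_iff] at h
    exact (C.ends_of_mem_image hε hN ⟨(s, η), ⟨hs, trivial⟩, rfl⟩).abs_ne hε h
  have hch : ∀ B ∈ {B : D.Bigon | ∃ η, (D.proj (C.lift (s, η)) : X) ∈ B.1},
      ∃ η, η ∈ Ico 0 (2 * π * C.θ) ∧ (D.proj (C.lift (s, η)) : X) ∈ B.1 := by
    rintro B ⟨η, hη⟩
    have h1 := AddCircle.coe_image_Ico_eq (2 * π * C.θ) 0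
    rw [zero_add] at h1
    obtain ⟨κ, hκ, hκη⟩ : (η : AddCircle (2 * π * C.θ)) ∈
      ((↑) : ℝ → AddCircle (2 * π * C.θ)) '' Ico 0 (2 * π * C.θ) := h1 ▸ mem_univ _
    exact ⟨κ, hκ, by rwa [C.proj_lift s hs, hκη, ← C.proj_lift s hs]⟩
  choose! f hf hfB using hch
  -- A bigon is recorded by the critical angles below its chosen angle `f B`. If two bigons have
  -- equal records, the arc between their angles contains no critical point and connects them.
  refine Finite.of_injOn (f := fun B => Z ∩ Iio (f B)) (t := 𝒫 Z) (fun B _ => inter_subset_left) ?_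
    hcrit.finite_subsets
  intro B hB B' hB' he
  wlog hle : f B ≤ f B' generalizing B B'
  · exact (this hB' hB he.symm (le_of_not_ge hle)).symm
  have harc : ∀ η ∈ Icc (f B) (f B'), (D.proj (C.lift (s, η)) : X) ∈ (D.crit ∪ D.poles)ᶜ := by
    rintro η hη (hc | hp)
    · have hηZ : η ∈ Z := ⟨⟨(hf B hB).1.trans hη.1, hη.2.trans_lt (hf B' hB').2⟩, hc⟩
      have hlt : η < f B' := hη.2.lt_of_ne fun h =>
        B'.subset (hfB B' hB') (Or.inl (h ▸ hc))
      have he' : Z ∩ Iio (f B) = Z ∩ Iio (f B') := he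
      have : η ∈ Z ∩ Iio (f B) := he' ▸ ⟨hηZ, hlt⟩
      exact absurd hη.1 (not_le.2 this.2)
    · exact hnp η hp
  have hT : IsPreconnected ((fun η => (D.proj (C.lift (s, η)) : X)) '' Icc (f B) (f B')) := by
    refine isPreconnected_Icc.image _ (D.continuous_proj.comp_continuousOn
      (C.continuousOn_lift.comp (by fun_prop) fun η _ => ⟨hs, trivial⟩))
  have hsub : _ ⊆ B.1 := B.subset_of_isPreconnected hT
    (by rintro _ ⟨η, hη, rfl⟩; exact harc η hη) ⟨f B, ⟨le_rfl, hle⟩, rfl⟩ (hfB B hB)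
  have hmem := hsub ⟨f B', ⟨hle, le_rfl⟩, rfl⟩
  exact Subtype.ext ((B.eq_connectedComponentIn hmem).trans
    (B'.eq_connectedComponentIn (hfB B' hB')).symm)

/-- A bigon contains a leaf of length π, which is radial near the pole where it starts and so
crosses the reference circle about that pole. -/
theorem finite_bigon [CompactSpace X] (hd : D.IsDihedral) (hg : D.IsGeneric) : Finite D.Bigon := by
  have K : ∀ z, D.ConeChart z := fun z => Classical.choice (D.nonempty_coneChart z)
  have hs : ∀ q, (K q).r / 2 ∈ Ioo 0 (K q).r := fun q => by
    have := (K q).r_pos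
    constructor <;> linarith
  have hfin := hd.finite_poles.biUnion fun q hq => (K q).finite_bigons hd hg hq (hs q)
  rw [← finite_univ_iff]
  refine hfin.subset fun B _ => ?_
  obtain ⟨p, q, d, hl, hB, hpq⟩ := B.exists_hasVertices hd
  obtain ⟨ψ, c, hray, hproj, hlim, hj⟩ := hl.exists_lift
  have hmem : π / 2 ∈ Ioo 0 π := ⟨by positivity, by linarith [pi_pos]⟩
  have hd0 : d 0 ∈ D.poles := (hj _ hmem).1.mem_poles hd (one_mul 1)
  refine mem_biUnion hd0 ?_
  have hr := hray _ hmem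
  obtain ⟨γ, hγ, A, hA, η, t₁, ht₁, ht₁r, hiso, hlift⟩ :=
    hr.exists_radial (one_mul 1) hlim (hr.proj_ne hd (one_mul 1) (Or.inl hd0)) (K (d 0))
  rw [sub_zero] at ht₁r
  have hπ := (K (d 0)).polar.radius_lt_pi
  have hmaps : MapsTo (fun t => (t, η)) (Ioo 0 (K (d 0)).r) (Ioo 0 (K (d 0)).r ×ˢ univ) :=
    fun t ht => ⟨ht, trivial⟩
  have hc : ContinuousOn c (Ioo 0 (K (d 0)).r) :=
    (hray (K (d 0)).r ⟨(K (d 0)).r_pos, hπ⟩).continuousOn.mono Ioo_subset_Ioc_self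
  -- `exists_radial` identifies leaf and radius only near the pole. Unique lifting extends this to
  -- the whole chart radius, in particular to the reference circle.
  have heq : EqOn c (fun t => ((K (d 0)).translate hγ hA).lift (t, η)) (Ioo 0 (K (d 0)).r) := by
    refine D.eqOn_of_dev_eqOn isPreconnected_Ioo hc
      (((K (d 0)).translate hγ hA).continuousOn_lift.comp (by fun_prop) hmaps) ?_
      (⟨ht₁.1, ht₁r⟩ : t₁ ∈ Ioo 0 (K (d 0)).r) ?_
    · intro t ht
      rw [((K (d 0)).translate hγ hA).dev_lift t ht, hiso, zero_add]
      exact (hray (K (d 0)).r ⟨(K (d 0)).r_pos, hπ⟩).dev_eq t (Ioo_subset_Ioc_self ht)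
    · have := hlift t₁ ⟨ht₁.1, le_rfl⟩
      rwa [sub_zero] at this
  refine ⟨η, ?_⟩
  have h1 := heq (hs (d 0))
  have h2 : ((K (d 0)).r / 2) ∈ Ioo 0 π := ⟨(hs _).1, (hs _).2.trans hπ⟩
  have h3 : (D.proj (c ((K (d 0)).r / 2)) : X) = D.proj ((K (d 0)).lift ((K (d 0)).r / 2, η)) := by
    rw [h1, ((K (d 0)).translate hγ hA).proj_lift _ (hs _), (K (d 0)).proj_lift _ (hs _)]
    rfl
  rw [← h3, hproj _ h2]
  exact hB ⟨_, h2, rfl⟩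

end DevelopingMap

/-! ### The tangent directions of the two foliations -/

/-- `latDir x` is the cross product of `north` and `x`; the determinant form lets rotations act on
it. -/
theorem inner_latDir (x w : E3) : inner ℝ (latDir x) w =
    (EuclideanSpace.basisFun (Fin 3) ℝ).toBasis.det ![north, x, w] := by
  rw [Module.Basis.det_apply, Matrix.det_fin_three, E3.inner_eq]
  simp [Module.Basis.toMatrix_apply, latDir]
  ring

/-- Determinant 1 makes `A` commute with the cross product. The sign is the same as in `map_lonDir`,
which is why the two foliations are orientable together. -/
theorem IsRotation.map_latDir {A : E3 ≃ₗᵢ[ℝ] E3} (hA : IsRotation A) {ε : ℝ}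
    (hN : A north = ε • north) (x : E3) : A (latDir x) = ε • latDir (A x) := by
  refine ext_inner_right ℝ fun w => ?_
  obtain ⟨w, rfl⟩ := A.surjective w
  have h1 := (EuclideanSpace.basisFun (Fin 3) ℝ).toBasis.det_comp
    (A.toLinearEquiv : E3 →ₗ[ℝ] E3) ![north, x, w]
  rw [show LinearMap.det (A.toLinearEquiv : E3 →ₗ[ℝ] E3) = 1 from hA, one_mul] at h1
  have h2 : (⇑(A.toLinearEquiv : E3 →ₗ[ℝ] E3) ∘ ![north, x, w]) = ![ε • north, A x, A w] := by
    rw [← hN]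
    ext i : 1
    fin_cases i <;> rfl
  have h3 : ![ε • north, A x, A w] = Function.update ![north, A x, A w] 0 (ε • north) := by
    ext i : 1
    fin_cases i <;> rfl
  have h4 : Function.update ![north, A x, A w] 0 north = ![north, A x, A w] := by
    ext i : 1
    fin_cases i <;> rfl
  rw [A.inner_map_map, inner_latDir, ← h1, h2, h3, AlternatingMap.map_update_smul, h4,
    inner_smul_left, inner_latDir]
  simp

theorem map_lonDir {A : E3 ≃ₗᵢ[ℝ] E3} {ε : ℝ} (hε : ε * ε = 1) (hN : A north = ε • north) (x : E3) :
    A (lonDir x) = ε • lonDir (A x) := by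
  rw [lonDir, lonDir, map_sub, map_smul, hN, map_two_of_map_north hε hN, smul_sub, smul_smul,
    ← mul_assoc, hε, one_mul]

theorem latDir_ne_zero {x : E3} (hx : ‖x‖ = 1) (h : |x 2| ≠ 1) : latDir x ≠ 0 := by
  intro h0
  have h1 : -x 1 = 0 := congrArg (fun v : E3 => v 0) h0
  have h2 : x 0 = 0 := congrArg (fun v : E3 => v 1) h0
  have h3 := sq_add_sq_add_sq_eq_one hx
  rw [h2, neg_eq_zero.1 h1] at h3
  refine h ((pow_eq_one_iff_of_nonneg (abs_nonneg _) two_ne_zero).1 ?_)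
  rw [sq_abs]; linarith

theorem lonDir_ne_zero {x : E3} (h : |x 2| ≠ 1) : lonDir x ≠ 0 := by
  intro h0
  have h1 : 1 - x 2 * x 2 = 0 := congrArg (fun v : E3 => v 2) h0
  refine h ((pow_eq_one_iff_of_nonneg (abs_nonneg _) two_ne_zero).1 ?_)
  rw [sq_abs]; linarith

theorem continuous_latDir : Continuous latDir := by
  have hcoord : ∀ i : Fin 3, Continuous fun x : E3 => x i := fun i =>
    (EuclideanSpace.proj (𝕜 := ℝ) i).continuous
  unfold latDir
  refine (PiLp.continuous_toLp 2 _).comp (continuous_pi fun i => ?_)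
  fin_cases i
  · exact (hcoord 1).neg
  · exact hcoord 0
  · exact continuous_const

theorem continuous_lonDir : Continuous lonDir :=
  continuous_const.sub (((EuclideanSpace.proj (𝕜 := ℝ) (2 : Fin 3)).continuous).smul continuous_id)

theorem IsPreconnected.mul_pos_of_ne_zero {T : Type*} [TopologicalSpace T] {s : Set T}
    (hs : IsPreconnected s) {f : T → ℝ} (hf : ContinuousOn f s) (h0 : ∀ t ∈ s, f t ≠ 0) {a b : T}
    (ha : a ∈ s) (hb : b ∈ s) : 0 < f a * f b := by
  by_contra hle
  have key : ∀ a ∈ s, ∀ b ∈ s, f a < 0 → 0 < f b → False := fun a ha b hb h1 h2 => by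
    obtain ⟨t, ht, ht0⟩ := hs.intermediate_value ha hb hf ⟨h1.le, h2.le⟩
    exact h0 t ht ht0
  rcases (h0 a ha).lt_or_gt with h1 | h1 <;> rcases (h0 b hb).lt_or_gt with h2 | h2
  · exact hle (mul_pos_of_neg_of_neg h1 h2)
  · exact key a ha b hb h1 h2
  · exact key b hb a ha h2 h1
  · exact hle (mul_pos h1 h2)

namespace DevelopingMap

variable {X : Type u} [MetricSpace X] {S : ConeSphericalSurface X} {D : DevelopingMap.{u, v} S}

theorem sign_eq_of_map_north {A : E3 ≃ₗᵢ[ℝ] E3} {ε ε' : ℝ} (h : A north = ε • north)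
    (h' : A north = ε' • north) : ε = ε' := by
  have := congrArg (fun x : E3 => x 2) (h.symm.trans h')
  simpa using this

variable (D) in
/-- An orientation of the direction towards `north`: a function without zeros on the complement of
the poles, with sign changes prescribed by the monodromy. -/
structure IsOrientation (k : D.Cover → ℝ) : Prop where
  continuousOn : ContinuousOn k {y | |(D.dev y : E3) 2| ≠ 1}
  ne_zero : ∀ y, |(D.dev y : E3) 2| ≠ 1 → k y ≠ 0
  deck : ∀ γ, D.IsDeck γ → ∀ A, D.IsMonodromy γ A → ∀ ε : ℝ, A north = ε • north →
    ∀ y, |(D.dev y : E3) 2| ≠ 1 → k (γ y) = ε * k y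

theorem dev_ne_iff (y : D.Cover) :
    ((D.dev y : E3) ≠ north ∧ (D.dev y : E3) ≠ -north) ↔ |(D.dev y : E3) 2| ≠ 1 := by
  rw [← not_or, eq_north_or_eq_neg_north_iff (D.norm_dev y)]

/-- A section of the line field is a multiple k ℓ. Its inner product with ℓ has the sign of k, and
equivariance of the field becomes the sign rule for k, because ℓ itself is equivariant up to ε. -/
theorem foliationOrientable_iff (hd : D.IsDihedral) {ℓ : E3 → E3} (hℓ : Continuous ℓ)
    (hℓ0 : ∀ x : E3, ‖x‖ = 1 → |x 2| ≠ 1 → ℓ x ≠ 0)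
    (hℓA : ∀ (A : E3 ≃ₗᵢ[ℝ] E3) (ε : ℝ), IsRotation A → ε * ε = 1 → A north = ε • north →
      ∀ x, A (ℓ x) = ε • ℓ (A x)) :
    D.FoliationOrientable ℓ ↔ ∃ k, D.IsOrientation k := by
  constructor
  · rintro ⟨V, hV, hVℓ, hVγ⟩
    simp only [dev_ne_iff] at hV
    refine ⟨fun y => inner ℝ (V y) (ℓ (D.dev y)),
      hV.inner (hℓ.comp D.continuous_dev_coe).continuousOn, fun y hy => ?_, ?_⟩
    · have hy' := (dev_ne_iff y).2 hy
      obtain ⟨k, hk, hkV⟩ := hVℓ y hy'.1 hy'.2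
      rw [hkV, inner_smul_left, real_inner_self_eq_norm_sq]
      have := norm_ne_zero_iff.2 (hℓ0 _ (D.norm_dev y) hy)
      exact mul_ne_zero hk (pow_ne_zero 2 this)
    · intro γ hγ A hA ε hN y hy
      obtain ⟨ε', hε, hN'⟩ := (hd γ hγ A hA).exists_sign
      obtain rfl := sign_eq_of_map_north hN hN'
      have hy' := (dev_ne_iff y).2 hy
      have h1 : ℓ (A (D.dev y)) = ε • A (ℓ (D.dev y)) := by
        rw [hℓA A ε hA.1 hε hN, smul_smul, hε, one_smul]
      rw [hVγ γ hγ A hA y hy'.1 hy'.2, hA.2, h1, inner_smul_right, A.inner_map_map]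
  · rintro ⟨k, hk⟩
    refine ⟨fun y => k y • ℓ (D.dev y), ?_, fun y h1 h2 =>
      ⟨k y, hk.ne_zero y ((dev_ne_iff y).1 ⟨h1, h2⟩), rfl⟩, ?_⟩
    · simp only [dev_ne_iff]
      exact hk.continuousOn.smul (hℓ.comp D.continuous_dev_coe).continuousOn
    · intro γ hγ A hA y h1 h2
      obtain ⟨ε, hε, hN⟩ := (hd γ hγ A hA).exists_sign
      change k (γ y) • ℓ (D.dev (γ y)) = A (k y • ℓ (D.dev y))
      rw [hk.deck γ hγ A hA ε hN y ((dev_ne_iff y).1 ⟨h1, h2⟩), hA.2, map_smul,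
        hℓA A ε hA.1 hε hN, smul_smul, mul_comm]

theorem latitudeOrientable_iff (hd : D.IsDihedral) :
    D.LatitudeOrientable ↔ ∃ k, D.IsOrientation k :=
  foliationOrientable_iff hd continuous_latDir (fun _ hx h => latDir_ne_zero hx h)
    fun _ _ hA _ hN x => hA.map_latDir hN x

theorem longitudeOrientable_iff (hd : D.IsDihedral) :
    D.LongitudeOrientable ↔ ∃ k, D.IsOrientation k :=
  foliationOrientable_iff hd continuous_lonDir (fun _ _ h => lonDir_ne_zero h)
    fun _ _ _ hε hN x => map_lonDir hε hN x

/-! ### Alternating functions on the set of poles -/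

variable (D) in
/-- A function on the set of poles that takes opposite values at the two ends of every leaf of
length `π`. -/
def IsAlternating (f : D.Pole → ℝ) : Prop :=
  ∀ y (p q : D.Pole), D.Joins y p q → f p + f q = 0

variable (D) in
/-- `v` is the value at `y` of the function on the universal cover that has the value `σ * f q` on
all leaves ending at the pole `q` in the direction of `σ • north`. -/
def IsValue (f : D.Pole → ℝ) (y : D.Cover) (v : ℝ) : Prop :=
  ∃ (σ : ℝ) (q : D.Pole), σ * σ = 1 ∧ D.Ends σ y 0 q ∧ v = σ * f q

namespace IsValue

variable {f : D.Pole → ℝ} {y : D.Cover} {v v' : ℝ}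

theorem abs_ne (h : D.IsValue f y v) : |(D.dev y : E3) 2| ≠ 1 := by
  obtain ⟨σ, q, hσ, he, -⟩ := h
  exact he.abs_ne hσ

/-- A leaf from `p` to `q` offers the values f p and -f q, which agree when `f` is alternating. -/
theorem unique (hf : D.IsAlternating f) (h : D.IsValue f y v) (h' : D.IsValue f y v') :
    v = v' := by
  obtain ⟨σ, q, hσ, he, rfl⟩ := h
  obtain ⟨σ', q', hσ', he', rfl⟩ := h'
  rcases eq_one_or_eq_neg_one hσ with rfl | rfl <;> rcases eq_one_or_eq_neg_one hσ' with rfl | rfl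
  · rw [Subtype.ext (he.unique hσ he').2]
  · linarith [hf y q q' ⟨he, he'⟩]
  · linarith [hf y q' q ⟨he', he⟩]
  · rw [Subtype.ext (he.unique hσ he').2]

theorem eventually (hd : D.IsDihedral) (h : D.IsValue f y v) : ∀ᶠ y' in 𝓝 y, D.IsValue f y' v := by
  obtain ⟨σ, q, hσ, he, hv⟩ := h
  filter_upwards [(isOpen_setOf_ends hd hσ (q : X)).mem_nhds he] with y' hy'
  exact ⟨σ, q, hσ, hy', hv⟩

theorem deck (h : D.IsValue f y v) {γ : D.Cover ≃ₜ D.Cover} (hγ : D.IsDeck γ)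
    {A : E3 ≃ₗᵢ[ℝ] E3} (hA : D.IsMonodromy γ A) {ε : ℝ} (hε : ε * ε = 1)
    (hN : A north = ε • north) : D.IsValue f (γ y) (ε * v) := by
  obtain ⟨σ, q, hσ, he, rfl⟩ := h
  exact ⟨ε * σ, q, by linear_combination σ * σ * hε + hσ, he.deck hσ hγ hA hε hN, by ring⟩

end IsValue

/-- By genericity the two ends of a leaf are not both zeros, so one of them is a pole. -/
theorem exists_isValue [CompactSpace X] (hd : D.IsDihedral) (hg : D.IsGeneric) (f : D.Pole → ℝ)
    {y : D.Cover} (hy : |(D.dev y : E3) 2| ≠ 1) : ∃ v, D.IsValue f y v := by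
  obtain ⟨a, p, hp⟩ := exists_ends hd (one_mul 1) hy
  have hm : (-1 : ℝ) * -1 = 1 := by norm_num
  rcases hp.pole_or_zero hd (one_mul 1) with ⟨rfl, hpp⟩ | ⟨-, hpz⟩
  · exact ⟨_, 1, ⟨p, hpp⟩, one_mul 1, hp, rfl⟩
  · obtain ⟨b, q, hq⟩ := exists_ends hd hm hy
    rcases hq.pole_or_zero hd hm with ⟨rfl, hqp⟩ | ⟨-, hqz⟩
    · exact ⟨_, -1, ⟨q, hqp⟩, hm, hq, rfl⟩
    · exact absurd hqz (hg.notMem_zeros (one_mul 1) hp hq hpz)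

theorem ConeChart.exists_ends (hd : D.IsDihedral) {q : X} (hq : q ∈ D.poles) (C : D.ConeChart q)
    {y : D.Cover} (hy : (D.proj y : X) ∈ Metric.ball q C.r) (hyq : (D.proj y : X) ≠ q) :
    ∃ σ, σ * σ = 1 ∧ D.Ends σ y 0 q := by
  obtain ⟨γ, hγ, A, hA, hyC⟩ := C.exists_translate hy hyq
  obtain ⟨σ, hσ, hN⟩ := (C.translate hγ hA).exists_sign hd hq
  exact ⟨σ, hσ, (C.translate hγ hA).ends_of_mem_image hσ hN hyC⟩

theorem abs_eq_of_sq_eq_one {σ : ℝ} (hσ : σ * σ = 1) (t : ℝ) : |σ * t| = |t| := by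
  rcases eq_one_or_eq_neg_one hσ with rfl | rfl <;> simp

/-- An alternating function has constant absolute value. -/
theorem IsAlternating.abs_eq [CompactSpace X] (hd : D.IsDihedral) (hg : D.IsGeneric)
    {f : D.Pole → ℝ} (hf : D.IsAlternating f) (p q : D.Pole) : |f p| = |f q| := by
  -- The absolute value of the spread-out function, extended by `|f|` to points over poles that are
  -- not cone points. It is then defined on the entire connected cover.
  let P : D.Cover → ℝ → Prop := fun y w =>
    (∃ h : (D.proj y : X) ∈ D.poles, w = |f ⟨D.proj y, h⟩|) ∨ ∃ v, D.IsValue f y v ∧ w = |v|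
  have huniq : ∀ y w w', P y w → P y w' → w = w' := by
    have hexcl : ∀ y v, (D.proj y : X) ∈ D.poles → D.IsValue f y v → False := fun y v h1 h2 =>
      h2.abs_ne ((hd.proj_mem_poles_iff y).1 h1)
    rintro y w w' (⟨h, rfl⟩ | ⟨v, hv, rfl⟩) (⟨h', rfl⟩ | ⟨v', hv', rfl⟩)
    · rfl
    · exact (hexcl _ _ h hv').elim
    · exact (hexcl _ _ h' hv).elim
    · rw [hv.unique hf hv']
  have hloc : ∀ y, ∃ w, ∀ᶠ y' in 𝓝 y, P y' w := by
    intro y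
    by_cases hy : (D.proj y : X) ∈ D.poles
    · obtain ⟨C⟩ := D.nonempty_coneChart (D.proj y : X)
      refine ⟨|f ⟨_, hy⟩|, ?_⟩
      have hb : ∀ᶠ y' in 𝓝 y, (D.proj y' : X) ∈ Metric.ball (D.proj y : X) C.r :=
        D.continuous_proj.continuousAt.eventually (Metric.ball_mem_nhds _ C.r_pos)
      filter_upwards [hb] with y' hy'
      by_cases he : (D.proj y' : X) = D.proj y
      · refine Or.inl ⟨by rw [he]; exact hy, ?_⟩
        congr 3
        exact he.symm
      · obtain ⟨σ, hσ, hend⟩ := C.exists_ends hd hy hy' he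
        exact Or.inr ⟨σ * f ⟨_, hy⟩, ⟨σ, ⟨_, hy⟩, hσ, hend, rfl⟩, (abs_eq_of_sq_eq_one hσ _).symm⟩
    · rw [hd.proj_mem_poles_iff] at hy
      obtain ⟨v, hv⟩ := exists_isValue hd hg f hy
      refine ⟨|v|, ?_⟩
      filter_upwards [hv.eventually hd] with y' hy'
      exact Or.inr ⟨v, hy', rfl⟩
  choose w hw using hloc
  have hconst : IsLocallyConstant w := by
    rw [IsLocallyConstant.iff_eventually_eq]
    intro y
    filter_upwards [hw y] with y' hy'
    exact huniq y' _ _ (hw y').self_of_nhds hy'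
  -- A pole may be a cone point and have no lift, so `|f q|` is read off at a chart point near `q`.
  have key : ∀ q : D.Pole, ∃ y, w y = |f q| := by
    intro q
    obtain ⟨C⟩ := D.nonempty_coneChart (q : X)
    obtain ⟨σ, hσ, hN⟩ := C.exists_sign hd q.2
    have hmem : C.lift (C.r / 2, 0) ∈ C.image :=
      ⟨_, ⟨⟨by linarith [C.r_pos], by linarith [C.r_pos]⟩, trivial⟩, rfl⟩
    have hend := C.ends_of_mem_image hσ hN hmem
    refine ⟨_, huniq _ _ _ (hw _).self_of_nhds (Or.inr ⟨σ * f q, ⟨σ, q, hσ, hend, rfl⟩, ?_⟩)⟩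
    exact (abs_eq_of_sq_eq_one hσ _).symm
  obtain ⟨y, hy⟩ := key p
  obtain ⟨y', hy'⟩ := key q
  rw [← hy, ← hy', hconst.apply_eq_of_preconnectedSpace y y']

/-- A nonzero alternating function on the poles orients the foliations. -/
theorem IsAlternating.exists_isOrientation [CompactSpace X] (hd : D.IsDihedral) (hg : D.IsGeneric)
    {f : D.Pole → ℝ} (hf : D.IsAlternating f) (hf0 : f ≠ 0) : ∃ k, D.IsOrientation k := by
  have hne : ∀ q, f q ≠ 0 := by
    obtain ⟨p, hp⟩ := Function.ne_iff.1 hf0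
    intro q
    rw [← abs_ne_zero, hf.abs_eq hd hg q p, abs_ne_zero]
    exact hp
  choose! k hk using fun (y : D.Cover) (hy : |(D.dev y : E3) 2| ≠ 1) => exists_isValue hd hg f hy
  refine ⟨k, fun y hy => ?_, fun y hy => ?_, fun γ hγ A hA ε hN y hy => ?_⟩
  · refine ContinuousAt.continuousWithinAt ?_
    refine (continuousAt_const (y := k y)).congr ?_
    filter_upwards [(hk y hy).eventually hd] with y' hy'
    exact hy'.unique hf (hk y' hy'.abs_ne)
  · obtain ⟨σ, q, hσ, -, h⟩ := hk y hy
    rw [h, ← abs_ne_zero, abs_eq_of_sq_eq_one hσ, abs_ne_zero]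
    exact hne q
  · obtain ⟨ε', hε, hN'⟩ := (hd γ hγ A hA).exists_sign
    obtain rfl := sign_eq_of_map_north hN hN'
    have h1 := (hk y hy).deck hγ hA hε hN
    exact (hk _ h1.abs_ne).unique hf h1

theorem nonempty_pole [CompactSpace X] (hd : D.IsDihedral) (hg : D.IsGeneric) : Nonempty D.Pole := by
  obtain ⟨y⟩ : Nonempty D.Cover := inferInstance
  by_cases hy : (D.proj y : X) ∈ D.poles
  · exact ⟨⟨_, hy⟩⟩
  · rw [hd.proj_mem_poles_iff] at hy
    obtain ⟨v, σ, q, -⟩ := exists_isValue hd hg (fun _ => 0) hy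
    exact ⟨q⟩

/-- An orientation determines a sign at every pole. -/
theorem IsOrientation.exists_sign (hd : D.IsDihedral) {k : D.Cover → ℝ} (hk : D.IsOrientation k)
    (q : D.Pole) : ∃ v : ℝ, v * v = 1 ∧ ∀ y σ, σ * σ = 1 → D.Ends σ y 0 q → 0 < k y * (σ * v) := by
  obtain ⟨C⟩ := D.nonempty_coneChart (q : X)
  obtain ⟨ε, hε, hN⟩ := C.exists_sign hd q.2
  have hmem : C.lift (C.r / 2, 0) ∈ C.image :=
    ⟨_, ⟨⟨by linarith [C.r_pos], by linarith [C.r_pos]⟩, trivial⟩, rfl⟩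
  set y₀ := C.lift (C.r / 2, 0)
  have hnp : ∀ y ∈ C.image, |(D.dev y : E3) 2| ≠ 1 := fun y hy =>
    (C.ends_of_mem_image hε hN hy).abs_ne hε
  obtain ⟨τ, hτ, hτk⟩ : ∃ τ : ℝ, τ * τ = 1 ∧ 0 < k y₀ * τ := by
    rcases (hk.ne_zero y₀ (hnp y₀ hmem)).lt_or_gt with h | h
    · exact ⟨-1, by norm_num, by linarith⟩
    · exact ⟨1, by norm_num, by linarith⟩
  -- `τ` is the sign of `k` at a reference point whose leaf ends at `q` in the direction `ε`, which
  -- forces the choice `ε * τ`.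
  refine ⟨ε * τ, by linear_combination τ * τ * hε + hτ, ?_⟩
  rintro y σ hσ ⟨ψ, φ, c, hc, rfl, hx, -⟩
  obtain ⟨γ, hγ, A, hA, η, t, ht, hr, hiso, hlift⟩ :=
    hc.exists_radial hσ hx (hc.proj_ne hd hσ (Or.inl q.2)) C
  obtain ⟨ε', hε', hN'⟩ := (hd γ hγ A hA).exists_sign
  have hσε : σ = ε * ε' := by
    have h1 := hiso 0
    rw [sph_colat_zero, zero_add, sphAt_colat_zero] at h1
    have h2 : A (C.iso north) = σ • north := h1
    rw [hN, map_smul, hN', smul_smul] at h2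
    have := congrArg (fun x : E3 => x 2) h2
    simpa using this.symm
  have ht0 : t - 0 ∈ Ioo 0 C.r := ⟨by linarith [ht.1], hr⟩
  have hyC : C.lift (t - 0, η) ∈ C.image := ⟨_, ⟨ht0, trivial⟩, rfl⟩
  have h1 : 0 < k (C.lift (t - 0, η)) * k y₀ :=
    C.isPreconnected_image.mul_pos_of_ne_zero (hk.continuousOn.mono hnp)
      (fun y hy => hk.ne_zero y (hnp y hy)) hyC hmem
  have h2 : k (c t) = ε' * k (C.lift (t - 0, η)) := by
    rw [hlift t ⟨ht.1, le_rfl⟩]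
    exact hk.deck γ hγ A hA ε' hN' _ (hnp _ hyC)
  have hcnp : ∀ s ∈ Ioc 0 φ, |(D.dev (c s) : E3) 2| ≠ 1 := fun s hs =>
    (hc.ends hx (Or.inl rfl) hs).abs_ne hσ
  have h3 : 0 < k (c φ) * k (c t) :=
    isPreconnected_Ioc.mul_pos_of_ne_zero (f := fun s => k (c s))
      (hk.continuousOn.comp hc.continuousOn hcnp) (fun s hs => hk.ne_zero _ (hcnp s hs))
      ⟨hc.lt, le_rfl⟩ ht
  have h4 : k (c φ) * (σ * (ε * τ)) = k (c φ) * (ε' * τ) := by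
    rw [hσε]; linear_combination k (c φ) * ε' * τ * hε
  rw [h4]
  -- `k` keeps its sign along the ray and on the chart image, and the deck transformation between
  -- them contributes `ε'`. Multiplying the positive products isolates the claim up to a square.
  have h5 : 0 < (k (c φ) * k (c t)) * (k (C.lift (t - 0, η)) * k y₀) * (k y₀ * τ) := by positivity
  rw [h2] at h5
  have h6 : (k (c φ) * (ε' * k (C.lift (t - 0, η)))) * (k (C.lift (t - 0, η)) * k y₀) * (k y₀ * τ) =
      (k (c φ) * (ε' * τ)) * (k (C.lift (t - 0, η)) * k y₀) ^ 2 := by ring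
  rw [h6] at h5
  exact pos_of_mul_pos_left h5 (sq_nonneg _)

/-- The signs at the two ends of a leaf are compared with the same value `k y` but with opposite
directions ±1, so they are opposite. -/
theorem IsOrientation.exists_isAlternating [CompactSpace X] (hd : D.IsDihedral) (hg : D.IsGeneric)
    {k : D.Cover → ℝ} (hk : D.IsOrientation k) : ∃ f, D.IsAlternating f ∧ f ≠ 0 := by
  choose f hf hfk using hk.exists_sign hd
  refine ⟨f, fun y p q h => ?_, fun h => ?_⟩
  · have h1 := hfk p y 1 (one_mul 1) h.1
    have h2 := hfk q y (-1) (by norm_num) h.2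
    rcases eq_one_or_eq_neg_one (hf p) with hp | hp <;>
      rcases eq_one_or_eq_neg_one (hf q) with hq | hq <;> rw [hp] at h1 ⊢ <;> rw [hq] at h2 ⊢ <;>
      linarith
  · obtain ⟨q⟩ := nonempty_pole hd hg
    have := hf q
    rw [h] at this
    norm_num at this

/-! ### The connection matrix -/

theorem Bigon.HasVertices.symm {B : D.Bigon} {p q : D.Pole} (h : B.HasVertices p q) :
    B.HasVertices q p := by
  obtain ⟨c, h1, h2, h3⟩ := h
  exact ⟨c, h1, h2, h3.symm⟩

-- A column is the sum of the indicators of the two vertices, and a repeated vertex accounts for the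
-- entry 2.
open Classical in
theorem connectionMatrix_apply [CompactSpace X] (hd : D.IsDihedral) {B : D.Bigon} {p q : D.Pole}
    (h : B.HasVertices p q) (r : D.Pole) :
    D.connectionMatrix r B = (if r = p then 1 else 0) + if r = q then 1 else 0 := by
  have key : ∀ p' q' : D.Pole, B.HasVertices p' q' → (p' = p ∧ q' = q) ∨ (p' = q ∧ q' = p) :=
    fun p' q' h' => by simpa [Sym2.eq_iff] using h'.sym2_eq hd h
  unfold connectionMatrix
  by_cases h1 : B.HasVertices r r
  · rw [if_pos h1]
    obtain ⟨rfl, rfl⟩ : r = p ∧ r = q := (key r r h1).elim id And.symm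
    norm_num
  · rw [if_neg h1]
    by_cases hrp : r = p
    · subst hrp
      have hrq : r ≠ q := by rintro rfl; exact h1 h
      rw [if_pos ⟨q, hrq.symm, h⟩, if_pos rfl, if_neg hrq, add_zero]
    · by_cases hrq : r = q
      · subst hrq
        rw [if_pos ⟨p, fun h' => hrp h'.symm, h.symm⟩, if_neg hrp, if_pos rfl, zero_add]
      · rw [if_neg hrp, if_neg hrq, if_neg, add_zero]
        rintro ⟨p', -, h'⟩
        rcases key r p' h' with ⟨h'', -⟩ | ⟨h'', -⟩
        · exact hrp h''
        · exact hrq h''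

theorem vecMul_connectionMatrix_eq_zero_iff [CompactSpace X] [Fintype D.Pole] (hd : D.IsDihedral)
    (f : D.Pole → ℝ) : Matrix.vecMul f D.connectionMatrix = 0 ↔ D.IsAlternating f := by
  classical
  have key : ∀ (B : D.Bigon) (p q : D.Pole), B.HasVertices p q →
      Matrix.vecMul f D.connectionMatrix B = f p + f q := by
    intro B p q h
    simp [Matrix.vecMul, dotProduct, connectionMatrix_apply hd h, mul_add, Finset.sum_add_distrib]
  constructor
  · intro h y p q hj
    have hy := hj.notMem hd
    let B : D.Bigon := ⟨_, _, hy, rfl⟩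
    rw [← key B p q (B.hasVertices_of_joins hd hj (mem_connectedComponentIn hy)), h]
    rfl
  · intro h
    funext B
    obtain ⟨x, hx⟩ := B.nonempty
    obtain ⟨y, rfl⟩ := exists_proj_eq_of_notMem (B.subset hx)
    obtain ⟨p, q, hj⟩ := exists_joins hd (B.subset hx)
    let p' : D.Pole := ⟨p, hj.1.mem_poles hd (one_mul 1)⟩
    let q' : D.Pole := ⟨q, hj.2.mem_poles hd (by norm_num)⟩
    rw [key B p' q' (B.hasVertices_of_joins hd hj hx), h y p' q' hj]
    rfl

/-- Rank-nullity for the transpose, whose kernel consists of the alternating functions and has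
dimension 0 or 1. -/
theorem rank_connectionMatrix [CompactSpace X] [Fintype D.Pole] [Fintype D.Bigon]
    (hd : D.IsDihedral) (hg : D.IsGeneric) :
    Fintype.card D.Pole ≤ D.connectionMatrix.rank + 1 ∧
      (D.connectionMatrix.rank + 1 = Fintype.card D.Pole ↔ ∃ f, D.IsAlternating f ∧ f ≠ 0) := by
  set L := (D.connectionMatrix.transpose).mulVecLin
  have hker : ∀ f, f ∈ LinearMap.ker L ↔ D.IsAlternating f := fun f => by
    rw [LinearMap.mem_ker, Matrix.mulVecLin_apply, Matrix.mulVec_transpose,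
      vecMul_connectionMatrix_eq_zero_iff hd]
  have hrank : D.connectionMatrix.rank + Module.finrank ℝ (LinearMap.ker L) =
      Fintype.card D.Pole := by
    rw [← Matrix.rank_transpose, Matrix.rank, LinearMap.finrank_range_add_finrank_ker]
    exact Module.finrank_fintype_fun_eq_card ℝ
  have hone : ∀ v ∈ LinearMap.ker L, v ≠ 0 → Module.finrank ℝ (LinearMap.ker L) = 1 := by
    intro v hv hv0
    refine finrank_eq_one ⟨v, hv⟩ (fun h => hv0 (congrArg Subtype.val h)) fun w => ?_
    obtain ⟨p, hp⟩ := Function.ne_iff.1 hv0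
    -- The multiple of `v` that agrees with `w` at `p`: the difference is alternating and vanishes
    -- at `p`, so it vanishes everywhere, its absolute value being constant.
    refine ⟨w.1 p / v p, Subtype.ext (funext fun q => ?_)⟩
    have hdiff : D.IsAlternating ((w.1 p / v p) • v - w.1) :=
      (hker _).1 (Submodule.sub_mem _ (Submodule.smul_mem _ _ hv) w.2)
    have h1 := hdiff.abs_eq hd hg q p
    have h2 : ((w.1 p / v p) • v - w.1) p = 0 := by
      rw [Pi.sub_apply, Pi.smul_apply, smul_eq_mul, div_mul_cancel₀ _ hp, sub_self]
    rw [h2, abs_zero, abs_eq_zero, Pi.sub_apply, sub_eq_zero] at h1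
    exact h1
  by_cases hex : ∃ f, D.IsAlternating f ∧ f ≠ 0
  · obtain ⟨f, hf, hf0⟩ := hex
    have := hone f ((hker f).2 hf) hf0
    rw [this] at hrank
    exact ⟨hrank.ge, iff_of_true hrank ⟨f, hf, hf0⟩⟩
  · have hbot : LinearMap.ker L = ⊥ := by
      rw [Submodule.eq_bot_iff]
      intro f hf
      by_contra hf0
      exact hex ⟨f, (hker f).1 hf, hf0⟩
    rw [hbot, finrank_bot, add_zero] at hrank
    exact ⟨by omega, iff_of_false (by omega) hex⟩

end DevelopingMap

/-! ### The main theorem -/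

theorem mainTheorem5 {X : Type u} [MetricSpace X] [CompactSpace X] [ConnectedSpace X]
    (S : ConeSphericalSurface X) (D : DevelopingMap.{u, v} S)
    (hdihedral : D.IsDihedral) (hgeneric : D.IsGeneric) :
    Finite D.Pole ∧ Finite D.Bigon ∧
    ∀ [Fintype D.Pole] [Fintype D.Bigon],
      Fintype.card D.Pole ≤ D.connectionMatrix.rank + 1 ∧
      (D.PairOrientable ↔ D.connectionMatrix.rank + 1 = Fintype.card D.Pole) ∧
      (D.LatitudeOrientable ↔ D.LongitudeOrientable) := by
  refine ⟨hdihedral.finite_poles.to_subtype, DevelopingMap.finite_bigon hdihedral hgeneric, ?_⟩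
  intro _ _
  obtain ⟨h1, h2⟩ := DevelopingMap.rank_connectionMatrix hdihedral hgeneric
  have hlat := DevelopingMap.latitudeOrientable_iff hdihedral
  have hlon := DevelopingMap.longitudeOrientable_iff hdihedral
  refine ⟨h1, ?_, hlat.trans hlon.symm⟩
  rw [h2, DevelopingMap.PairOrientable, hlat, hlon, and_self]
  constructor
  · rintro ⟨k, hk⟩
    exact hk.exists_isAlternating hdihedral hgeneric
  · rintro ⟨f, hf, hf0⟩
    exact hf.exists_isOrientation hdihedral hgeneric hf0
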